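/- Let $G$ be a finite undirected graph without self-loops, multiple edges or isolated vertices, with $n\ge 1$ vertices and $m$ edges. The coreness $c(v)$ of a vertex $v$ is the largest $k$ such that $v$ lies in the maximal induced subgraph of $G$ all of whose degrees are at least $k$. For $k\ge 1$ the $k$-cores of $G$ are the connected components of the subgraph induced by the vertices of coreness at least $k$; the only $0$-core is the whole vertex set. The core-connectivity tree $T$ of $G$ is the rooted tree obtained as follows. Its leaves are the vertices of $G$ and its other nodes are the $k$-cores of $G$ for all $k\ge 0$; the root is the $0$-core; the parent of a vertex $u$ is the $k$-core with maximum $k$ that contains $u$; the parent of a $(k+1)$-core is the $k$-core that contains it. Finally every maximal chain of cores, each of which is the only child of the previous one, is contracted into a single node. Every node of $T$ is labelled with the minimum and the maximum coreness associated with it: the smallest and the largest $k$ among the $k$-cores contracted into it, and $c(v)$ in both cases for the leaf $v$. Then $T$ has $O(n)$ nodes, and $T$, with its labels, can be computed from the adjacency lists of $G$ in $O(n+m\,\alpha(n))$ time on a random access machine with unit-cost operations on integers of size $O(n+m)$, where $\alpha(n)=\min\{k : A(k,k)\ge n\}$ is the inverse of the Ackermann function $A$. -/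

import Mathlib

namespace CoreTree

/-! ## Coreness and cores -/

section Cores

variable {V : Type*}

/-- Every vertex of the subgraph of `G` induced by `S` has degree at least `k` in it. -/
def MinDegreeOn (G : SimpleGraph V) (k : ℕ) (S : Set V) : Prop :=
  ∀ v ∈ S, k ≤ {w | w ∈ S ∧ G.Adj v w}.ncard

/-- The vertex set of the maximal induced subgraph with all degrees at least `k`: the union of the
vertex sets of all such subgraphs. That it is itself the largest one is `isGreatest_coreSet`. -/
def coreSet (G : SimpleGraph V) (k : ℕ) : Set V :=
  {v | ∃ S : Set V, MinDegreeOn G k S ∧ v ∈ S}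

theorem isGreatest_coreSet [Finite V] (G : SimpleGraph V) (k : ℕ) :
    IsGreatest {S : Set V | MinDegreeOn G k S} (coreSet G k) := by
  refine ⟨?_, fun S hS v hv => ⟨S, hS, hv⟩⟩
  rintro v ⟨S, hS, hv⟩
  refine (hS v hv).trans (Set.ncard_le_ncard ?_ (Set.toFinite _))
  rintro w ⟨hw, ha⟩
  exact ⟨⟨S, hS, hw⟩, ha⟩

/-- The coreness of `v`: the largest `k` such that `v` lies in the maximal induced subgraph with
all degrees at least `k`. -/
noncomputable def coreness (G : SimpleGraph V) (v : V) : ℕ :=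
  sSup {k | v ∈ coreSet G k}

theorem isGreatest_coreness [Finite V] (G : SimpleGraph V) (v : V) :
    IsGreatest {k | v ∈ coreSet G k} (coreness G v) := by
  have hne : {k | v ∈ coreSet G k}.Nonempty :=
    ⟨0, Set.univ, fun _ _ => Nat.zero_le _, Set.mem_univ v⟩
  have hb : BddAbove {k | v ∈ coreSet G k} := by
    refine ⟨(Set.univ : Set V).ncard, ?_⟩
    rintro k ⟨S, hS, hv⟩
    exact (hS v hv).trans (Set.ncard_le_ncard (Set.subset_univ _) (Set.toFinite _))
  exact ⟨Nat.sSup_mem hne hb, fun k hk => le_csSup hb hk⟩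

/-- `C` is (the vertex set of) a `k`-core. For `k ≥ 1` it is a connected component of the subgraph
induced by the vertices of coreness at least `k`; by convention the only `0`-core contains all
the vertices. -/
def IsKCore (G : SimpleGraph V) (k : ℕ) (C : Set V) : Prop :=
  (k = 0 ∧ C = Set.univ) ∨
  (1 ≤ k ∧ ∃ c : (G.induce {v | k ≤ coreness G v}).ConnectedComponent,
    C = Subtype.val '' c.supp)

/-- The cores of `G`. The same vertex set may occur for several values of `k`. -/
structure Core (G : SimpleGraph V) where
  k : ℕ
  verts : Set V
  isKCore : IsKCore G k verts

end Cores

/-! ## The core-connectivity tree -/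

section Tree

variable {V : Type*}

/-- The nodes of the tree before contraction: the leaves are the vertices and the other nodes are
the cores. -/
abbrev PreNode (G : SimpleGraph V) : Type _ := V ⊕ Core G

/-- `IsChild G x y`: in the tree before contraction, `x` is a child of `y`. The parent of a vertex
`u` is the `k`-core with maximum `k` containing `u`; the parent of a `(k+1)`-core is the
`k`-core containing it. -/
def IsChild (G : SimpleGraph V) : PreNode G → PreNode G → Prop
  | Sum.inl u, Sum.inr c => u ∈ c.verts ∧ ∀ d : Core G, u ∈ d.verts → d.k ≤ c.k
  | Sum.inr d, Sum.inr c => d.k = c.k + 1 ∧ d.verts ⊆ c.verts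
  | _, Sum.inl _ => False

/-- `x` and `y` are cores, and `y` is the only child of `x`. -/
def OnlyChild (G : SimpleGraph V) (x y : PreNode G) : Prop :=
  x.isRight ∧ y.isRight ∧ ∀ z, IsChild G z x ↔ z = y

/-- The nodes of the core-connectivity tree: every maximal chain of cores, each of which is the only
child of the previous one, is contracted to a single node. (`Quot` identifies along the equivalence
relation generated by `OnlyChild`.) -/
def Node (G : SimpleGraph V) : Type _ := Quot (OnlyChild G)

/-- The leaf of the core-connectivity tree that represents the vertex `v`. -/
def leaf (G : SimpleGraph V) (v : V) : Node G := Quot.mk _ (Sum.inl v)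

/-- The root of the core-connectivity tree: the node that represents the `0`-core. -/
def root (G : SimpleGraph V) : Node G :=
  Quot.mk _ (Sum.inr ⟨0, Set.univ, Or.inl ⟨rfl, rfl⟩⟩)

/-- `IsParent G b a`: in the core-connectivity tree, `b` is the parent of `a`. -/
def IsParent (G : SimpleGraph V) (b a : Node G) : Prop :=
  a ≠ b ∧ ∃ x y : PreNode G, Quot.mk _ x = a ∧ Quot.mk _ y = b ∧ IsChild G x y

/-- The coreness value of a node before contraction: `k` for a `k`-core, and the coreness for a
vertex. -/
noncomputable def level (G : SimpleGraph V) : PreNode G → ℕ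
  | Sum.inl u => coreness G u
  | Sum.inr c => c.k

/-- The coreness values associated with a node of the core-connectivity tree; the labels of the
node are the minimum and the maximum of this set. -/
def levels (G : SimpleGraph V) (a : Node G) : Set ℕ :=
  {k | ∃ x : PreNode G, Quot.mk _ x = a ∧ level G x = k}

end Tree

/-! ## The inverse Ackermann function -/

/-- The inverse of the Ackermann function: the least `k` with `n ≤ A(k, k)`. -/
noncomputable def invAck (n : ℕ) : ℕ := sInf {k | n ≤ ack k k}

/-! ## A random access machine with unit costs and bounded words -/

/-- Programs of a random access machine with integer variables `x, y, z, …` and finitely many random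
access arrays (both named by fixed numbers in the program text). -/
inductive Prog : Type
  /-- do nothing -/
  | skip : Prog
  /-- `x := c` for a constant `c` -/
  | const (x c : ℕ) : Prog
  /-- `x := y` -/
  | copy (x y : ℕ) : Prog
  /-- `x := y + z` -/
  | add (x y z : ℕ) : Prog
  /-- `x := max (y - z) 0` -/
  | sub (x y z : ℕ) : Prog
  /-- `x := a[y]` -/
  | load (x a y : ℕ) : Prog
  /-- `a[x] := y` -/
  | store (a x y : ℕ) : Prog
  /-- `p; q` -/
  | seq (p q : Prog) : Prog
  /-- `if x < y then p else q` -/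
  | ite (x y : ℕ) (p q : Prog) : Prog
  /-- `while x < y do p` -/
  | loop (x y : ℕ) (p : Prog) : Prog

/-- A state of the machine: the values of the variables and the contents of the arrays. -/
structure State where
  var : ℕ → ℕ
  arr : ℕ → ℕ → ℕ

namespace State

/-- Assign the value `v` to the variable `x`. -/
def setVar (s : State) (x v : ℕ) : State :=
  { s with var := Function.update s.var x v }

/-- Write the value `v` into cell `i` of the array `a`. -/
def setArr (s : State) (a i v : ℕ) : State :=
  { s with arr := Function.update s.arr a (Function.update (s.arr a) i v) }

/-- All variables and array cells hold numbers that are at most `W`. -/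
def BoundedBy (s : State) (W : ℕ) : Prop :=
  (∀ x, s.var x ≤ W) ∧ ∀ a i, s.arr a i ≤ W

end State

/-- `Exec W p s t s'`: on a machine whose words hold the numbers `0, …, W`, the program `p` started
in state `s` halts in state `s'` after exactly `t` steps. Every basic instruction and every
evaluation of a test takes one step. A program that creates a number exceeding `W` has no
execution. -/
inductive Exec (W : ℕ) : Prog → State → ℕ → State → Prop
  | skip (s : State) : Exec W Prog.skip s 1 s
  | const (s : State) (x c : ℕ) (h : c ≤ W) :
      Exec W (Prog.const x c) s 1 (s.setVar x c)
  | copy (s : State) (x y : ℕ) :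
      Exec W (Prog.copy x y) s 1 (s.setVar x (s.var y))
  | add (s : State) (x y z : ℕ) (h : s.var y + s.var z ≤ W) :
      Exec W (Prog.add x y z) s 1 (s.setVar x (s.var y + s.var z))
  | sub (s : State) (x y z : ℕ) :
      Exec W (Prog.sub x y z) s 1 (s.setVar x (s.var y - s.var z))
  | load (s : State) (x a y : ℕ) :
      Exec W (Prog.load x a y) s 1 (s.setVar x (s.arr a (s.var y)))
  | store (s : State) (a x y : ℕ) :
      Exec W (Prog.store a x y) s 1 (s.setArr a (s.var x) (s.var y))
  | seq {p q : Prog} {s s' s'' : State} {t t' : ℕ}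
      (hp : Exec W p s t s') (hq : Exec W q s' t' s'') :
      Exec W (Prog.seq p q) s (t + t') s''
  | ite_true {x y : ℕ} {p q : Prog} {s s' : State} {t : ℕ}
      (h : s.var x < s.var y) (hp : Exec W p s t s') :
      Exec W (Prog.ite x y p q) s (t + 1) s'
  | ite_false {x y : ℕ} {p q : Prog} {s s' : State} {t : ℕ}
      (h : ¬ s.var x < s.var y) (hq : Exec W q s t s') :
      Exec W (Prog.ite x y p q) s (t + 1) s'
  | loop_true {x y : ℕ} {p : Prog} {s s' s'' : State} {t t' : ℕ}
      (h : s.var x < s.var y) (hp : Exec W p s t s')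
      (hl : Exec W (Prog.loop x y p) s' t' s'') :
      Exec W (Prog.loop x y p) s (t + t' + 1) s''
  | loop_false {x y : ℕ} {p : Prog} {s : State} (h : ¬ s.var x < s.var y) :
      Exec W (Prog.loop x y p) s 1 s

/-! ## Input and output formats -/

/-- The input: the graph `G` on the vertices `0, …, n - 1`, as adjacency lists in arbitrary order.
Variable `0` holds `n`; the neighbours of the vertex `v` are listed, once each, in the cells `i` of
array `1` with `off v ≤ i < off (v + 1)`, where `off` is array `0`. All other variables and cells
are `0`. -/
structure IsInput {n : ℕ} (G : SimpleGraph (Fin n)) (s : State) : Prop where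
  var_zero : s.var 0 = n
  var_other : ∀ x, x ≠ 0 → s.var x = 0
  off_zero : s.arr 0 0 = 0
  off_succ : ∀ v : Fin n, s.arr 0 (v + 1) = s.arr 0 v + (G.neighborSet v).ncard
  off_other : ∀ i, n < i → s.arr 0 i = 0
  adj_lt : ∀ i, i < s.arr 0 n → s.arr 1 i < n
  adj_iff : ∀ v w : Fin n,
    G.Adj v w ↔ ∃ i, s.arr 0 v ≤ i ∧ i < s.arr 0 (v + 1) ∧ s.arr 1 i = w
  adj_other : ∀ i, s.arr 0 n ≤ i → s.arr 1 i = 0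
  arr_other : ∀ a, 2 ≤ a → ∀ i, s.arr a i = 0

/-- The output: the core-connectivity tree of `G`, with its nodes numbered from `0` to `N - 1`, where
`N` is held by variable `0` and the leaf of the vertex `v` has the number `v`. Array `2` gives the
parent of every node (the root points to itself), arrays `3` and `4` give the minimum and the
maximum coreness of every node. -/
def IsOutput {n : ℕ} (G : SimpleGraph (Fin n)) (s : State) : Prop :=
  ∃ φ : Node G ≃ Fin (s.var 0),
    (∀ v : Fin n, (φ (leaf G v) : ℕ) = v) ∧
    s.arr 2 (φ (root G)) = φ (root G) ∧
    (∀ b, ¬ IsParent G b (root G)) ∧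
    (∀ a, a ≠ root G → ∃ b, s.arr 2 (φ a) = φ b ∧ ∀ b', IsParent G b' a ↔ b' = b) ∧
    (∀ a, IsLeast (levels G a) (s.arr 3 (φ a))) ∧
    (∀ a, IsGreatest (levels G a) (s.arr 4 (φ a)))

end CoreTree

namespace CoreTree

/-! ## Coreness and connectivity inside cores -/

section SameCore

variable {V : Type*} (G : SimpleGraph V)

/-! Give every edge the smaller coreness of its two ends as weight. For `k ≥ 1`, distinct vertices
share a `k`-core iff a path of edges of weight at least `k` joins them, so the cores record
bottleneck connectivity. Prim's algorithm with maximum weights linearises it: if `o` is the order of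
visits and `q l` the weight by which `o l` was reached, then `o i` and `o j` with `i ≤ j` share a
`k`-core iff `k ≤ q l` for all `i < l ≤ j` (`CoreOrder.sameCore_iff`). Cores are thus intervals of
positions. Without isolated vertices each of them has two vertices, so it contains a gap between
consecutive positions, and it is the core of its lightest gap (`CoreOrder.exists_gap`). Contraction
identifies exactly the cores with equal vertex sets (`nodeKey_injective`, `mk_core_eq_iff`). Hence
the nodes are `n` leaves and at most `n` gap cores.

The inner nodes form the Cartesian tree of the sequence `q`, with equal minima of one range merged.
It is built by appending positions and walking from the last node towards the root
(`GapTree.extend_old`, `GapTree.extend_new`). `OutputSpec.isOutput` identifies it with the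
core-connectivity tree.

All of this takes linear time. Coreness is found by peeling vertices of minimum degree from buckets.
The weights are below `n`, so the queue of the search is an array of buckets as well; a visit raises
the current weight by at most the coreness of the new vertex, hence by at most its degree. A walk
that starts at gap `l` has at most `q l + 1` steps, and `q l` is at most the coreness of `o l`; the
coreness values sum to at most the number of arcs, `2m`. The total is `O(n + m)`, and `α` enters
only through `α(n) ≥ 1` for `n ≥ 2`. -/

theorem coreSet_anti {j k : ℕ} (h : j ≤ k) : coreSet G k ⊆ coreSet G j := by
  rintro v ⟨S, hS, hv⟩
  exact ⟨S, fun w hw => h.trans (hS w hw), hv⟩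

theorem mem_coreSet_iff [Finite V] {k : ℕ} {v : V} : v ∈ coreSet G k ↔ k ≤ coreness G v :=
  ⟨fun h => (isGreatest_coreness G v).2 h,
    fun h => coreSet_anti G h (isGreatest_coreness G v).1⟩

/-- Every vertex has at least `coreness G v` neighbours whose coreness is at least its own. -/
theorem le_ncard_coreness [Finite V] {k : ℕ} {v : V} (h : k ≤ coreness G v) :
    k ≤ {w | k ≤ coreness G w ∧ G.Adj v w}.ncard := by
  have := (isGreatest_coreSet G k).1 v ((mem_coreSet_iff G).2 h)
  simpa only [mem_coreSet_iff] using this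

theorem coreness_le_ncard [Finite V] (v : V) : coreness G v ≤ (G.neighborSet v).ncard :=
  (le_ncard_coreness G le_rfl).trans (Set.ncard_le_ncard (fun _ hw => hw.2) (Set.toFinite _))

theorem one_le_coreness [Finite V] (hG : ∀ v, ∃ w, G.Adj v w) (v : V) : 1 ≤ coreness G v := by
  rw [← mem_coreSet_iff]
  refine ⟨Set.univ, fun u _ => ?_, Set.mem_univ v⟩
  obtain ⟨w, hw⟩ := hG u
  exact (Set.ncard_pos (Set.toFinite _)).2 ⟨w, Set.mem_univ w, hw⟩

/-- The edges of `G` both of whose ends have coreness at least `k`. -/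
def coreGraph (k : ℕ) : SimpleGraph V where
  Adj u v := G.Adj u v ∧ k ≤ coreness G u ∧ k ≤ coreness G v
  symm := ⟨fun _ _ h => ⟨h.1.symm, h.2.2, h.2.1⟩⟩
  loopless := ⟨fun _ h => h.1.ne rfl⟩

/-- `u` and `v` lie in the same `k`-core, or are equal. -/
def SameCore (k : ℕ) (u v : V) : Prop := k = 0 ∨ (coreGraph G k).Reachable u v

variable {G}

namespace SameCore

theorem refl (k : ℕ) (u : V) : SameCore G k u u := Or.inr (SimpleGraph.Reachable.refl u)

theorem zero (u v : V) : SameCore G 0 u v := Or.inl rfl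

theorem symm {k : ℕ} {u v : V} (h : SameCore G k u v) : SameCore G k v u :=
  h.imp id SimpleGraph.Reachable.symm

theorem trans {k : ℕ} {u v w : V} (h : SameCore G k u v) (h' : SameCore G k v w) :
    SameCore G k u w := by
  rcases h with h | h
  · exact Or.inl h
  · exact h'.imp id h.trans

theorem mono {j k : ℕ} {u v : V} (hjk : j ≤ k) (h : SameCore G k u v) : SameCore G j u v := by
  rcases h with rfl | h
  · exact Or.inl (Nat.le_zero.1 hjk)
  · exact Or.inr (h.mono (show coreGraph G k ≤ coreGraph G j from
      fun _ _ ha => ⟨ha.1, hjk.trans ha.2.1, hjk.trans ha.2.2⟩))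

theorem of_adj {k : ℕ} {u v : V} (h : G.Adj u v) (hu : k ≤ coreness G u)
    (hv : k ≤ coreness G v) : SameCore G k u v :=
  Or.inr (SimpleGraph.Adj.reachable (G := coreGraph G k) ⟨h, hu, hv⟩)

/-- A path between the inside and the outside of `A` inside a `k`-core crosses the boundary. -/
theorem exists_crossing {k : ℕ} (hk : 1 ≤ k) {u v : V} (h : SameCore G k u v) {A : Set V}
    (hu : u ∈ A) (hv : v ∉ A) :
    ∃ x ∈ A, ∃ y ∉ A, G.Adj x y ∧ k ≤ coreness G x ∧ k ≤ coreness G y := by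
  obtain ⟨p⟩ := h.resolve_left (by omega)
  obtain ⟨d, -, h1, h2⟩ := p.exists_boundary_dart A hu hv
  exact ⟨_, h1, _, h2, d.adj⟩

/-- A path to a different vertex must leave `u` by an edge of `coreGraph G k`. -/
theorem le_coreness_left {k : ℕ} {u v : V} (h : SameCore G k u v) (hne : u ≠ v) :
    k ≤ coreness G u := by
  rcases Nat.eq_zero_or_pos k with rfl | hk
  · exact Nat.zero_le _
  · obtain ⟨x, hx, y, -, -, hc, -⟩ :=
      h.exists_crossing hk (A := {u}) rfl (fun h => hne (Set.mem_singleton_iff.1 h).symm)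
    rwa [Set.mem_singleton_iff.1 hx] at hc

theorem le_coreness_right {k : ℕ} {u v : V} (h : SameCore G k u v) (hu : k ≤ coreness G u) :
    k ≤ coreness G v := by
  by_cases hne : v = u
  · exact hne ▸ hu
  · exact h.symm.le_coreness_left hne

end SameCore

/-- No core is a single vertex. This is where isolated vertices are excluded, and it is what makes
every core visible as a gap of a core order. -/
theorem exists_sameCore_ne [Finite V] (hG : ∀ v, ∃ w, G.Adj v w) {k : ℕ} {u : V}
    (hu : k ≤ coreness G u) : ∃ v, v ≠ u ∧ SameCore G k u v := by
  rcases Nat.eq_zero_or_pos k with rfl | hk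
  · obtain ⟨w, hw⟩ := hG u
    exact ⟨w, hw.ne', SameCore.zero _ _⟩
  · obtain ⟨w, hw, ha⟩ := Set.nonempty_of_ncard_ne_zero
      (show {w | k ≤ coreness G w ∧ G.Adj u w}.ncard ≠ 0 from
        (hk.trans_le (le_ncard_coreness G hu)).ne')
    exact ⟨w, ha.ne', SameCore.of_adj ha hu hw⟩

/-- The disjunct `k = 0` in `SameCore` absorbs the convention for the `0`-core, so that all cores
become classes of a single relation. -/
theorem isKCore_iff [Nonempty V] {k : ℕ} {C : Set V} :
    IsKCore G k C ↔ ∃ u, k ≤ coreness G u ∧ C = {v | SameCore G k u v} := by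
  have key : ∀ {k : ℕ}, 1 ≤ k → ∀ u (hu : k ≤ coreness G u),
      Subtype.val '' ((G.induce {v | k ≤ coreness G v}).connectedComponentMk ⟨u, hu⟩).supp
        = {v | SameCore G k u v} := by
    intro k hk u hu
    ext v
    simp only [Set.mem_image, Subtype.exists, exists_and_right, exists_eq_right,
      Set.mem_ofPred_eq, SimpleGraph.ConnectedComponent.mem_supp_iff,
      SimpleGraph.ConnectedComponent.eq]
    constructor
    · rintro ⟨hv, h⟩
      let f : G.induce {v | k ≤ coreness G v} →g coreGraph G k :=
        ⟨Subtype.val, fun {a b} hab => ⟨hab, a.2, b.2⟩⟩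
      exact Or.inr (h.map f).symm
    · intro h
      obtain ⟨p⟩ := h.resolve_left (by omega)
      clear h
      induction p with
      | nil => exact ⟨hu, SimpleGraph.Reachable.refl _⟩
      | cons hadj p ih =>
        obtain ⟨hv, h⟩ := ih hadj.2.2
        refine ⟨hv, h.trans (SimpleGraph.Adj.reachable ?_)⟩
        exact hadj.1.symm
  constructor
  · rintro (⟨rfl, rfl⟩ | ⟨hk, c, rfl⟩)
    · obtain ⟨u⟩ := ‹Nonempty V›
      exact ⟨u, Nat.zero_le _, (Set.eq_univ_of_forall fun v => SameCore.zero u v).symm⟩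
    · induction c using SimpleGraph.ConnectedComponent.ind with
      | h u => exact ⟨u.1, u.2, key hk u.1 u.2⟩
  · rintro ⟨u, hu, rfl⟩
    rcases Nat.eq_zero_or_pos k with rfl | hk
    · exact Or.inl ⟨rfl, Set.eq_univ_of_forall fun v => SameCore.zero u v⟩
    · exact Or.inr ⟨hk, _, (key hk u hu).symm⟩

/-- The `k`-core of a vertex. -/
def coreOf [Nonempty V] (G : SimpleGraph V) (k : ℕ) (u : V) (h : k ≤ coreness G u) : Core G :=
  ⟨k, {v | SameCore G k u v}, isKCore_iff.2 ⟨u, h, rfl⟩⟩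

theorem Core.verts_eq [Nonempty V] (c : Core G) {u : V} (hu : u ∈ c.verts) :
    c.verts = {v | SameCore G c.k u v} := by
  obtain ⟨x, -, hC⟩ := isKCore_iff.1 c.isKCore
  rw [hC] at hu ⊢
  ext v
  exact ⟨fun h => hu.symm.trans h, fun h => SameCore.trans hu h⟩

theorem Core.le_coreness [Nonempty V] (c : Core G) {u : V} (hu : u ∈ c.verts) :
    c.k ≤ coreness G u := by
  obtain ⟨x, hx, hC⟩ := isKCore_iff.1 c.isKCore
  rw [hC] at hu
  exact SameCore.le_coreness_right hu hx

theorem Core.nonempty [Nonempty V] (c : Core G) : c.verts.Nonempty := by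
  obtain ⟨x, -, hC⟩ := isKCore_iff.1 c.isKCore
  exact ⟨x, hC ▸ SameCore.refl _ _⟩

theorem Core.ext' {c d : Core G} (hk : c.k = d.k) (hv : c.verts = d.verts) : c = d := by
  cases c; cases d; cases hk; cases hv; rfl

end SameCore


/-! ## Core orders -/

section Order

variable {V : Type*} {G : SimpleGraph V}

/-- The first `cnt` entries of `o` list vertices in the order of a maximum-weight-edge-first search
(Prim's algorithm) for the edge weights `min (coreness u) (coreness v)`, and `q i` is the weight
of the edge by which the `i`-th vertex was reached (`0` for the first vertex of a component). -/
structure CoreOrder (G : SimpleGraph V) (o : ℕ → V) (q : ℕ → ℕ) (cnt : ℕ) : Prop where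
  inj : ∀ i j, i < cnt → j < cnt → o i = o j → i = j
  link : ∀ l, l + 1 < cnt → SameCore G (q (l + 1)) (o l) (o (l + 1))
  -- Maximality: when position `l` is filled, no vertex `z` outside the prefix is attached to the
  -- prefix more strongly than `q l`.
  gap : ∀ i l, i < l → l < cnt → ∀ k z, (∀ j < l, o j ≠ z) → SameCore G k (o i) z → k ≤ q l
  -- The search does not leave a `k`-core before exhausting it: while some `z` of the core of `o i`
  -- is unvisited, the latest vertex lies in that core.
  last : ∀ i l, i < cnt → l + 1 = cnt → ∀ k z, (∀ j < cnt, o j ≠ z) → SameCore G k (o i) z →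
    SameCore G k (o i) (o l)

namespace CoreOrder

theorem nil (o : ℕ → V) (q : ℕ → ℕ) : CoreOrder G o q 0 :=
  ⟨by omega, by omega, by omega, by omega⟩

theorem congr {o o' : ℕ → V} {q q' : ℕ → ℕ} {cnt : ℕ} (h : CoreOrder G o q cnt)
    (ho : ∀ i < cnt, o' i = o i) (hq : ∀ i < cnt, q' i = q i) : CoreOrder G o' q' cnt where
  inj i j hi hj := by rw [ho i hi, ho j hj]; exact h.inj i j hi hj
  link l hl := by rw [ho l (by omega), ho _ hl, hq _ hl]; exact h.link l hl
  gap i l hil hl k z hz hs := by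
    rw [hq l hl]
    rw [ho i (by omega)] at hs
    exact h.gap i l hil hl k z (fun j hj => ho j (by omega) ▸ hz j hj) hs
  last i l hi hl k z hz hs := by
    rw [ho i hi] at hs ⊢
    rw [ho l (by omega)]
    exact h.last i l hi hl k z (fun j hj => ho j hj ▸ hz j hj) hs

/-- The weight at position `0` is irrelevant. -/
theorem congr_weight {o : ℕ → V} {q q' : ℕ → ℕ} {cnt : ℕ} (h : CoreOrder G o q cnt)
    (hq : ∀ i, 1 ≤ i → q' i = q i) : CoreOrder G o q' cnt where
  inj := h.inj
  link l hl := by rw [hq _ (by omega)]; exact h.link l hl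
  gap i l hil hl k z hz hs := by rw [hq l (by omega)]; exact h.gap i l hil hl k z hz hs
  last := h.last

/-- The search continues with an unvisited end of a crossing edge of maximum weight, or anywhere if
no edge crosses. -/
theorem extend {o : ℕ → V} {q : ℕ → ℕ} {cnt : ℕ} (h : CoreOrder G o q cnt)
    (hw : ∀ j < cnt, o j ≠ o cnt)
    (hmax : ∀ j < cnt, ∀ y, (∀ i < cnt, o i ≠ y) → G.Adj (o j) y →
      min (coreness G (o j)) (coreness G y) ≤ q cnt)
    (hq : q cnt = 0 ∨ ∃ j < cnt, SameCore G (q cnt) (o j) (o cnt)) :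
    CoreOrder G o q (cnt + 1) := by
  -- A path from the visited vertices to `z` in a `k`-core crosses the boundary by an edge of weight
  -- at least `k`, and `hmax` bounds all crossing weights.
  have hgap : ∀ i < cnt, ∀ k z, (∀ j < cnt, o j ≠ z) → SameCore G k (o i) z → k ≤ q cnt := by
    intro i hi k z hz hs
    rcases Nat.eq_zero_or_pos k with rfl | hk
    · exact Nat.zero_le _
    · obtain ⟨x, ⟨j, hj, rfl⟩, y, hy, ha, hx, hy'⟩ :=
        hs.exists_crossing hk (A := {x | ∃ j < cnt, o j = x}) ⟨i, hi, rfl⟩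
          (by rintro ⟨j, hj, e⟩; exact hz j hj e)
      exact (le_min hx hy').trans (hmax j hj y (fun i hi e => hy ⟨i, hi, e⟩) ha)
  -- The new vertex was unvisited, so `last` applies to it: the previous vertex shares the `q
  -- cnt`-core of `o j`, although the edge used starts at `o j`.
  have hlast : ∀ l, l + 1 = cnt → SameCore G (q cnt) (o l) (o cnt) := by
    intro l hl
    rcases hq with h0 | ⟨j, hj, hs⟩
    · exact Or.inl h0
    · exact (h.last j l hj hl _ _ hw hs).symm.trans hs
  refine ⟨?_, ?_, ?_, ?_⟩
  · intro i j hi hj e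
    rcases Nat.lt_succ_iff_lt_or_eq.1 hi with hi' | rfl <;>
      rcases Nat.lt_succ_iff_lt_or_eq.1 hj with hj' | rfl
    · exact h.inj i j hi' hj' e
    · exact absurd e (hw i hi')
    · exact absurd e.symm (hw j hj')
    · rfl
  · intro l hl
    rcases Nat.lt_succ_iff_lt_or_eq.1 hl with hl' | rfl
    · exact h.link l hl'
    · exact hlast l rfl
  · intro i l hil hl k z hz hs
    rcases Nat.lt_succ_iff_lt_or_eq.1 hl with hl' | rfl
    · exact h.gap i l hil hl' k z hz hs
    · exact hgap i hil k z hz hs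
  · intro i l hi hl k z hz hs
    obtain rfl : l = cnt := by omega
    rcases Nat.lt_succ_iff_lt_or_eq.1 hi with hi' | rfl
    · have hz' : ∀ j < l, o j ≠ z := fun j hj => hz j (by omega)
      have hkq := hgap i hi' k z hz' hs
      refine (h.last i (l - 1) hi' (by omega) k z hz' hs).trans ?_
      exact (hlast (l - 1) (by omega)).mono hkq
    · exact SameCore.refl _ _

/-- Forwards, `o j` itself is the unvisited vertex to which `gap` applies; backwards, the links are
chained. -/
theorem sameCore_iff {o : ℕ → V} {q : ℕ → ℕ} {cnt : ℕ} (h : CoreOrder G o q cnt) {i j k : ℕ}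
    (hij : i ≤ j) (hj : j < cnt) :
    SameCore G k (o i) (o j) ↔ ∀ l, i < l → l ≤ j → k ≤ q l := by
  constructor
  · intro hs l hil hlj
    exact h.gap i l hil (by omega) k (o j)
      (fun m hm e => by have := h.inj m j (by omega) hj e; omega) hs
  · intro hl
    induction j, hij using Nat.le_induction with
    | base => exact SameCore.refl _ _
    | succ j hij ih =>
      exact (ih (by omega) fun l h1 h2 => hl l h1 (by omega)).trans
        ((h.link j hj).mono (hl (j + 1) (by omega) le_rfl))

/-- Every finite graph has a core order. -/
theorem exists_full [Finite V] [Nonempty V] (G : SimpleGraph V) :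
    ∃ o q, CoreOrder G o q (Nat.card V) := by
  suffices ∀ cnt ≤ Nat.card V, ∃ o q, CoreOrder G o q cnt from this _ le_rfl
  intro cnt
  induction cnt with
  | zero =>
    obtain ⟨v⟩ := ‹Nonempty V›
    exact fun _ => ⟨fun _ => v, fun _ => 0, nil _ _⟩
  | succ cnt ih =>
    intro hc
    obtain ⟨o, q, h⟩ := ih (by omega)
    have hz : ∃ z, ∀ j < cnt, o j ≠ z := by
      by_contra! hcon
      have hs : Function.Surjective (fun j : Fin cnt => o j) := fun z => by
        obtain ⟨j, hj, e⟩ := hcon z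
        exact ⟨⟨j, hj⟩, e⟩
      have := Nat.card_le_card_of_surjective _ hs
      simp at this
      omega
    suffices ∃ w k, (∀ j < cnt, o j ≠ w) ∧
        (∀ j < cnt, ∀ y, (∀ i < cnt, o i ≠ y) → G.Adj (o j) y →
          min (coreness G (o j)) (coreness G y) ≤ k) ∧
        (k = 0 ∨ ∃ j < cnt, SameCore G k (o j) w) by
      obtain ⟨w, k, hw, hmax, hk⟩ := this
      have ho : ∀ i < cnt, Function.update o cnt w i = o i :=
        fun i hi => Function.update_of_ne (by omega) _ _
      refine ⟨Function.update o cnt w, Function.update q cnt k, extend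
        (h.congr ho fun i hi => Function.update_of_ne (by omega) _ _) ?_ ?_ ?_⟩
      · intro j hj
        simpa [ho j hj] using hw j hj
      · intro j hj y hy ha
        rw [ho j hj] at ha ⊢
        simpa using hmax j hj y (fun i hi => ho i hi ▸ hy i hi) ha
      · simp only [Function.update_self]
        exact hk.imp id fun ⟨j, hj, hs⟩ => ⟨j, hj, (ho j hj).symm ▸ hs⟩
    -- The weights of the crossing edges. An edge attaining the maximum is followed; if there is
    -- none, any unvisited vertex starts a new component with weight `0`.
    let K : Set ℕ := {k | ∃ j < cnt, ∃ y, (∀ i < cnt, o i ≠ y) ∧ G.Adj (o j) y ∧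
      k = min (coreness G (o j)) (coreness G y)}
    by_cases hK : K.Nonempty
    · have hfin : K.Finite := by
        refine (Set.finite_range fun p : V × V =>
          min (coreness G p.1) (coreness G p.2)).subset ?_
        rintro k ⟨j, -, y, -, -, rfl⟩
        exact ⟨(o j, y), rfl⟩
      have hmem := Nat.sSup_mem hK hfin.bddAbove
      obtain ⟨j, hj, y, hy, ha, e⟩ := hmem
      refine ⟨y, sSup K, hy, fun i hi z hz hz' =>
        le_csSup hfin.bddAbove ⟨i, hi, z, hz, hz', rfl⟩, Or.inr ⟨j, hj, ?_⟩⟩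
      exact SameCore.of_adj ha (e ▸ min_le_left _ _) (e ▸ min_le_right _ _)
    · obtain ⟨z, hz⟩ := hz
      refine ⟨z, 0, hz, fun i hi y hy ha => absurd ⟨_, i, hi, y, hy, ha, rfl⟩ hK, Or.inl rfl⟩

end CoreOrder

end Order


/-! ## Nodes of the core-connectivity tree -/

section Nodes

variable {V : Type*} {G : SimpleGraph V}

/-- A vertex of `c` with coreness exactly `c.k` would be a leaf child, which is not a core. Any
other vertex of `c` lies in a child core of level `c.k + 1`, and that child can only be `d`. -/
theorem verts_eq_of_onlyChild [Nonempty V] {c d : Core G}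
    (h : OnlyChild G (Sum.inr c) (Sum.inr d)) : c.verts = d.verts := by
  obtain ⟨-, -, h⟩ := h
  have hd : IsChild G (Sum.inr d) (Sum.inr c) := (h _).2 rfl
  refine Set.Subset.antisymm (fun v hv => ?_) hd.2
  rcases (c.le_coreness hv).eq_or_lt with he | hlt
  · have : IsChild G (Sum.inl v) (Sum.inr c) := ⟨hv, fun e he' => he ▸ e.le_coreness he'⟩
    cases (h _).1 this
  · have : IsChild G (Sum.inr (coreOf G (c.k + 1) v hlt)) (Sum.inr c) := by
      refine ⟨rfl, fun w hw => ?_⟩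
      rw [c.verts_eq hv]
      exact SameCore.mono (Nat.le_succ _) hw
    have := (h _).1 this
    rw [← Sum.inr.inj this]
    exact SameCore.refl _ _

/-- Induction on the difference of levels: the core one level above `c` is squeezed between `c` and
`d`, so it has the same vertices and is the only child of `c`. Leaves are no children of `c` because
`d` contains them at a higher level. -/
theorem mk_eq_of_verts_eq [Nonempty V] (j : ℕ) {c d : Core G} (hk : d.k = c.k + j)
    (hv : c.verts = d.verts) :
    (Quot.mk (OnlyChild G) (Sum.inr c) : Node G) = Quot.mk _ (Sum.inr d) := by
  induction j generalizing c with
  | zero => rw [Core.ext' hk.symm hv]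
  | succ j ih =>
    obtain ⟨u, hu⟩ := d.nonempty
    have hdu := d.le_coreness hu
    let e := coreOf G (c.k + 1) u (by omega)
    have hev : c.verts = e.verts := by
      refine Set.Subset.antisymm ?_ fun w hw => ?_
      · rw [hv, d.verts_eq hu]
        exact fun w hw => SameCore.mono (by omega) hw
      · rw [c.verts_eq (hv ▸ hu)]
        exact SameCore.mono (Nat.le_succ _) hw
    refine Eq.trans (Quot.sound ⟨rfl, rfl, fun z => ⟨fun hz => ?_, ?_⟩⟩)
      (ih (c := e) (by rw [hk]; change _ = c.k + 1 + j; omega) (hev ▸ hv))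
    · rcases z with v | f
      · have := hz.2 d (hv ▸ hz.1)
        omega
      · obtain ⟨w, hw⟩ := f.nonempty
        have hwe : w ∈ e.verts := hev ▸ hz.2 hw
        congr 1
        refine Core.ext' hz.1 ?_
        rw [f.verts_eq hw, e.verts_eq hwe, hz.1]
        rfl
    · rintro rfl
      exact ⟨rfl, hev.ge⟩

/-- The vertex or the vertex set of a node. -/
def nodeKey [Nonempty V] : Node G → V ⊕ Set V :=
  Quot.lift (Sum.map id Core.verts) (by
    rintro (u | c) (v | d) h
    · exact absurd h.1 (by simp)
    · exact absurd h.1 (by simp)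
    · exact absurd h.2.1 (by simp)
    · exact congrArg Sum.inr (verts_eq_of_onlyChild h))

/-- With this the quotient is never touched again: inner nodes are compared by their vertex sets. -/
theorem nodeKey_injective [Nonempty V] : Function.Injective (nodeKey (G := G)) := by
  rintro ⟨u | c⟩ ⟨v | d⟩ h
  · exact congrArg (leaf G) (Sum.inl.inj h)
  · cases h
  · cases h
  · have hv : c.verts = d.verts := Sum.inr.inj h
    rcases le_total c.k d.k with hk | hk
    · exact mk_eq_of_verts_eq (d.k - c.k) (by omega) hv
    · exact (mk_eq_of_verts_eq (c.k - d.k) (by omega) hv.symm).symm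

theorem mk_core_eq_iff [Nonempty V] {c d : Core G} :
    (Quot.mk (OnlyChild G) (Sum.inr c) : Node G) = Quot.mk _ (Sum.inr d) ↔ c.verts = d.verts :=
  ⟨fun h => Sum.inr.inj (congrArg nodeKey h : _),
    fun h => nodeKey_injective (congrArg Sum.inr h)⟩

theorem mk_eq_leaf_iff [Nonempty V] {x : PreNode G} {v : V} :
    (Quot.mk (OnlyChild G) x : Node G) = Quot.mk _ (Sum.inl v) ↔ x = Sum.inl v := by
  refine ⟨fun h => ?_, fun h => h ▸ rfl⟩
  have := congrArg nodeKey h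
  rcases x with u | c
  · exact congrArg Sum.inl (Sum.inl.inj this)
  · cases this

theorem levels_leaf [Nonempty V] (v : V) : levels G (leaf G v) = {coreness G v} := by
  ext k
  constructor
  · rintro ⟨x, hx, rfl⟩
    rw [mk_eq_leaf_iff.1 hx]
    rfl
  · rintro rfl
    exact ⟨Sum.inl v, rfl, rfl⟩

theorem mem_levels_core [Nonempty V] {c : Core G} {k : ℕ} :
    k ∈ levels G (Quot.mk _ (Sum.inr c)) ↔ IsKCore G k c.verts := by
  constructor
  · rintro ⟨x, hx, rfl⟩
    rcases x with u | d
    · exact absurd (mk_eq_leaf_iff.1 hx.symm) (by simp)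
    · rw [← mk_core_eq_iff.1 hx]
      exact d.isKCore
  · intro h
    exact ⟨Sum.inr ⟨k, c.verts, h⟩, mk_core_eq_iff.2 rfl, rfl⟩

end Nodes

/-! ## Ranges of positions -/

/-- The values of `g` between `a` and `b` (inclusive, in either order) are at least `k`. -/
def Above (g : ℕ → ℕ) (k a b : ℕ) : Prop :=
  ∀ j, (a ≤ j ∧ j ≤ b ∨ b ≤ j ∧ j ≤ a) → k ≤ g j

namespace Above

variable {g : ℕ → ℕ} {k a b c : ℕ}

theorem refl (h : k ≤ g a) : Above g k a a := fun j hj => by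
  obtain rfl : j = a := by omega
  exact h

theorem symm (h : Above g k a b) : Above g k b a := fun j hj => h j (by omega)

theorem trans (h : Above g k a b) (h' : Above g k b c) : Above g k a c := fun j hj => by
  by_cases hb : a ≤ j ∧ j ≤ b ∨ b ≤ j ∧ j ≤ a
  · exact h j hb
  · exact h' j (by omega)

theorem mono {k' : ℕ} (h : Above g k a b) (hk : k' ≤ k) : Above g k' a b :=
  fun j hj => hk.trans (h j hj)

theorem left (h : Above g k a b) : k ≤ g a := h a (by omega)

theorem right (h : Above g k a b) : k ≤ g b := h b (by omega)

theorem zero : Above g 0 a b := fun _ _ => Nat.zero_le _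

theorem succ (h : Above g k a b) (hb : k ≤ g (b + 1)) : Above g k a (b + 1) :=
  h.trans fun j hj => by
    rcases (show j = b ∨ j = b + 1 by omega) with rfl | rfl
    · exact h.right
    · exact hb

theorem of_succ (h : Above g k a (b + 1)) (hab : a ≤ b) : Above g k a b :=
  fun j hj => h j (by omega)

end Above

/-! ### Cores as gaps of a core order -/

namespace CoreOrder

variable {n : ℕ} {G : SimpleGraph (Fin n)} {o : ℕ → Fin n} {q : ℕ → ℕ}

theorem exists_eq (h : CoreOrder G o q n) (v : Fin n) : ∃ i < n, o i = v := by
  have hi : Function.Injective (fun i : Fin n => o i) :=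
    fun i j e => Fin.ext (h.inj i j i.2 j.2 e)
  obtain ⟨i, hi⟩ := (Finite.injective_iff_surjective.1 hi) v
  exact ⟨i, i.2, hi⟩

theorem sameCore_gap (h : CoreOrder G o q n) {l : ℕ} (h1 : 1 ≤ l) (hl : l < n) :
    SameCore G (q l) (o l) (o (l - 1)) := by
  have := h.link (l - 1) (by omega)
  rw [Nat.sub_add_cancel h1] at this
  exact this.symm

theorem le_coreness (h : CoreOrder G o q n) {l : ℕ} (h1 : 1 ≤ l) (hl : l < n) :
    q l ≤ coreness G (o l) :=
  (h.sameCore_gap h1 hl).le_coreness_left fun e => by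
    have := h.inj _ _ hl (by omega) e
    omega

theorem le_of_sameCore (h : CoreOrder G o q n) {i j k l : ℕ} (hi : i < n) (hj : j < n)
    (hs : SameCore G k (o i) (o j)) (h1 : min i j < l) (h2 : l ≤ max i j) : k ≤ q l := by
  rcases le_total i j with hij | hij
  · exact (h.sameCore_iff hij hj).1 hs l (by omega) (by omega)
  · exact (h.sameCore_iff hij hi).1 hs.symm l (by omega) (by omega)

theorem sameCore_of_le (h : CoreOrder G o q n) {i j k : ℕ} (hi : i < n) (hj : j < n)
    (hl : ∀ l, min i j < l → l ≤ max i j → k ≤ q l) : SameCore G k (o i) (o j) := by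
  rcases le_total i j with hij | hij
  · exact (h.sameCore_iff hij hj).2 fun l h1 h2 => hl l (by omega) (by omega)
  · exact ((h.sameCore_iff hij hi).2 fun l h1 h2 => hl l (by omega) (by omega)).symm

theorem sameCore_of_above (h : CoreOrder G o q n) {l l' k : ℕ} (hl : l < n) (hl' : l' < n)
    (ha : Above q k l l') : SameCore G k (o l) (o l') :=
  h.sameCore_of_le hl hl' fun j _ _ => ha j (by omega)

/-- The gap in front of the leftmost position does not separate the two vertices, so its weight
needs a hypothesis of its own. -/
theorem above_of_sameCore (h : CoreOrder G o q n) {l l' k : ℕ} (hl : l < n) (hl' : l' < n)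
    (hs : SameCore G k (o l) (o l')) (hq : k ≤ q l) (hq' : k ≤ q l') : Above q k l l' := by
  intro j hj
  by_cases hj' : j = l ∨ j = l'
  · rcases hj' with rfl | rfl <;> assumption
  · exact h.le_of_sameCore hl hl' hs (by omega) (by omega)

/-- The core that belongs to the gap between the positions `l - 1` and `l`. -/
def gapCore (G : SimpleGraph (Fin n)) (o : ℕ → Fin n) (q : ℕ → ℕ) (l : ℕ) : Set (Fin n) :=
  {v | SameCore G (q l) (o l) v}

variable (hG : ∀ v, ∃ w, G.Adj v w) (h : CoreOrder G o q n)
include h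

/-- The gap core contains both `o l` and `o (l - 1)`. A core containing them cannot have been formed
at a level above `q l`; applied in both directions, equal gap cores have equal weights. -/
theorem gapCore_eq_iff {l l' : ℕ} (h1 : 1 ≤ l) (hl : l < n) (h1' : 1 ≤ l') (hl' : l' < n) :
    gapCore G o q l = gapCore G o q l' ↔ q l = q l' ∧ Above q (q l) l l' := by
  have key : ∀ {a b}, 1 ≤ a → a < n → b < n → gapCore G o q a = gapCore G o q b → q b ≤ q a := by
    intro a b h1 ha hb e
    have m1 : o a ∈ gapCore G o q b := e ▸ SameCore.refl _ _
    have m2 : o (a - 1) ∈ gapCore G o q b := e ▸ h.sameCore_gap h1 ha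
    exact h.le_of_sameCore ha (by omega) (SameCore.trans (SameCore.symm m1) m2) (by omega)
      (by omega)
  constructor
  · intro e
    have hq : q l = q l' := le_antisymm (key h1' hl' hl e.symm) (key h1 hl hl' e)
    refine ⟨hq, h.above_of_sameCore hl hl' ?_ le_rfl hq.le⟩
    have : o l' ∈ gapCore G o q l := e ▸ SameCore.refl _ _
    exact this
  · rintro ⟨hq, ha⟩
    have hs := h.sameCore_of_above hl hl' ha
    ext v
    change SameCore G (q l) _ _ ↔ SameCore G (q l') _ _
    rw [← hq]
    exact ⟨hs.symm.trans, hs.trans⟩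

include hG

/-- Among the gaps inside the core choose one of minimum weight. Every other gap between positions
of the core is at least as heavy, so nothing is lost by passing from level `c.k` to that weight. -/
theorem exists_gap (c : Core G) : ∃ l, 1 ≤ l ∧ l < n ∧ c.k ≤ q l ∧ c.verts = gapCore G o q l ∧
    ∀ l', 1 ≤ l' → l' < n → c.k ≤ q l' → o l' ∈ c.verts → q l ≤ q l' := by
  have : Nonempty (Fin n) := ⟨o 0⟩
  obtain ⟨u, hu⟩ := c.nonempty
  have hcv := c.verts_eq hu
  have hex : ∃ m l, 1 ≤ l ∧ l < n ∧ c.k ≤ q l ∧ o l ∈ c.verts ∧ q l = m := by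
    obtain ⟨v, hvu, hs⟩ := exists_sameCore_ne hG (c.le_coreness hu)
    obtain ⟨i, hi, rfl⟩ := h.exists_eq u
    obtain ⟨j, hj, rfl⟩ := h.exists_eq v
    have hij : i ≠ j := by rintro rfl; exact hvu rfl
    rw [hcv]
    -- The gap at the later of the two positions separates two vertices of the core, so its weight
    -- is at least `c.k`.
    exact ⟨_, max i j, by omega, by omega, h.le_of_sameCore hi hj hs (by omega) le_rfl,
      (by rcases max_choice i j with e | e <;> rw [e]; exacts [SameCore.refl _ _, hs]), rfl⟩
  classical
  obtain ⟨l, h1, hl, hq, hm, e⟩ := Nat.find_spec hex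
  have hmin : ∀ l', 1 ≤ l' → l' < n → c.k ≤ q l' → o l' ∈ c.verts → q l ≤ q l' :=
    fun l' h1' hl' hq' hm' => e ▸ Nat.find_min' hex ⟨l', h1', hl', hq', hm', rfl⟩
  refine ⟨l, h1, hl, hq, ?_, hmin⟩
  rw [c.verts_eq hm]
  ext v
  refine ⟨fun hv => ?_, fun hv => SameCore.mono hq hv⟩
  obtain ⟨j, hj, rfl⟩ := h.exists_eq v
  refine h.sameCore_of_le hl hj fun p hp1 hp2 => ?_
  have hpn : p < n := by omega
  have hv' : SameCore G c.k (o l) (o j) := hv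
  refine hmin p (by omega) hpn (h.le_of_sameCore hl hj hv' hp1 hp2) ?_
  rw [c.verts_eq hm]
  refine h.sameCore_of_le hl hpn fun r hr1 hr2 => ?_
  by_cases hr : min l j < r ∧ r ≤ max l j
  · exact h.le_of_sameCore hl hj hv' hr.1 hr.2
  · obtain rfl : r = l := by omega
    exact hq

theorem finite_node_and_card_le : Finite (Node G) ∧ Nat.card (Node G) ≤ 2 * n := by
  have : Nonempty (Fin n) := ⟨o 0⟩
  choose f h1 h2 _ h4 _ using h.exists_gap hG
  let F : Fin n ⊕ Fin n → Fin n ⊕ Set (Fin n) :=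
    Sum.map id fun l => gapCore G o q l
  have hF : ∀ a : Node G, ∃ x, F x = nodeKey a := by
    rintro ⟨v | c⟩
    · exact ⟨Sum.inl v, rfl⟩
    · exact ⟨Sum.inr ⟨f c, h2 c⟩, congrArg Sum.inr (h4 c).symm⟩
  choose φ hφ using hF
  have hinj : Function.Injective φ := fun a b e =>
    nodeKey_injective (by rw [← hφ, ← hφ, e])
  refine ⟨Finite.of_injective φ hinj, (Nat.card_le_card_of_injective φ hinj).trans ?_⟩
  simp [two_mul]

end CoreOrder

/-! ## The tree of the gaps -/

/-- The maximal ranges of positions `1, …, i` on which `g` is at least its minimum there, as a tree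
with the nodes `n, …, N - 1`: `nd l` is the node of the range with minimum `g l` around `l`, `lvl` is
the minimum and `par` the parent. Position `0` and node `0` are sentinels. -/
structure GapTree (g : ℕ → ℕ) (n N i : ℕ) (lvl par nd : ℕ → ℕ) : Prop where
  nd_zero : nd 0 = 0
  range : ∀ l, 1 ≤ l → l ≤ i → n ≤ nd l ∧ nd l < N
  lvl_nd : ∀ l ≤ i, lvl (nd l) = g l
  surj : ∀ x, n ≤ x → x < N → ∃ l, 1 ≤ l ∧ l ≤ i ∧ nd l = x
  above : ∀ l l', l ≤ i → l' ≤ i → nd l = nd l' → Above g (g l) l l'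
  nd_eq : ∀ l l', l ≤ i → l' ≤ i → g l = g l' → Above g (g l) l l' → nd l = nd l'
  -- No threshold above the level of the parent yields a wider range, so no node is missing between
  -- a node and its parent.
  par_max : ∀ l j, 1 ≤ l → l ≤ i → j ≤ i → Above g (lvl (par (nd l)) + 1) l j → Above g (g l) l j
  par : ∀ l, 1 ≤ l → l ≤ i → ∃ l' ≤ i, par (nd l) = nd l' ∧ g l' < g l ∧ Above g (g l') l l'

/-- The level of a gap, with a sentinel in front. -/
def gapLevel (q : ℕ → ℕ) (l : ℕ) : ℕ := if l = 0 then 0 else q l + 1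

theorem gapLevel_pos {q : ℕ → ℕ} {l : ℕ} (h : 1 ≤ l) : gapLevel q l = q l + 1 :=
  if_neg (by omega)

/-- The shift by one keeps gaps of weight `0` strictly above the sentinel at position `0`, so that
every gap has a parent. -/
theorem above_gapLevel {q : ℕ → ℕ} {k a b : ℕ} (ha : 1 ≤ a) (hb : 1 ≤ b) :
    Above (gapLevel q) (k + 1) a b ↔ Above q k a b := by
  refine forall_congr' fun j => forall_congr' fun hj => ?_
  rw [gapLevel_pos (by omega)]
  omega

/-! ### From the tree of the gaps to the required output -/

section Output

variable {n : ℕ} {G : SimpleGraph (Fin n)} {o : ℕ → Fin n} {q : ℕ → ℕ} {N : ℕ}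
  {lvl par nd : ℕ → ℕ}

open CoreOrder

/-- The children of the root range have parent `0`, and only they do. -/
theorem GapTree.par_cases (hT : GapTree (gapLevel q) n N (n - 1) lvl par nd) {l : ℕ} (h1 : 1 ≤ l)
    (hl : l < n) :
    (par (nd l) = 0 ∧ lvl (par (nd l)) = 0) ∨
    ∃ l', 1 ≤ l' ∧ l' < n ∧ par (nd l) = nd l' ∧ lvl (par (nd l)) = q l' + 1 ∧ q l' < q l ∧
      Above q (q l') l l' := by
  obtain ⟨l', hl', hp, hg, ha⟩ := hT.par l h1 (by omega)
  rcases Nat.eq_zero_or_pos l' with rfl | h1'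
  · left
    rw [hp, hT.lvl_nd 0 (by omega), hT.nd_zero]
    exact ⟨rfl, rfl⟩
  · right
    rw [gapLevel_pos h1, gapLevel_pos h1'] at hg
    rw [gapLevel_pos h1', above_gapLevel h1 h1'] at ha
    exact ⟨l', h1', by omega, hp, by rw [hp, hT.lvl_nd l' hl', gapLevel_pos h1'], by omega, ha⟩

/-- Between a range and its parent there is no other core. -/
theorem GapTree.sameCore_iff (hT : GapTree (gapLevel q) n N (n - 1) lvl par nd)
    (h : CoreOrder G o q n) {l : ℕ} (h1 : 1 ≤ l) (hl : l < n) {k : ℕ}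
    (hk : lvl (par (nd l)) ≤ k) (hkq : k ≤ q l) :
    {v | SameCore G k (o l) v} = gapCore G o q l := by
  ext v
  refine ⟨fun hv => ?_, fun hv => SameCore.mono hkq hv⟩
  obtain ⟨j, hj, rfl⟩ := h.exists_eq v
  have hv' : SameCore G k (o l) (o j) := hv
  have key : ∀ p, 1 ≤ p → p < n → Above q k l p → Above q (q l) l p := by
    intro p hp hpn ha
    have := hT.par_max l p h1 (by omega) (by omega)
      (((above_gapLevel h1 hp).2 ha).mono (by omega))
    rw [gapLevel_pos h1] at this
    exact (above_gapLevel h1 hp).1 this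
  refine h.sameCore_of_le hl hj fun p hp1 hp2 => ?_
  refine (key p (by omega) (by omega) fun r hr => ?_).right
  by_cases hr' : min l j < r ∧ r ≤ max l j
  · exact h.le_of_sameCore hl hj hv' hr'.1 hr'.2
  · obtain rfl : r = l := by omega
    exact hkq

/-- The final contents of the output arrays, in terms of the tree of the gaps. -/
structure OutputSpec (G : SimpleGraph (Fin n)) (o : ℕ → Fin n) (q : ℕ → ℕ) (N : ℕ)
    (lvl par nd : ℕ → ℕ) (s : State) : Prop where
  var_zero : s.var 0 = N
  le : n ≤ N
  leaf_min : ∀ v : Fin n, s.arr 3 v = coreness G v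
  leaf_max : ∀ v : Fin n, s.arr 4 v = coreness G v
  leaf_par : ∀ v : Fin n, ∃ l, 1 ≤ l ∧ l < n ∧ s.arr 2 v = nd l ∧ q l = coreness G v ∧
    SameCore G (q l) (o l) v
  node_par : ∀ x, n ≤ x → x < N → s.arr 2 x = if par x = 0 then x else par x
  node_max : ∀ x, n ≤ x → x < N → s.arr 4 x = lvl x - 1
  -- Levels are weights plus one, so the level of the parent is the first coreness value after the
  -- parent's largest one; for the root it is `0`, from the sentinel.
  node_min : ∀ x, n ≤ x → x < N → s.arr 3 x = lvl (par x)

/-- A core is numbered by the node of any of its gaps; `nd` and `gapCore` identify the same gaps, so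
this descends to a bijection from the nodes. The values associated with an inner node form the
interval from the level of its parent to its weight (`kcore_iff`), which gives the labels. The only
cover relation leaving such a chain starts at its lower end, which gives the parent. -/
theorem OutputSpec.isOutput {s : State} (hS : OutputSpec G o q N lvl par nd s)
    (hT : GapTree (gapLevel q) n N (n - 1) lvl par nd)
    (h : CoreOrder G o q n) (hG : ∀ v, ∃ w, G.Adj v w) : IsOutput G s := by
  have : Nonempty (Fin n) := ⟨o 0⟩
  choose f f1 f2 f3 f4 f5 using h.exists_gap hG
  -- the number of a core does not depend on the choice of the gap
  have nd_iff : ∀ {l l'}, 1 ≤ l → l < n → 1 ≤ l' → l' < n →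
      (nd l = nd l' ↔ gapCore G o q l = gapCore G o q l') := by
    intro l l' h1 hl h1' hl'
    rw [h.gapCore_eq_iff h1 hl h1' hl', ← above_gapLevel h1 h1', ← gapLevel_pos h1]
    constructor
    · intro e
      refine ⟨?_, hT.above l l' (by omega) (by omega) e⟩
      have := hT.lvl_nd l (by omega)
      rw [e, hT.lvl_nd l' (by omega), gapLevel_pos h1, gapLevel_pos h1'] at this
      omega
    · rintro ⟨e, ha⟩
      exact hT.nd_eq l l' (by omega) (by omega)
        (by rw [gapLevel_pos h1, gapLevel_pos h1', e]) ha
  let num : PreNode G → ℕ := Sum.elim (fun v => v) (fun c => nd (f c))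
  have num_core : ∀ (c : Core G) l, 1 ≤ l → l < n → c.verts = gapCore G o q l →
      num (Sum.inr c) = nd l := fun c l h1 hl e =>
    (nd_iff (f1 c) (f2 c) h1 hl).2 ((f4 c).symm.trans e)
  have num_lt : ∀ x, num x < N := by
    rintro (v | c)
    · exact v.2.trans_le hS.le
    · exact (hT.range _ (f1 c) (by have := f2 c; omega)).2
  have num_inj : ∀ x y, num x = num y ↔
      (Quot.mk (OnlyChild G) x : Node G) = Quot.mk _ y := by
    have aux : ∀ (v : Fin n) (c : Core G), num (Sum.inl v) ≠ num (Sum.inr c) := fun v c e => by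
      have := (hT.range _ (f1 c) (by have := f2 c; omega)).1
      have e' : (v : ℕ) = nd (f c) := e
      omega
    rintro (u | c) (v | d)
    · rw [mk_eq_leaf_iff]
      exact ⟨fun e => congrArg Sum.inl (Fin.ext e), fun e => by rw [e]⟩
    · exact iff_of_false (aux u d) fun e => absurd (mk_eq_leaf_iff.1 e.symm) (by simp)
    · exact iff_of_false (aux v c).symm fun e => absurd (mk_eq_leaf_iff.1 e) (by simp)
    · rw [mk_core_eq_iff, f4 c, f4 d]
      exact nd_iff (f1 c) (f2 c) (f1 d) (f2 d)
  let F : Node G → Fin (s.var 0) := Quot.lift (fun x => ⟨num x, hS.var_zero ▸ num_lt x⟩)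
    fun x y hxy => Fin.ext ((num_inj x y).2 (Quot.sound hxy))
  have Fval : ∀ x, (F (Quot.mk _ x) : ℕ) = num x := fun x => rfl
  -- the core of a gap
  let gc : ∀ l, 1 ≤ l → l < n → Core G := fun l h1 hl =>
    coreOf G (q l) (o l) (h.le_coreness h1 hl)
  have num_gc : ∀ l h1 hl, num (Sum.inr (gc l h1 hl)) = nd l := fun l h1 hl =>
    num_core _ l h1 hl rfl
  have Fbij : Function.Bijective F := by
    constructor
    · rintro ⟨x⟩ ⟨y⟩ e
      exact (num_inj x y).1 (congrArg Fin.val e)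
    · rintro ⟨x, hx⟩
      rw [hS.var_zero] at hx
      by_cases hxn : x < n
      · exact ⟨leaf G ⟨x, hxn⟩, rfl⟩
      · obtain ⟨l, h1, hl, e⟩ := hT.surj x (by omega) hx
        have hl' : l < n := by omega
        exact ⟨Quot.mk _ (Sum.inr (gc l h1 hl')), Fin.ext ((num_gc l h1 hl').trans e)⟩
  have node_range : ∀ {l}, 1 ≤ l → l < n → n ≤ nd l ∧ nd l < N :=
    fun h1 hl => hT.range _ h1 (by omega)
  -- the levels of a core
  have kcore_iff : ∀ {l} (h1 : 1 ≤ l) (hl : l < n) {k},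
      IsKCore G k (gapCore G o q l) ↔ lvl (par (nd l)) ≤ k ∧ k ≤ q l := by
    intro l h1 hl k
    constructor
    · intro hk
      let c : Core G := ⟨k, gapCore G o q l, hk⟩
      have hc : c.verts = {v | SameCore G k (o l) v} := c.verts_eq (SameCore.refl _ _)
      have hkq : k ≤ q l := by
        have hm : o (l - 1) ∈ c.verts := h.sameCore_gap h1 hl
        rw [hc] at hm
        exact h.le_of_sameCore hl (by omega) hm (by omega) (by omega)
      refine ⟨?_, hkq⟩
      rcases hT.par_cases h1 hl with ⟨-, h0⟩ | ⟨l', h1', hl', hp, hlv, hlt, ha⟩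
      · omega
      -- If `k ≤ q l'`, then the gap `l'` lies inside the core as well, so two vertices of `gapCore
      -- G o q l` are separated by a gap of weight `q l' < q l`.
      · by_contra! hcon
        have hm : o l' ∈ c.verts := by
          rw [hc]
          exact h.sameCore_of_above hl hl' (ha.mono (by omega))
        have hm' : o (l' - 1) ∈ c.verts := by
          rw [hc] at hm ⊢
          exact SameCore.trans hm ((h.sameCore_gap h1' hl').mono (by omega))
        have := h.le_of_sameCore hl' (by omega)
          (SameCore.trans (SameCore.symm hm) hm') (k := q l) (l := l') (by omega) (by omega)
        omega
    · rintro ⟨hk1, hk2⟩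
      rw [← hT.sameCore_iff h h1 hl hk1 hk2]
      exact isKCore_iff.2 ⟨o l, hk2.trans (h.le_coreness h1 hl), rfl⟩
  let rootCore : Core G := ⟨0, Set.univ, Or.inl ⟨rfl, rfl⟩⟩
  -- The value `0` belongs to the root, whereas below a genuine parent all values are at least `q l'
  -- + 1`.
  have par_root : par (nd (f rootCore)) = 0 := by
    have := (kcore_iff (f1 rootCore) (f2 rootCore)).1 (f4 rootCore ▸ rootCore.isKCore)
    rcases hT.par_cases (f1 rootCore) (f2 rootCore) with ⟨h0, -⟩ | ⟨l', -, -, -, hlv, -⟩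
    · exact h0
    · have h0 : lvl (par (nd (f rootCore))) ≤ 0 := this.1
      omega
  refine ⟨Equiv.ofBijective F Fbij, fun v => rfl, ?_, ?_, ?_, ?_, ?_⟩
  · change s.arr 2 (nd (f rootCore)) = nd (f rootCore)
    have := node_range (f1 rootCore) (f2 rootCore)
    rw [hS.node_par _ this.1 this.2, if_pos par_root]
  · rintro b ⟨hne, x, y, hx, rfl, hxy⟩
    refine hne ?_
    rcases x with u | c
    · exact absurd (mk_eq_leaf_iff.1 hx.symm) (by simp)
    rcases y with u | d
    · exact hxy.elim
    have hc : c.verts = Set.univ := mk_core_eq_iff.1 hx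
    refine mk_core_eq_iff.2 (Set.eq_univ_of_univ_subset ?_).symm
    rw [← hc]
    exact hxy.2
  · rintro ⟨v | c⟩ hne
    · obtain ⟨l, h1, hl, hp, hq, hs⟩ := hS.leaf_par v
      refine ⟨Quot.mk _ (Sum.inr (gc l h1 hl)), hp.trans (num_gc l h1 hl).symm, fun b' => ?_⟩
      have hchild : IsChild G (Sum.inl v) (Sum.inr (gc l h1 hl)) :=
        ⟨hs, fun d hd => (d.le_coreness hd).trans hq.ge⟩
      constructor
      · rintro ⟨-, x, y, hx, rfl, hxy⟩
        obtain rfl := mk_eq_leaf_iff.1 hx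
        rcases y with u | d
        · exact hxy.elim
        have hk : d.k = (gc l h1 hl).k :=
          le_antisymm (hchild.2 d hxy.1) (hxy.2 _ hchild.1)
        refine mk_core_eq_iff.2 ?_
        rw [d.verts_eq hxy.1, (gc l h1 hl).verts_eq hchild.1, hk]
      · rintro rfl
        exact ⟨fun e => absurd (mk_eq_leaf_iff.1 e.symm) (by simp), _, _, rfl, rfl, hchild⟩
    · have h1 := f1 c
      have hl := f2 c
      have hc := f4 c
      have hr := node_range h1 hl
      rcases hT.par_cases h1 hl with ⟨h0, hl0⟩ | ⟨l', h1', hl', hp, hlv, hlt, ha⟩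
      · refine absurd (mk_core_eq_iff.2 ?_) hne
        rw [hc, ← hT.sameCore_iff h h1 hl (k := 0) (by omega) (Nat.zero_le _)]
        exact Set.eq_univ_of_forall fun v => SameCore.zero _ _
      · have hsub : gapCore G o q (f c) ⊆ gapCore G o q l' := fun v hv =>
          (h.sameCore_of_above hl hl' ha).symm.trans (SameCore.mono hlt.le hv)
        have hne' : gapCore G o q (f c) ≠ gapCore G o q l' := fun e => by
          have := ((h.gapCore_eq_iff h1 hl h1' hl').1 e).1
          omega
        refine ⟨Quot.mk _ (Sum.inr (gc l' h1' hl')), ?_, fun b' => ?_⟩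
        · change s.arr 2 (nd (f c)) = num (Sum.inr (gc l' h1' hl'))
          have h0 : par (nd (f c)) ≠ 0 := by
            have := node_range h1' hl'
            omega
          rw [hS.node_par _ hr.1 hr.2, if_neg h0, num_gc l' h1' hl', hp]
        · constructor
          · rintro ⟨hab, x, y, hx, rfl, hxy⟩
            rcases x with u | d
            · exact absurd (mk_eq_leaf_iff.1 hx.symm) (by simp)
            rcases y with u | e
            · exact hxy.elim
            have hd : d.verts = gapCore G o q (f c) := (mk_core_eq_iff.1 hx).trans hc
            have hdk := (kcore_iff h1 hl).1 (hd ▸ d.isKCore)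
            have hm : o (f c) ∈ e.verts := hxy.2 (hd ▸ SameCore.refl _ _)
            have hk := hxy.1
            -- If `e.k` were still in the interval of values of this node, `e` would have the same
            -- vertices and would have been contracted into it, against `hab`. So `d` is the lowest
            -- core of its chain.
            have hek : e.k = q l' := by
              by_contra hcon
              refine hab (mk_core_eq_iff.2 ?_)
              rw [hc, e.verts_eq hm]
              exact (hT.sameCore_iff h h1 hl (by omega) (by omega)).symm
            refine mk_core_eq_iff.2 ?_
            rw [e.verts_eq hm, hek]
            have hs := h.sameCore_of_above hl hl' ha
            ext v
            exact ⟨fun hv => hs.symm.trans hv, fun hv => hs.trans hv⟩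
          · rintro rfl
            refine ⟨fun e => hne' (hc.symm.trans (mk_core_eq_iff.1 e)),
              -- The lowest core of the chain contracted into the node; it is the one whose parent
              -- has different vertices.
              Sum.inr ⟨q l' + 1, gapCore G o q (f c), (kcore_iff h1 hl).2 ⟨hlv.le, hlt⟩⟩, _,
              mk_core_eq_iff.2 hc.symm, rfl, rfl, hsub⟩
  · rintro ⟨v | c⟩
    · change IsLeast (levels G (leaf G v)) (s.arr 3 v)
      rw [levels_leaf, hS.leaf_min]
      exact isLeast_singleton
    · have hr := node_range (f1 c) (f2 c)
      change IsLeast _ (s.arr 3 (nd (f c)))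
      rw [hS.node_min _ hr.1 hr.2]
      refine ⟨mem_levels_core.2 ?_, fun k hk => ?_⟩
      · rw [f4 c, kcore_iff (f1 c) (f2 c)]
        refine ⟨le_rfl, ?_⟩
        rcases hT.par_cases (f1 c) (f2 c) with ⟨-, h0⟩ | ⟨l', -, -, -, hlv, hlt, -⟩ <;> omega
      · have := mem_levels_core.1 hk
        rw [f4 c, kcore_iff (f1 c) (f2 c)] at this
        exact this.1
  · rintro ⟨v | c⟩
    · change IsGreatest (levels G (leaf G v)) (s.arr 4 v)
      rw [levels_leaf, hS.leaf_max]
      exact isGreatest_singleton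
    · have hr := node_range (f1 c) (f2 c)
      have hlv := hT.lvl_nd (f c) (by have := f2 c; omega)
      rw [gapLevel_pos (f1 c)] at hlv
      change IsGreatest _ (s.arr 4 (nd (f c)))
      rw [hS.node_max _ hr.1 hr.2, hlv, Nat.add_sub_cancel]
      refine ⟨mem_levels_core.2 ?_, fun k hk => ?_⟩
      · rw [f4 c, kcore_iff (f1 c) (f2 c)]
        refine ⟨?_, le_rfl⟩
        rcases hT.par_cases (f1 c) (f2 c) with ⟨-, h0⟩ | ⟨l', -, -, -, hlv, hlt, -⟩ <;> omega
      · have := mem_levels_core.1 hk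
        rw [f4 c, kcore_iff (f1 c) (f2 c)] at this
        exact this.2

end Output


/-! ### Appending a position to the tree of the gaps -/

namespace GapTree

variable {g : ℕ → ℕ} {n N i : ℕ} {lvl par nd : ℕ → ℕ}

theorem nil (h0 : nd 0 = 0) (hl : lvl 0 = 0) (hg : g 0 = 0) : GapTree g n n 0 lvl par nd where
  nd_zero := h0
  range l h1 h2 := by omega
  lvl_nd l h := by obtain rfl : l = 0 := by omega
                   rw [h0, hl, hg]
  surj x h1 h2 := by omega
  above l l' h h' _ := by
    obtain rfl : l = 0 := by omega
    rw [hg]; exact Above.zero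
  nd_eq l l' h h' _ _ := by
    obtain rfl : l = 0 := by omega
    obtain rfl : l' = 0 := by omega
    rfl
  par_max l j h1 h2 := by omega
  par l h1 h2 := by omega

theorem nd_lt (hT : GapTree g n N i lvl par nd) (hN : 1 ≤ N) {l : ℕ} (hl : l ≤ i) : nd l < N := by
  rcases Nat.eq_zero_or_pos l with rfl | h1
  · rw [hT.nd_zero]; omega
  · exact (hT.range l h1 hl).2

/-- The state of the walk from the node of position `i` towards the root: `x` is the current node and
`z` the previous one, if any; all the nodes passed have levels above `k`. -/
def Walk (g par nd : ℕ → ℕ) (i k z x : ℕ) : Prop :=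
  ∃ l ≤ i, nd l = x ∧ Above g (g l) l i ∧
    (z = 0 ∧ l = i ∨ ∃ lz, 1 ≤ lz ∧ lz ≤ i ∧ nd lz = z ∧ par z = x ∧ Above g (g lz) lz i ∧ k < g lz)

theorem walk_start (par : ℕ → ℕ) (k : ℕ) : Walk g par nd i k 0 (nd i) :=
  ⟨i, le_rfl, rfl, Above.refl le_rfl, Or.inl ⟨rfl, rfl⟩⟩

theorem walk_step (hT : GapTree g n N i lvl par nd) {k z x : ℕ} (hW : Walk g par nd i k z x)
    (hg : g 0 = 0) (hk : k < lvl x) : Walk g par nd i k x (par x) ∧ lvl (par x) < lvl x := by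
  obtain ⟨l, hl, rfl, ha, -⟩ := hW
  rw [hT.lvl_nd l hl] at hk ⊢
  have h1 : 1 ≤ l := by
    rcases Nat.eq_zero_or_pos l with rfl | h
    · omega
    · exact h
  obtain ⟨l', hl', hp, hlt, ha'⟩ := hT.par l h1 hl
  refine ⟨⟨l', hl', hp.symm, ha'.symm.trans (ha.mono hlt.le),
    Or.inr ⟨l, h1, hl, rfl, rfl, ha, hk⟩⟩, ?_⟩
  rwa [hp, hT.lvl_nd l' hl']

/-- At the end of the walk, all ranges that the new position does not join are closed. -/
theorem Walk.closed (hT : GapTree g n N i lvl par nd) {k z x : ℕ} (hW : Walk g par nd i k z x)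
    {j : ℕ} (ha : Above g (lvl x + 1) j i) (hk : lvl x ≤ k) (hj : j ≤ i) (hn : 1 ≤ n) :
    z ≠ 0 ∧ Above g (k + 1) j i := by
  obtain ⟨l, hl, rfl, -, ⟨rfl, rfl⟩ | ⟨lz, h1, hlz, rfl, hp, haz, hkz⟩⟩ := hW
  · rw [hT.lvl_nd l le_rfl] at ha
    have := ha.right
    omega
  · have hlj := hT.par_max lz j h1 hlz hj (hp.symm ▸ (haz.mono (by
      rw [hT.lvl_nd l hl] at hk ⊢; omega)).trans ha.symm)
    have hr := (hT.range lz h1 hlz).1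
    exact ⟨by omega, (hlj.symm.trans haz).mono hkz⟩

/-- Ranges that stay open at the new position have levels at most `k`. -/
theorem Walk.le_of_open (hT : GapTree g n N i lvl par nd) {k z x : ℕ}
    (hW : Walk g par nd i k z x) (hk : lvl x ≤ k) {l' : ℕ} (h1 : 1 ≤ l') (hl' : l' ≤ i)
    (hz : nd l' ≠ z) (ha : Above g (lvl (par (nd l')) + 1) l' i) (hp : lvl (par (nd l')) < k) :
    g l' ≤ k := by
  by_contra! hcon
  have hop := hT.par_max l' i h1 hl' le_rfl ha
  obtain ⟨l, hl, rfl, -, ⟨rfl, rfl⟩ | ⟨lz, h1z, hlz, rfl, hpz, haz, hkz⟩⟩ := hW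
  · rw [hT.lvl_nd l le_rfl] at hk
    have := hop.right
    omega
  -- Both `l'` and the last node passed reach position `i` above the level of their parents.
  -- Maximality of the range with the larger minimum forbids a smaller value in it, so the minima
  -- agree and the nodes coincide, which `hz` excludes.
  · rcases lt_trichotomy (g lz) (g l') with h | h | h
    · have := (hT.par_max l' lz h1 hl' hlz
        ((hop.mono (by omega)).trans (haz.symm.mono (by omega)))).right
      omega
    · exact hz (hT.nd_eq l' lz hl' hlz h.symm (hop.trans (haz.symm.mono h.ge)))
    · have := (hT.par_max lz l' h1z hlz hl'
        ((haz.mono (by rw [hpz]; omega)).trans (hop.symm.mono (by rw [hpz]; omega)))).right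
      omega

/-- The new position joins the range of an existing node. -/
theorem extend_old (hT : GapTree g n N i lvl par nd) (hg : ∀ l, 1 ≤ l → 1 ≤ g l)
    (hg0 : g 0 = 0) {z x : ℕ} (hW : Walk g par nd i (g (i + 1)) z x) (hx : lvl x = g (i + 1)) :
    GapTree g n N (i + 1) lvl par (Function.update nd (i + 1) x) := by
  have hW' := hW
  obtain ⟨l, hl, rfl, ha, -⟩ := hW
  rw [hT.lvl_nd l hl] at hx
  have hl1 : 1 ≤ l := by
    rcases Nat.eq_zero_or_pos l with rfl | h
    · have := hg (i + 1) (by omega)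
      omega
    · exact h
  set nd' := Function.update nd (i + 1) (nd l) with hnd'
  have hold : ∀ j ≤ i, nd' j = nd j := fun j hj => Function.update_of_ne (by omega) _ _
  have hnew : nd' (i + 1) = nd l := Function.update_self _ _ _
  have hal : Above g (g (i + 1)) l (i + 1) := (hx ▸ ha).succ le_rfl
  have hcase : ∀ j ≤ i + 1, j ≤ i ∨ j = i + 1 := fun j hj => by omega
  -- every position has an old representative with the same node and range
  have hrep : ∀ j ≤ i + 1, ∃ j' ≤ i, nd' j = nd j' ∧ g j' = g j ∧ Above g (g j) j j' ∧
      (1 ≤ j → 1 ≤ j') := by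
    intro j hj
    rcases hcase j hj with hj | rfl
    · exact ⟨j, hj, hold j hj, rfl, Above.refl le_rfl, id⟩
    · exact ⟨l, hl, hnew, hx, hal.symm, fun _ => hl1⟩
  have hpm : ∀ a b, 1 ≤ a → a ≤ i → b ≤ i + 1 → Above g (lvl (par (nd a)) + 1) a b →
      Above g (g a) a b := by
    intro a b h1 hai hb hab
    obtain ⟨b', hb', -, e2, e3, -⟩ := hrep b hb
    have h2 := hT.par_max a b' h1 hai hb' (hab.trans (e3.mono hab.right))
    exact h2.trans (e3.symm.mono (e2 ▸ h2.right))
  refine ⟨?_, ?_, ?_, ?_, ?_, ?_, ?_, ?_⟩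
  · rw [hold 0 (Nat.zero_le _), hT.nd_zero]
  · intro j h1 hj
    obtain ⟨j', hj', e, -, -, h1'⟩ := hrep j hj
    rw [e]
    exact hT.range j' (h1' h1) hj'
  · intro j hj
    obtain ⟨j', hj', e, e2, -, -⟩ := hrep j hj
    rw [e, hT.lvl_nd j' hj', e2]
  · intro y hy hyN
    obtain ⟨j, h1, hj, e⟩ := hT.surj y hy hyN
    exact ⟨j, h1, by omega, (hold j hj).trans e⟩
  · intro a b ha hb e
    obtain ⟨a', ha', ea, ea2, ea3, -⟩ := hrep a ha
    obtain ⟨b', hb', eb, eb2, eb3, -⟩ := hrep b hb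
    have h1 := hT.above a' b' ha' hb' (by rw [← ea, ← eb, e])
    have h2 : g a' = g b' := by rw [← hT.lvl_nd a' ha', ← hT.lvl_nd b' hb', ← ea, ← eb, e]
    rw [ea2] at h1
    exact ea3.trans (h1.trans (eb3.symm.mono (by omega)))
  · intro a b ha hb e hab
    obtain ⟨a', ha', ea, ea2, ea3, -⟩ := hrep a ha
    obtain ⟨b', hb', eb, eb2, eb3, -⟩ := hrep b hb
    rw [ea, eb]
    refine hT.nd_eq a' b' ha' hb' (by omega) ?_
    rw [ea2]
    exact ea3.symm.trans (hab.trans (eb3.mono e.le))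
  · intro a b h1 ha hb hab
    obtain ⟨a', ha', ea, ea2, ea3, h1'⟩ := hrep a ha
    rw [ea] at hab
    have h2 : lvl (par (nd a')) + 1 ≤ g a := hab.left
    have h3 := hpm a' b (h1' h1) ha' hb ((ea3.mono h2).symm.trans hab)
    exact ea3.trans (ea2 ▸ h3)
  · intro a h1 ha
    obtain ⟨a', ha', ea, ea2, ea3, h1'⟩ := hrep a ha
    obtain ⟨p, hp, e1, e2, e3⟩ := hT.par a' (h1' h1) ha'
    refine ⟨p, by omega, by rw [ea, hold p hp, e1], by omega, (ea3.mono (by omega)).trans e3⟩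

/-- The new position opens a range of its own. -/
theorem extend_new (hT : GapTree g n N i lvl par nd) (hn : 1 ≤ n) (hN : n ≤ N)
    {z x : ℕ} (hW : Walk g par nd i (g (i + 1)) z x) (hx : lvl x < g (i + 1)) :
    GapTree g n (N + 1) (i + 1) (Function.update lvl N (g (i + 1)))
      (Function.update (Function.update par N x) z N) (Function.update nd (i + 1) N) := by
  have hlt : ∀ j ≤ i, nd j ≠ N := fun j hj => (hT.nd_lt (by omega) hj).ne
  set nd' := Function.update nd (i + 1) N with hnd'
  set lvl' := Function.update lvl N (g (i + 1)) with hlvl'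
  set par' := Function.update (Function.update par N x) z N with hpar'
  have hold : ∀ j ≤ i, nd' j = nd j := fun j hj => Function.update_of_ne (by omega) _ _
  have hnew : nd' (i + 1) = N := Function.update_self _ _ _
  have lold : ∀ j ≤ i, lvl' (nd j) = g j := fun j hj => by
    rw [hlvl', Function.update_of_ne (hlt j hj), hT.lvl_nd j hj]
  have lnew : lvl' N = g (i + 1) := Function.update_self _ _ _
  have hzN : z ≠ N := by
    obtain ⟨l, hl, -, -, ⟨h0, -⟩ | ⟨lz, -, hlz, e, -⟩⟩ := hW
    · omega
    · exact e ▸ hlt lz hlz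
  -- If no node was passed, `z = 0` and this write only hits the sentinel, whose parent is never
  -- used; a passed node becomes a child of the new one.
  have pz : par' z = N := Function.update_self _ _ _
  have pN : par' N = x := by
    rw [hpar', Function.update_of_ne hzN.symm, Function.update_self]
  have pold : ∀ j ≤ i, nd j ≠ z → par' (nd j) = par (nd j) := fun j hj hz => by
    rw [hpar', Function.update_of_ne hz, Function.update_of_ne (hlt j hj)]
  have hcase : ∀ j ≤ i + 1, j ≤ i ∨ j = i + 1 := fun j hj => by omega
  -- What is connected to position `i` above the level of `x` is connected even above the new value.
  -- Hence no old range with the new value as minimum reaches the new position, and a new node is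
  -- needed.
  have hclosed : ∀ j ≤ i, Above g (lvl x + 1) j i → Above g (g (i + 1) + 1) j i :=
    fun j hj ha => (hW.closed hT ha hx.le hj hn).2
  have hne : ∀ j ≤ i, g j = g (i + 1) → ¬ Above g (g j) j (i + 1) := by
    intro j hj e ha
    have := (hclosed j hj ((ha.of_succ hj).mono (by omega))).left
    omega
  have hzcase : ∀ a, 1 ≤ a → a ≤ i → nd a = z → par (nd a) = x ∧ g (i + 1) < g a ∧
      Above g (g a) a i := by
    intro a h1 ha hz
    have hr := (hT.range a h1 ha).1
    obtain ⟨l, -, -, -, ⟨h0, -⟩ | ⟨lz, -, hlz, e, hp, haz, hlt⟩⟩ := hW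
    · omega
    · have hg : g lz = g a := by rw [← hT.lvl_nd lz hlz, ← hT.lvl_nd a ha, e, hz]
      exact ⟨hz ▸ hp, hg ▸ hlt, (hT.above a lz ha hlz (hz.trans e.symm)).trans (hg ▸ haz)⟩
  obtain ⟨lx, hlx, ex, hax, -⟩ := id hW
  have gx : g lx = lvl x := by rw [← ex, hT.lvl_nd lx hlx]
  have lx' : lvl' x = lvl x := by rw [← ex, lold lx hlx, hT.lvl_nd lx hlx]
  refine ⟨?_, ?_, ?_, ?_, ?_, ?_, ?_, ?_⟩
  · rw [hold 0 (Nat.zero_le _), hT.nd_zero]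
  · intro j h1 hj
    rcases hcase j hj with hj | rfl
    · have := hT.range j h1 hj
      rw [hold j hj]
      omega
    · rw [hnew]
      omega
  · intro j hj
    rcases hcase j hj with hj | rfl
    · rw [hold j hj, lold j hj]
    · rw [hnew, lnew]
  · intro y hy hyN
    rcases Nat.lt_succ_iff_lt_or_eq.1 hyN with hy' | rfl
    · obtain ⟨j, h1, hj, e⟩ := hT.surj y hy hy'
      exact ⟨j, h1, by omega, (hold j hj).trans e⟩
    · exact ⟨i + 1, by omega, le_rfl, hnew⟩
  · intro a b ha hb e
    rcases hcase a ha with ha | rfl <;> rcases hcase b hb with hb | rfl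
    · rw [hold a ha, hold b hb] at e
      exact hT.above a b ha hb e
    · rw [hold a ha, hnew] at e
      exact absurd e (hlt a ha)
    · rw [hold b hb, hnew] at e
      exact absurd e.symm (hlt b hb)
    · exact Above.refl le_rfl
  · intro a b ha hb e hab
    rcases hcase a ha with ha | rfl <;> rcases hcase b hb with hb | rfl
    · rw [hold a ha, hold b hb]
      exact hT.nd_eq a b ha hb e hab
    · exact absurd hab (hne a ha e)
    · exact absurd (e ▸ hab.symm) (hne b hb e.symm)
    · rfl
  · intro a b h1 ha hb hab
    rcases hcase a ha with ha | rfl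
    · rw [hold a ha] at hab
      obtain ⟨p, hp, ep, -, -⟩ := hT.par a h1 ha
      by_cases hz : nd a = z
      · obtain ⟨e1, e2, e3⟩ := hzcase a h1 ha hz
        rw [hz, pz, lnew] at hab
        rcases hcase b hb with hb | rfl
        · exact hT.par_max a b h1 ha hb (hab.mono (by rw [e1]; omega))
        · have := hab.right
          omega
      · rw [pold a ha hz, ep, lold p hp, ← hT.lvl_nd p hp, ← ep] at hab
        rcases hcase b hb with hb | rfl
        · exact hT.par_max a b h1 ha hb hab
        · have hab' := hab.of_succ ha
          exact (hT.par_max a i h1 ha le_rfl hab').succ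
            (hW.le_of_open hT hx.le h1 ha hz hab' hab.right)
    · rw [hnew, pN, lx'] at hab
      rcases hcase b hb with hb | rfl
      · exact (((hclosed b hb (hab.symm.of_succ hb)).mono (Nat.le_succ _)).succ le_rfl).symm
      · exact Above.refl le_rfl
  · intro a h1 ha
    rcases hcase a ha with ha | rfl
    · by_cases hz : nd a = z
      · obtain ⟨e1, e2, e3⟩ := hzcase a h1 ha hz
        exact ⟨i + 1, le_rfl, by rw [hold a ha, hz, pz, hnew], e2, (e3.mono e2.le).succ le_rfl⟩
      · obtain ⟨p, hp, e1, e2, e3⟩ := hT.par a h1 ha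
        exact ⟨p, by omega, by rw [hold a ha, pold a ha hz, e1, hold p hp], e2, e3⟩
    · exact ⟨lx, by omega, by rw [hnew, pN, hold lx hlx, ex], by omega,
        (hax.succ (by omega)).symm⟩

end GapTree

/-! ## Reasoning about programs -/

infixr:60 " ;; " => Prog.seq

/-- The weakest precondition for halting with the number of steps and the final state in `Q`. -/
def wp (W : ℕ) : Prog → State → (ℕ → State → Prop) → Prop
  | .skip, s, Q => Q 1 s
  | .const x c, s, Q => c ≤ W ∧ Q 1 (s.setVar x c)
  | .copy x y, s, Q => Q 1 (s.setVar x (s.var y))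
  | .add x y z, s, Q => s.var y + s.var z ≤ W ∧ Q 1 (s.setVar x (s.var y + s.var z))
  | .sub x y z, s, Q => Q 1 (s.setVar x (s.var y - s.var z))
  | .load x a y, s, Q => Q 1 (s.setVar x (s.arr a (s.var y)))
  | .store a x y, s, Q => Q 1 (s.setArr a (s.var x) (s.var y))
  | .seq p q, s, Q => wp W p s fun t s' => wp W q s' fun t' s'' => Q (t + t') s''
  | .ite x y p q, s, Q => (s.var x < s.var y → wp W p s fun t s' => Q (t + 1) s') ∧
      (¬ s.var x < s.var y → wp W q s fun t s' => Q (t + 1) s')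
  | .loop x y p, s, Q => ∃ t s', Exec W (.loop x y p) s t s' ∧ Q t s'

section

variable (W : ℕ) (s : State) (Q : ℕ → State → Prop)

/-- One equation for each construct except loops: rewriting with them stops at a loop, where
`wp_loop` applies. -/
theorem wp_seq (p q : Prog) : wp W (p ;; q) s Q
    = wp W p s fun t s' => wp W q s' fun t' s'' => Q (t + t') s'' := rfl

theorem wp_skip : wp W .skip s Q = Q 1 s := rfl

theorem wp_const (x c : ℕ) : wp W (.const x c) s Q = (c ≤ W ∧ Q 1 (s.setVar x c)) := rfl

theorem wp_copy (x y : ℕ) : wp W (.copy x y) s Q = Q 1 (s.setVar x (s.var y)) := rfl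

theorem wp_add (x y z : ℕ) : wp W (.add x y z) s Q
    = (s.var y + s.var z ≤ W ∧ Q 1 (s.setVar x (s.var y + s.var z))) := rfl

theorem wp_sub (x y z : ℕ) : wp W (.sub x y z) s Q
    = Q 1 (s.setVar x (s.var y - s.var z)) := rfl

theorem wp_load (x a y : ℕ) : wp W (.load x a y) s Q
    = Q 1 (s.setVar x (s.arr a (s.var y))) := rfl

theorem wp_store (a x y : ℕ) : wp W (.store a x y) s Q
    = Q 1 (s.setArr a (s.var x) (s.var y)) := rfl

theorem wp_ite (x y : ℕ) (p q : Prog) : wp W (.ite x y p q) s Q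
    = ((s.var x < s.var y → wp W p s fun t s' => Q (t + 1) s') ∧
      (¬ s.var x < s.var y → wp W q s fun t s' => Q (t + 1) s')) := rfl

end

theorem wp_sound {W : ℕ} {p : Prog} {s : State} {Q : ℕ → State → Prop} (h : wp W p s Q) :
    ∃ t s', Exec W p s t s' ∧ Q t s' := by
  induction p generalizing s Q with
  | skip => exact ⟨_, _, .skip s, h⟩
  | const x c => exact ⟨_, _, .const s x c h.1, h.2⟩
  | copy x y => exact ⟨_, _, .copy s x y, h⟩
  | add x y z => exact ⟨_, _, .add s x y z h.1, h.2⟩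
  | sub x y z => exact ⟨_, _, .sub s x y z, h⟩
  | load x a y => exact ⟨_, _, .load s x a y, h⟩
  | store a x y => exact ⟨_, _, .store s a x y, h⟩
  | seq p q ihp ihq =>
    obtain ⟨t, s', hp, h'⟩ := ihp h
    obtain ⟨t', s'', hq, h''⟩ := ihq h'
    exact ⟨_, _, .seq hp hq, h''⟩
  | ite x y p q ihp ihq =>
    by_cases hc : s.var x < s.var y
    · obtain ⟨t, s', hp, h'⟩ := ihp (h.1 hc)
      exact ⟨_, _, .ite_true hc hp, h'⟩
    · obtain ⟨t, s', hq, h'⟩ := ihq (h.2 hc)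
      exact ⟨_, _, .ite_false hc hq, h'⟩
  | loop x y p ih => exact h

theorem wp_mono {W : ℕ} {p : Prog} {s : State} {Q Q' : ℕ → State → Prop} (h : wp W p s Q)
    (hQ : ∀ t s', Q t s' → Q' t s') : wp W p s Q' := by
  induction p generalizing s Q Q' with
  | seq p q ihp ihq => exact ihp h fun t s' h' => ihq h' fun t' s'' => hQ _ _
  | ite x y p q ihp ihq =>
    exact ⟨fun hc => ihp (h.1 hc) fun t s' => hQ _ _, fun hc => ihq (h.2 hc) fun t s' => hQ _ _⟩
  | loop x y p ih =>
    obtain ⟨t, s', he, h'⟩ := h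
    exact ⟨t, s', he, hQ _ _ h'⟩
  | const x c => exact ⟨h.1, hQ _ _ h.2⟩
  | add x y z => exact ⟨h.1, hQ _ _ h.2⟩
  | skip | copy x y | sub x y z | load x a y | store a x y => exact hQ _ _ h

/-- Loops are analysed with an invariant that carries the remaining time. -/
theorem wp_loop {W x y : ℕ} {p : Prog} (Inv : ℕ → State → Prop)
    (step : ∀ τ s, Inv τ s → s.var x < s.var y →
      wp W p s fun t s' => ∃ τ', τ' + t + 1 ≤ τ ∧ Inv τ' s')
    {τ : ℕ} {s : State} (h : Inv τ s) {Q : ℕ → State → Prop}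
    (hQ : ∀ t τ' s', Inv τ' s' → ¬ s'.var x < s'.var y → t + τ' ≤ τ + 1 → Q t s') :
    wp W (.loop x y p) s Q := by
  suffices ∃ t τ' s', Exec W (.loop x y p) s t s' ∧ Inv τ' s' ∧ ¬ s'.var x < s'.var y ∧
      t + τ' ≤ τ + 1 by
    obtain ⟨t, τ', s', he, hi, hc, ht⟩ := this
    exact ⟨t, s', he, hQ t τ' s' hi hc ht⟩
  clear hQ
  induction τ using Nat.strong_induction_on generalizing s with
  | _ τ ih =>
    by_cases hc : s.var x < s.var y
    · obtain ⟨t, s', he, τ', hτ, hi⟩ := wp_sound (step τ s h hc)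
      obtain ⟨t', τ'', s'', he', hi', hc', ht⟩ := ih τ' (by omega) hi
      exact ⟨_, τ'', s'', .loop_true hc he he', hi', hc', by omega⟩
    · exact ⟨1, τ, s, .loop_false hc, h, hc, by omega⟩

namespace State

variable (s : State) (x v a i : ℕ)

@[simp] theorem var_setVar (y : ℕ) : (s.setVar x v).var y = if y = x then v else s.var y :=
  Function.update_apply _ _ _ _

@[simp] theorem arr_setVar : (s.setVar x v).arr = s.arr := rfl

@[simp] theorem var_setArr : (s.setArr a i v).var = s.var := rfl

@[simp] theorem arr_setArr (b : ℕ) :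
    (s.setArr a i v).arr b = if b = a then Function.update (s.arr a) i v else s.arr b :=
  Function.update_apply _ _ _ _

end State

/-! ## Buckets stored as linked lists -/

/-- The linked list with the head `h` (`0` for the empty list, `i + 1` for the cell `i`). -/
def Chain (X : ℕ → ℕ) : ℕ → List ℕ → Prop
  | h, [] => h = 0
  | h, i :: l => h = i + 1 ∧ Chain X (X i) l

theorem Chain.update {X : ℕ → ℕ} {i v : ℕ} : ∀ {h : ℕ} {l : List ℕ}, Chain X h l → i ∉ l →
    Chain (Function.update X i v) h l
  | _, [], hc, _ => hc
  | _, j :: l, hc, hi => by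
    rw [List.mem_cons, not_or] at hi
    refine ⟨hc.1, ?_⟩
    rw [Function.update_of_ne (Ne.symm hi.1)]
    exact hc.2.update hi.2

/-- The buckets `L b`, stored with the heads `H` and the links `X`. -/
def IsBuckets (H X : ℕ → ℕ) (L : ℕ → List ℕ) : Prop := ∀ b, Chain X (H b) (L b)

namespace IsBuckets

variable {H X : ℕ → ℕ} {L : ℕ → List ℕ}

theorem empty (h : ∀ b, H b = 0) : IsBuckets H X fun _ => [] := h

/-- Links are indexed by cells, so a cell can be stored only once in all buckets together;
overwriting its link is safe only for a fresh cell. -/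
theorem push (h : IsBuckets H X L) (b : ℕ) {i : ℕ} (hi : ∀ b, i ∉ L b) :
    IsBuckets (Function.update H b (i + 1)) (Function.update X i (H b))
      (Function.update L b (i :: L b)) := by
  intro c
  by_cases hc : c = b
  · subst hc
    simp only [Function.update_self]
    refine ⟨rfl, ?_⟩
    rw [Function.update_self]
    exact (h c).update (hi c)
  · simp only [Function.update_of_ne hc]
    exact (h c).update (hi c)

theorem eq_nil (h : IsBuckets H X L) {b : ℕ} (hb : H b = 0) : L b = [] := by
  have := h b
  match hL : L b with
  | [] => rfl
  | i :: l =>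
    rw [hL] at this
    have := this.1
    omega

theorem pop (h : IsBuckets H X L) {b : ℕ} (hb : 0 < H b) :
    ∃ l, L b = (H b - 1) :: l ∧
      IsBuckets (Function.update H b (X (H b - 1))) X (Function.update L b l) := by
  have hb' := h b
  match hL : L b with
  | [] =>
    rw [hL] at hb'
    have : H b = 0 := hb'
    omega
  | i :: l =>
    rw [hL] at hb'
    obtain ⟨h1, h2⟩ := hb'
    refine ⟨l, by rw [h1, Nat.add_sub_cancel], fun c => ?_⟩
    by_cases hc : c = b
    · subst hc
      simp only [Function.update_self]
      rwa [h1, Nat.add_sub_cancel]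
    · simp only [Function.update_of_ne hc]
      exact h c

end IsBuckets

/-- The total size of the buckets with numbers below `n`. -/
def bucketSize (n : ℕ) (L : ℕ → List ℕ) : ℕ := ∑ b ∈ Finset.range n, (L b).length

theorem bucketSize_update {n b : ℕ} (hb : b < n) (L : ℕ → List ℕ) (l : List ℕ) :
    bucketSize n (Function.update L b l) + (L b).length = bucketSize n L + l.length := by
  unfold bucketSize
  rw [← Finset.add_sum_erase _ _ (Finset.mem_range.2 hb),
    ← Finset.add_sum_erase _ (fun b => (L b).length) (Finset.mem_range.2 hb),
    Finset.sum_congr rfl (g := fun b => (L b).length) fun c hc => by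
      rw [Function.update_of_ne (Finset.ne_of_mem_erase hc)]]
  simp only [Function.update_self]
  omega

theorem mem_update_cons {L : ℕ → List ℕ} {b i c j : ℕ} :
    j ∈ Function.update L b (i :: L b) c ↔ (c = b ∧ j = i) ∨ j ∈ L c := by
  by_cases hc : c = b
  · subst hc
    simp
  · simp [hc]

theorem mem_of_mem_pop {L : ℕ → List ℕ} {b i c j : ℕ} {l : List ℕ} (hL : L b = i :: l)
    (h : j ∈ Function.update L b l c) : j ∈ L c := by
  by_cases hc : c = b
  · subst hc
    rw [Function.update_self] at h
    rw [hL]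
    exact List.mem_cons_of_mem _ h
  · rwa [Function.update_of_ne hc] at h

theorem mem_pop {L : ℕ → List ℕ} {b i c j : ℕ} {l : List ℕ} (hL : L b = i :: l)
    (h : j ∈ L c) (hj : j ≠ i) : j ∈ Function.update L b l c := by
  by_cases hc : c = b
  · subst hc
    rw [Function.update_self]
    rw [hL] at h
    exact (List.mem_cons.1 h).resolve_left hj
  · rwa [Function.update_of_ne hc]

/-- The sum of `f` over the numbers below `n` that are not yet flagged. -/
def budget (n : ℕ) (f fl : ℕ → ℕ) : ℕ := ∑ v ∈ Finset.range n, if fl v = 0 then f v else 0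

/-- Flagging `u` releases `f u`, which pays for scanning its adjacency list. -/
theorem budget_update {n u : ℕ} (hu : u < n) (f fl : ℕ → ℕ) (h : fl u = 0) :
    budget n f (Function.update fl u 1) + f u = budget n f fl := by
  unfold budget
  rw [← Finset.add_sum_erase _ _ (Finset.mem_range.2 hu),
    ← Finset.add_sum_erase _ (fun v => if fl v = 0 then f v else 0) (Finset.mem_range.2 hu),
    Finset.sum_congr rfl (g := fun v => if fl v = 0 then f v else 0) fun c hc => by
      rw [Function.update_of_ne (Finset.ne_of_mem_erase hc)]]
  simp [h, add_comm]

/-! ## Adjacency lists -/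

/-- The adjacency lists of `G`, with `M` arcs, extended by a cell `M + v` for every vertex `v`. -/
structure Arcs {n : ℕ} (G : SimpleGraph (Fin n)) (off tgt : ℕ → ℕ) (M : ℕ) : Prop where
  off_zero : off 0 = 0
  off_last : off n = M
  off_succ : ∀ v : Fin n, off (v + 1) = off v + (G.neighborSet v).ncard
  tgt_lt : ∀ i < M, tgt i < n
  adj_iff : ∀ v w : Fin n, G.Adj v w ↔ ∃ i, off v ≤ i ∧ i < off (v + 1) ∧ tgt i = w
  -- Buckets hold arcs; these pseudo-arcs allow a vertex to be queued before any arc leads to it.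
  tgt_vertex : ∀ v < n, tgt (M + v) = v

namespace Arcs

variable {n : ℕ} {G : SimpleGraph (Fin n)} {off tgt : ℕ → ℕ} {M : ℕ} (h : Arcs G off tgt M)
include h

theorem off_mono {a b : ℕ} (hab : a ≤ b) (hb : b ≤ n) : off a ≤ off b := by
  induction b, hab using Nat.le_induction with
  | base => exact le_rfl
  | succ b hab ih =>
    have := h.off_succ ⟨b, hb⟩
    have := ih (by omega)
    simp only at *
    omega

theorem lt_of_arc {u i : ℕ} (hu : u < n) (hi : i < off (u + 1)) : i < M :=
  hi.trans_le (h.off_last ▸ h.off_mono hu le_rfl)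

theorem source_unique {u v i : ℕ} (hu : u < n) (hv : v < n) (h1 : off u ≤ i)
    (h2 : i < off (u + 1)) (h3 : off v ≤ i) (h4 : i < off (v + 1)) : u = v := by
  rcases lt_trichotomy u v with huv | huv | huv
  · have := h.off_mono (a := u + 1) (b := v) huv hv.le
    omega
  · exact huv
  · have := h.off_mono (a := v + 1) (b := u) huv hu.le
    omega

theorem tgt_adj (u : Fin n) {i : ℕ} (h1 : off u ≤ i) (h2 : i < off (u + 1)) :
    ∃ w : Fin n, tgt i = w ∧ G.Adj u w :=
  ⟨⟨tgt i, h.tgt_lt i (h.lt_of_arc u.2 h2)⟩, rfl, (h.adj_iff _ _).2 ⟨i, h1, h2, rfl⟩⟩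

/-- By counting: the list of `u` has as many cells as `u` has neighbours and its targets exhaust
them. -/
theorem tgt_inj (u : Fin n) {i j : ℕ} (hi1 : off u ≤ i) (hi2 : i < off (u + 1))
    (hj1 : off u ≤ j) (hj2 : j < off (u + 1)) (e : tgt i = tgt j) : i = j := by
  have himg : tgt '' (Finset.Ico (off u) (off (u + 1)) : Set ℕ)
      = (fun w : Fin n => (w : ℕ)) '' G.neighborSet u := by
    ext x
    constructor
    · rintro ⟨k, hk, rfl⟩
      rw [Finset.coe_Ico] at hk
      obtain ⟨w, hw, ha⟩ := h.tgt_adj u hk.1 hk.2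
      exact ⟨w, ha, hw.symm⟩
    · rintro ⟨w, hw, rfl⟩
      obtain ⟨k, h1, h2, h3⟩ := (h.adj_iff u w).1 hw
      exact ⟨k, by rw [Finset.coe_Ico]; exact ⟨h1, h2⟩, h3⟩
  have hcard : (tgt '' (Finset.Ico (off u) (off (u + 1)) : Set ℕ)).ncard
      = (Finset.Ico (off u) (off (u + 1)) : Set ℕ).ncard := by
    rw [himg, Set.ncard_image_of_injective _ Fin.val_injective, Set.ncard_coe_finset,
      Nat.card_Ico, h.off_succ u, Nat.add_sub_cancel_left]
  have hinj := Set.injOn_of_ncard_image_eq hcard (Finset.finite_toSet _)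
  rw [Finset.coe_Ico] at hinj
  exact hinj ⟨hi1, hi2⟩ ⟨hj1, hj2⟩ e

theorem budget_eq : budget n (fun v => off (v + 1) - off v) (fun _ => 0) = M := by
  unfold budget
  simp only [if_true]
  have : ∀ k ≤ n, ∑ v ∈ Finset.range k, (off (v + 1) - off v) = off k := by
    intro k hk
    induction k with
    | zero => simp [h.off_zero]
    | succ k ih =>
      rw [Finset.sum_range_succ, ih (by omega)]
      have := h.off_mono (Nat.le_add_right k 1) hk
      omega
  rw [this n le_rfl, h.off_last]

theorem arcs_eq : M = 2 * G.edgeSet.ncard := by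
  classical
  rw [← h.budget_eq]
  unfold budget
  simp only [if_true]
  rw [← Fin.sum_univ_eq_sum_range (fun v => off (v + 1) - off v), ← SimpleGraph.coe_edgeFinset G,
    Set.ncard_coe_finset, ← SimpleGraph.sum_degrees_eq_twice_card_edges]
  refine Finset.sum_congr rfl fun v _ => ?_
  rw [h.off_succ v, Nat.add_sub_cancel_left, ← SimpleGraph.card_neighborFinset_eq_degree,
    ← Set.ncard_coe_finset, SimpleGraph.coe_neighborFinset]

end Arcs


/-! ## Preparation -/

theorem Arcs.sub_lt {n : ℕ} {G : SimpleGraph (Fin n)} {off tgt : ℕ → ℕ} {M : ℕ}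
    (h : Arcs G off tgt M) {u : ℕ} (hu : u < n) : off (u + 1) - off u < n := by
  have h1 := h.off_succ ⟨u, hu⟩
  have h2 : (G.neighborSet ⟨u, hu⟩).ncard < (Set.univ : Set (Fin n)).ncard :=
    Set.ncard_lt_ncard (Set.ssubset_univ_iff.2 fun e =>
      G.loopless.irrefl ⟨u, hu⟩ (e.symm ▸ Set.mem_univ _ : (⟨u, hu⟩ : Fin n) ∈ G.neighborSet _))
  rw [Set.ncard_univ, Nat.card_fin] at h2
  simp only at h1
  omega

/-- The targets of the arcs and of the additional cells. -/
def extendedTarget (n M : ℕ) (adj : ℕ → ℕ) (i : ℕ) : ℕ :=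
  if M ≤ i ∧ i < M + n then i - M else adj i

theorem IsInput.arcs {n : ℕ} {G : SimpleGraph (Fin n)} {s : State} (h : IsInput G s) :
    Arcs G (s.arr 0) (extendedTarget n (s.arr 0 n) (s.arr 1)) (s.arr 0 n) := by
  have hmono : ∀ k ≤ n, ∀ j ≤ k, s.arr 0 j ≤ s.arr 0 k := by
    intro k hk
    induction k with
    | zero => intro j hj; rw [Nat.le_zero.1 hj]
    | succ k ih =>
      intro j hj
      have h1 : s.arr 0 (k + 1) = _ := h.off_succ ⟨k, hk⟩
      rcases Nat.le_succ_iff.1 hj with hj | rfl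
      · have := ih (by omega) j hj
        simp only at h1
        omega
      · exact le_rfl
  have hold : ∀ i < s.arr 0 n, extendedTarget n (s.arr 0 n) (s.arr 1) i = s.arr 1 i :=
    fun i hi => if_neg (by omega)
  refine ⟨h.off_zero, rfl, h.off_succ, fun i hi => hold i hi ▸ h.adj_lt i hi, fun v w => ?_, ?_⟩
  · rw [h.adj_iff]
    refine exists_congr fun i => and_congr_right fun _ => and_congr_right fun hi => ?_
    rw [hold i (hi.trans_le (hmono n le_rfl _ v.2))]
  · intro v hv
    unfold extendedTarget
    rw [if_pos (by omega)]
    omega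

/-- The registers and arrays that all phases of the computation share. -/
structure Base (n : ℕ) (off tgt : ℕ → ℕ) (s : State) : Prop where
  var_zero : s.var 0 = n
  var_one : s.var 1 = 0
  var_two : s.var 2 = 1
  off_eq : s.arr 0 = off
  tgt_eq : s.arr 1 = tgt

/-- Set up, for every vertex `v`, the cell `M + v`, the degree of `v` in array `7`, the buckets of
the vertices by degree in the arrays `5` and `6`, and a single bucket with all vertices in the arrays
`9` and `10`. -/
def prepareBody : Prog :=
  .add 5 3 4 ;; .store 1 5 4 ;; .add 6 4 2 ;; .load 7 0 4 ;; .load 8 0 6 ;; .sub 9 8 7 ;;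
  .store 7 4 9 ;; .load 10 5 9 ;; .store 6 5 10 ;; .add 11 5 2 ;; .store 5 9 11 ;;
  .load 12 9 1 ;; .store 10 5 12 ;; .store 9 1 11 ;; .copy 4 6

/-- Fill the initial buckets and arrays of all vertices. -/
def prepare : Prog := .const 2 1 ;; .load 3 0 0 ;; .loop 4 0 prepareBody

/-- The vertices before `v` have been prepared. -/
structure PrepareInv (n M v : ℕ) (off adj : ℕ → ℕ) (LA LB : ℕ → List ℕ) (s : State) :
    Prop where
  var_zero : s.var 0 = n
  var_one : s.var 1 = 0
  var_two : s.var 2 = 1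
  var_three : s.var 3 = M
  var_four : s.var 4 = v
  le : v ≤ n
  off_eq : s.arr 0 = off
  tgt_eq : s.arr 1 = extendedTarget v M adj
  deg : ∀ w < v, s.arr 7 w = off (w + 1) - off w
  bucketsA : IsBuckets (s.arr 5) (s.arr 6) LA
  memA : ∀ b j, j ∈ LA b ↔ ∃ w < v, j = M + w ∧ b = off (w + 1) - off w
  sizeA : bucketSize n LA = v
  bucketsB : IsBuckets (s.arr 9) (s.arr 10) LB
  memB : ∀ b j, j ∈ LB b ↔ b = 0 ∧ ∃ w < v, j = M + w
  sizeB : bucketSize n LB = v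
  zero : ∀ a, 2 ≤ a → a ≠ 5 → a ≠ 6 → a ≠ 7 → a ≠ 9 → a ≠ 10 → ∀ i, s.arr a i = 0

theorem PrepareInv.step {n : ℕ} {G : SimpleGraph (Fin n)} {W M v : ℕ} {off adj : ℕ → ℕ}
    {LA LB : ℕ → List ℕ} {s : State} (h : PrepareInv n M v off adj LA LB s)
    (hA : Arcs G off (extendedTarget n M adj) M) (hW : n + M + 1 ≤ W) (hv : v < n) :
    wp W prepareBody s fun t s' => t = 15 ∧
      ∃ LA' LB', PrepareInv n M (v + 1) off adj LA' LB' s' := by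
  have hd := hA.sub_lt hv
  unfold prepareBody
  simp only [wp, State.var_setVar, State.arr_setVar, State.var_setArr, State.arr_setArr,
    Nat.reduceEqDiff, reduceIte, h.var_one, h.var_two, h.var_three, h.var_four, h.off_eq, h.tgt_eq]
  have fA : ∀ b, M + v ∉ LA b := fun b hb => by
    obtain ⟨w, hw, e, -⟩ := (h.memA b _).1 hb
    omega
  have fB : ∀ b, M + v ∉ LB b := fun b hb => by
    obtain ⟨-, w, hw, e⟩ := (h.memB b _).1 hb
    omega
  refine ⟨by omega, by omega, by omega, trivial,
    Function.update LA (off (v + 1) - off v) ((M + v) :: LA (off (v + 1) - off v)),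
    Function.update LB 0 ((M + v) :: LB 0), ?_⟩
  constructor <;> try simp only [State.var_setVar, State.arr_setVar, State.var_setArr,
    State.arr_setArr, Nat.reduceEqDiff, reduceIte]
  · exact h.var_zero
  · exact h.var_one
  · exact h.var_two
  · exact h.var_three
  · exact hv
  · exact h.off_eq
  · rw [h.tgt_eq]
    funext i
    unfold extendedTarget
    by_cases hi : i = M + v
    · subst hi
      rw [Function.update_self, if_pos (by omega)]
      omega
    · rw [Function.update_of_ne hi]
      exact if_congr (by omega) rfl rfl
  · intro w hw
    by_cases e : w = v
    · rw [e, Function.update_self]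
    · rw [Function.update_of_ne e]
      exact h.deg w (by omega)
  · exact h.bucketsA.push _ fA
  · intro b j
    rw [mem_update_cons, h.memA]
    constructor
    · rintro (⟨rfl, rfl⟩ | ⟨w, hw, e⟩)
      · exact ⟨v, by omega, rfl, rfl⟩
      · exact ⟨w, by omega, e⟩
    · rintro ⟨w, hw, rfl, rfl⟩
      by_cases e : w = v
      · exact Or.inl (by rw [e]; exact ⟨rfl, rfl⟩)
      · exact Or.inr ⟨w, by omega, rfl, rfl⟩
  · have := bucketSize_update hd LA ((M + v) :: LA (off (v + 1) - off v))
    have := h.sizeA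
    rw [List.length_cons] at *
    omega
  · exact h.bucketsB.push _ fB
  · intro b j
    rw [mem_update_cons, h.memB]
    constructor
    · rintro (⟨rfl, rfl⟩ | ⟨e, w, hw, e'⟩)
      · exact ⟨rfl, v, by omega, rfl⟩
      · exact ⟨e, w, by omega, e'⟩
    · rintro ⟨rfl, w, hw, rfl⟩
      by_cases e : w = v
      · exact Or.inl ⟨rfl, by rw [e]⟩
      · exact Or.inr ⟨rfl, w, by omega, rfl⟩
  · have := bucketSize_update (show 0 < n by omega) LB ((M + v) :: LB 0)
    have := h.sizeB
    rw [List.length_cons] at *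
    omega
  · intro a h2 h5 h6 h7 h9 h10 i
    rw [if_neg h9, if_neg h10, if_neg h5, if_neg h6, if_neg h7, if_neg (by omega)]
    exact h.zero a h2 h5 h6 h7 h9 h10 i

theorem prepare_spec {n : ℕ} {G : SimpleGraph (Fin n)} {W : ℕ} {s : State} (hs : IsInput G s)
    (hW : n + s.arr 0 n + 1 ≤ W) :
    wp W prepare s fun t s' => t ≤ 16 * n + 10 ∧ ∃ LA LB,
      PrepareInv n (s.arr 0 n) n (s.arr 0) (s.arr 1) LA LB s' := by
  unfold prepare
  simp only [wp_seq, wp_const, wp_load]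
  refine ⟨by omega, ?_⟩
  refine wp_loop (fun τ s' => ∃ v LA LB, 16 * n ≤ τ + 16 * v ∧
    PrepareInv n (s.arr 0 n) v (s.arr 0) (s.arr 1) LA LB s') ?_ (τ := 16 * n)
    ⟨0, fun _ => [], fun _ => [], by omega, ?_⟩ ?_
  · rintro τ s' ⟨v, LA, LB, hτ, h⟩ hc
    rw [h.var_zero, h.var_four] at hc
    refine wp_mono (h.step hs.arcs hW hc) ?_
    rintro t s'' ⟨rfl, LA', LB', h'⟩
    exact ⟨τ - 16, by omega, v + 1, LA', LB', by omega, h'⟩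
  · have hv := hs.var_other
    have hz := hs.arr_other
    constructor <;> try simp only [State.var_setVar, State.arr_setVar, Nat.reduceEqDiff, reduceIte]
    · exact hs.var_zero
    · exact hv 1 (by omega)
    · rw [hs.var_zero]
    · exact hv 4 (by omega)
    · omega
    · funext i
      exact (if_neg (by omega)).symm
    · omega
    · exact IsBuckets.empty fun b => hz 5 (by omega) b
    · simp
    · simp [bucketSize]
    · exact IsBuckets.empty fun b => hz 9 (by omega) b
    · simp
    · simp [bucketSize]
    · exact fun a h2 _ _ _ _ _ i => hz a h2 i
  · rintro t τ' s' ⟨v, LA, LB, hτ, h⟩ hc ht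
    rw [h.var_zero, h.var_four] at hc
    obtain rfl : v = n := le_antisymm h.le (by omega)
    exact ⟨by omega, LA, LB, h⟩


/-! ## Computing the coreness by peeling -/

/-- Decrease the degree of the target of arc `8` unless it is at most the current level, and put the
arc into the bucket of the new degree. -/
def peelScanBody : Prog :=
  .load 10 1 8 ;; .load 11 7 10 ;;
  .ite 4 11
    (.sub 11 11 2 ;; .store 7 10 11 ;; .load 12 5 11 ;; .store 6 8 12 ;; .add 12 8 2 ;;
      .store 5 11 12)
    .skip ;;
  .add 8 8 2

/-- Remove a vertex from the bucket of the current level `4` or increase the level. -/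
def peelBody : Prog :=
  .load 5 5 4 ;;
  .ite 1 5
    (.sub 5 5 2 ;; .load 6 6 5 ;; .store 5 4 6 ;; .load 6 1 5 ;; .load 7 8 6 ;;
      .ite 1 7 .skip
        (.store 8 6 2 ;; .store 4 6 4 ;; .store 3 6 4 ;; .load 8 0 6 ;; .add 9 6 2 ;;
          .load 9 0 9 ;; .loop 8 9 peelScanBody))
    (.add 4 4 2)

/-- Compute the coreness of all vertices by removing vertices of minimum degree. -/
def peel : Prog := .const 4 0 ;; .loop 4 0 peelBody

open Classical in
/-- The arcs of `u` before `i` have been scanned since the state `s₀`. -/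
structure PeelScanInv (n k u i : ℕ) (off tgt : ℕ → ℕ) (s₀ : State) (L₀ L : ℕ → List ℕ)
    (s : State) : Prop where
  base : Base n off tgt s
  var_four : s.var 4 = k
  var_eight : s.var 8 = i
  var_nine : s.var 9 = off (u + 1)
  le : off u ≤ i
  le' : i ≤ off (u + 1)
  frame : ∀ a, a ≠ 5 → a ≠ 6 → a ≠ 7 → s.arr a = s₀.arr a
  buckets : IsBuckets (s.arr 5) (s.arr 6) L
  deg : ∀ w, s.arr 7 w = if k < s₀.arr 7 w ∧ ∃ j, off u ≤ j ∧ j < i ∧ tgt j = w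
    then s₀.arr 7 w - 1 else s₀.arr 7 w
  old : ∀ b j, j ∈ L₀ b → j ∈ L b
  mem : ∀ b j, j ∈ L b → j ∈ L₀ b ∨ off u ≤ j ∧ j < i ∧ s.arr 7 (tgt j) = b
  new : ∀ j, off u ≤ j → j < i → k < s₀.arr 7 (tgt j) → j ∈ L (s.arr 7 (tgt j))
  size : bucketSize n L ≤ bucketSize n L₀ + (i - off u)

theorem PeelScanInv.step {n : ℕ} {G : SimpleGraph (Fin n)} {W M k i : ℕ} {u : Fin n}
    {off tgt : ℕ → ℕ} {s₀ s : State} {L₀ L : ℕ → List ℕ}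
    (h : PeelScanInv n k u i off tgt s₀ L₀ L s) (hA : Arcs G off tgt M) (hW : n + M + 1 ≤ W)
    (hdeg : ∀ w < n, s₀.arr 7 w < n)
    (hfresh : ∀ b j, j ∈ L₀ b → off u ≤ j → j < off (u + 1) → False) (hi : i < off (u + 1)) :
    wp W peelScanBody s fun t s' => t ≤ 10 ∧
      ∃ L', PeelScanInv n k u (i + 1) off tgt s₀ L₀ L' s' := by
  classical
  have hiM := hA.lt_of_arc u.2 hi
  have hwn := hA.tgt_lt i hiM
  have hle := h.le
  -- No neighbour occurs twice in the list, so its degree is lowered at most once and still has its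
  -- value from before the scan.
  have hne : ∀ j, off u ≤ j → j < i → tgt j ≠ tgt i := fun j h1 h2 e => by
    have := hA.tgt_inj u h1 (by omega) h.le hi e
    omega
  have hold : s.arr 7 (tgt i) = s₀.arr 7 (tgt i) := by
    rw [h.deg, if_neg]
    rintro ⟨-, j, h1, h2, e⟩
    exact hne j h1 h2 e
  have hstep : ∀ w, (∃ j, off u ≤ j ∧ j < i + 1 ∧ tgt j = w) ↔
      w = tgt i ∨ ∃ j, off u ≤ j ∧ j < i ∧ tgt j = w := by
    intro w
    constructor
    · rintro ⟨j, h1, h2, rfl⟩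
      by_cases e : j = i
      · exact Or.inl (by rw [e])
      · exact Or.inr ⟨j, h1, by omega, rfl⟩
    · rintro (rfl | ⟨j, h1, h2, e⟩)
      · exact ⟨i, h.le, by omega, rfl⟩
      · exact ⟨j, h1, by omega, e⟩
  have hfr : ∀ b, i ∉ L b := fun b hb => by
    rcases h.mem b i hb with h1 | ⟨-, h1, -⟩
    · exact hfresh b i h1 h.le hi
    · omega
  unfold peelScanBody
  simp only [wp, State.var_setVar, State.arr_setVar, State.var_setArr, State.arr_setArr,
    Nat.reduceEqDiff, reduceIte, h.base.var_two, h.var_four, h.var_eight, h.base.tgt_eq, hold]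
  constructor
  · intro hk
    refine ⟨by omega, by omega, by omega, Function.update L (s₀.arr 7 (tgt i) - 1)
      (i :: L (s₀.arr 7 (tgt i) - 1)), ?_⟩
    refine ⟨⟨?_, ?_, ?_, ?_, ?_⟩, ?_, ?_, ?_, ?_, ?_, ?_, ?_, ?_, ?_, ?_, ?_, ?_⟩ <;>
      try simp only [State.var_setVar, State.arr_setVar, State.var_setArr,
        State.arr_setArr, Nat.reduceEqDiff, reduceIte]
    · exact h.base.var_zero
    · exact h.base.var_one
    · exact h.base.var_two
    · exact h.base.off_eq
    · exact h.base.tgt_eq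
    · exact h.var_four
    · exact h.var_nine
    · omega
    · omega
    · intro a h5 h6 h7
      rw [if_neg h5, if_neg h6, if_neg h7]
      exact h.frame a h5 h6 h7
    · exact h.buckets.push _ hfr
    · intro w
      by_cases e : w = tgt i
      · subst e
        rw [Function.update_self, if_pos ⟨hk, (hstep _).2 (Or.inl rfl)⟩]
      · rw [Function.update_of_ne e, h.deg]
        exact if_congr (and_congr_right fun _ => ((hstep w).trans (or_iff_right e)).symm) rfl rfl
    · intro b j hj
      exact mem_update_cons.2 (Or.inr (h.old b j hj))
    · intro b j hj
      rcases mem_update_cons.1 hj with ⟨rfl, rfl⟩ | hj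
      · exact Or.inr ⟨h.le, by omega, Function.update_self _ _ _⟩
      · refine (h.mem b j hj).imp id ?_
        rintro ⟨h1, h2, h3⟩
        exact ⟨h1, by omega, by rw [Function.update_of_ne (hne j h1 h2), h3]⟩
    · intro j h1 h2 h3
      rw [mem_update_cons]
      by_cases e : j = i
      · exact Or.inl (by rw [e, Function.update_self]; exact ⟨rfl, rfl⟩)
      · rw [Function.update_of_ne (hne j h1 (by omega))]
        exact Or.inr (h.new j h1 (by omega) h3)
    · have h1 := bucketSize_update (n := n) (b := s₀.arr 7 (tgt i) - 1)
        (by have := hdeg _ hwn; omega) L (i :: L (s₀.arr 7 (tgt i) - 1))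
      have := h.size
      rw [List.length_cons] at h1
      omega
  · intro hk
    refine ⟨by omega, by omega, L, ?_⟩
    refine ⟨⟨?_, ?_, ?_, ?_, ?_⟩, ?_, ?_, ?_, ?_, ?_, ?_, ?_, ?_, ?_, ?_, ?_, ?_⟩ <;>
      try simp only [State.var_setVar, State.arr_setVar, Nat.reduceEqDiff, reduceIte]
    · exact h.base.var_zero
    · exact h.base.var_one
    · exact h.base.var_two
    · exact h.base.off_eq
    · exact h.base.tgt_eq
    · exact h.var_four
    · exact h.var_nine
    · omega
    · omega
    · exact h.frame
    · exact h.buckets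
    · intro w
      rw [h.deg]
      by_cases e : w = tgt i
      · subst e
        rw [if_neg fun h => hk h.1, if_neg fun h => hk h.1]
      · exact if_congr (and_congr_right fun _ => ((hstep w).trans (or_iff_right e)).symm) rfl rfl
    · exact h.old
    · intro b j hj
      refine (h.mem b j hj).imp id ?_
      rintro ⟨h1, h2, h3⟩
      exact ⟨h1, by omega, h3⟩
    · intro j h1 h2 h3
      by_cases e : j = i
      · exact absurd (e ▸ h3) hk
      · exact h.new j h1 (by omega) h3
    · have := h.size
      omega

theorem PeelScanInv.loop {n : ℕ} {G : SimpleGraph (Fin n)} {W M k : ℕ} {u : Fin n}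
    {off tgt : ℕ → ℕ} {s₀ : State} {L₀ : ℕ → List ℕ} (hA : Arcs G off tgt M)
    (hW : n + M + 1 ≤ W) (hdeg : ∀ w < n, s₀.arr 7 w < n)
    (hfresh : ∀ b j, j ∈ L₀ b → off u ≤ j → j < off (u + 1) → False)
    (h : PeelScanInv n k u (off u) off tgt s₀ L₀ L₀ s₀) :
    wp W (.loop 8 9 peelScanBody) s₀ fun t s => t ≤ 11 * (off (u + 1) - off u) + 1 ∧
      ∃ L, PeelScanInv n k u (off (u + 1)) off tgt s₀ L₀ L s := by
  refine wp_loop (fun τ s => ∃ i L, 11 * (off (u + 1) - i) ≤ τ ∧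
    PeelScanInv n k u i off tgt s₀ L₀ L s) ?_ (τ := 11 * (off (u + 1) - off u))
    ⟨_, L₀, le_rfl, h⟩ ?_
  · rintro τ s ⟨i, L, hτ, hs⟩ hc
    rw [hs.var_eight, hs.var_nine] at hc
    refine wp_mono (hs.step hA hW hdeg hfresh hc) ?_
    rintro t s' ⟨ht, L', hs'⟩
    exact ⟨τ - 11, by omega, i + 1, L', by omega, hs'⟩
  · rintro t τ s ⟨i, L, hτ, hs⟩ hc ht
    rw [hs.var_eight, hs.var_nine] at hc
    obtain rfl : i = off (u + 1) := le_antisymm hs.le' (by omega)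
    exact ⟨by omega, L, hs⟩


/-- The invariant of the peeling at level `k`: the vertices flagged in array `8` are removed, and
every other vertex has a cell in the bucket of its current degree. -/
structure PeelInv {n : ℕ} (G : SimpleGraph (Fin n)) (M k : ℕ) (off tgt : ℕ → ℕ) (s₀ : State)
    (L : ℕ → List ℕ) (s : State) : Prop where
  base : Base n off tgt s
  var_four : s.var 4 = k
  le : k ≤ n
  frame : ∀ a, 9 ≤ a → s.arr a = s₀.arr a
  buckets : IsBuckets (s.arr 5) (s.arr 6) L
  flag : ∀ v, s.arr 8 v = 0 ∨ s.arr 8 v = 1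
  tgt_lt : ∀ b j, j ∈ L b → tgt j < n
  -- Cells are not moved when a degree drops; a fresh cell is pushed instead. A remaining vertex may
  -- thus keep stale cells in higher buckets, which are discarded after its removal.
  bucket_le : ∀ b j, j ∈ L b → s.arr 8 (tgt j) = 0 → s.arr 7 (tgt j) ≤ b
  source : ∀ b j, j ∈ L b → M ≤ j ∨ ∃ u : Fin n, s.arr 8 u = 1 ∧ off u ≤ j ∧ j < off (u + 1)
  mem : ∀ v : Fin n, s.arr 8 v = 0 → ∃ j ∈ L (s.arr 7 v), tgt j = v
  deg : ∀ v : Fin n, s.arr 8 v = 0 →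
    -- The scan does not lower degrees below the current level, whence the maximum.
    s.arr 7 v = max k {w : Fin n | s.arr 8 w = 0 ∧ G.Adj v w}.ncard
  deg_removed : ∀ v : Fin n, s.arr 8 v = 1 → s.arr 7 v ≤ k
  lower : ∀ v : Fin n, s.arr 8 v = 0 → k ≤ coreness G v
  upper : ∀ v : Fin n, s.arr 8 v = 1 → coreness G v ≤ k ∧ s.arr 3 v = coreness G v ∧
    s.arr 4 v = coreness G v

section

variable {n : ℕ} {G : SimpleGraph (Fin n)} {W M k : ℕ} {off tgt : ℕ → ℕ} {s₀ s : State}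
  {L : ℕ → List ℕ}

theorem ncard_adj_lt (v : Fin n) (U : Set (Fin n)) : {w | w ∈ U ∧ G.Adj v w}.ncard < n := by
  have : {w | w ∈ U ∧ G.Adj v w}.ncard < (Set.univ : Set (Fin n)).ncard :=
    Set.ncard_lt_ncard (Set.ssubset_univ_iff.2 fun e =>
      G.loopless.irrefl v (e.symm ▸ Set.mem_univ v : v ∈ {w | w ∈ U ∧ G.Adj v w}).2)
  rwa [Set.ncard_univ, Nat.card_fin] at this

/-- If the bucket of the current level is empty, the level can be increased. -/
theorem PeelInv.next_level (h : PeelInv G M k off tgt s₀ L s) (hL : L k = []) (hk : k < n)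
    {s' : State} (hb : Base n off tgt s') (h4 : s'.var 4 = k + 1) (hs : s'.arr = s.arr) :
    PeelInv G M (k + 1) off tgt s₀ L s' := by
  have key : ∀ v : Fin n, s.arr 8 v = 0 → k + 1 ≤ {w : Fin n | s.arr 8 w = 0 ∧ G.Adj v w}.ncard := by
    intro v hv
    obtain ⟨j, hj, -⟩ := h.mem v hv
    have hne : s.arr 7 v ≠ k := fun e => by
      rw [e, hL] at hj
      exact absurd hj List.not_mem_nil
    have := h.deg v hv
    omega
  refine ⟨hb, h4, hk, ?_, ?_, ?_, ?_, ?_, ?_, ?_, ?_, ?_, ?_, ?_⟩ <;> try rw [hs]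
  · exact h.frame
  · exact h.buckets
  · exact h.flag
  · exact h.tgt_lt
  · exact h.bucket_le
  · exact h.source
  · exact h.mem
  · intro v hv
    have h1 := key v hv
    have h2 := h.deg v hv
    change s.arr 7 v = max (k + 1) {w : Fin n | s.arr 8 w = 0 ∧ G.Adj v w}.ncard
    omega
  · exact fun v hv => (h.deg_removed v hv).trans (Nat.le_succ k)
  · intro v hv
    rw [← mem_coreSet_iff]
    -- With bucket `k` empty, the remaining vertices induce a subgraph of minimum degree at least `k
    -- + 1`.
    exact ⟨{w | s.arr 8 w = 0}, fun w hw => key w hw, hv⟩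
  · exact fun v hv => ⟨(h.upper v hv).1.trans (Nat.le_succ k), (h.upper v hv).2⟩

/-- A vertex in the bucket of the current level has coreness `k`. -/
theorem PeelInv.coreness_eq (h : PeelInv G M k off tgt s₀ L s) {u : Fin n} {j : ℕ} (hj : j ∈ L k)
    (hju : tgt j = u) (hu : s.arr 8 u = 0) : coreness G u = k := by
  refine le_antisymm ?_ (h.lower u hu)
  by_contra! hcon
  -- With coreness above `k`, the vertex would have `k + 1` neighbours of coreness above `k`. None
  -- of them is removed yet, so its current degree would exceed its bucket.
  have h1 := le_ncard_coreness G hcon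
  have h2 : {w | k + 1 ≤ coreness G w ∧ G.Adj u w}.ncard
      ≤ {w : Fin n | s.arr 8 w = 0 ∧ G.Adj u w}.ncard := by
    refine Set.ncard_le_ncard (fun w hw => ⟨?_, hw.2⟩) (Set.toFinite _)
    rcases h.flag w with h0 | h0
    · exact h0
    · have := (h.upper w h0).1
      have := hw.1
      omega
  have h3 := h.deg u hu
  have h4 := h.bucket_le k j hj (hju ▸ hu)
  rw [hju] at h4
  have h5 : k + 1 ≤ {w | k + 1 ≤ coreness G w ∧ G.Adj u w}.ncard := h1
  omega

/-- Popping an arc and removing its target `u`. -/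
theorem PeelInv.remove (h : PeelInv G M k off tgt s₀ L s) (hA : Arcs G off tgt M)
    {u : Fin n} {j : ℕ} {l : List ℕ} (hL : L k = j :: l) (hju : tgt j = u) (hu : s.arr 8 u = 0)
    {L' L'' : ℕ → List ℕ} (hL' : L' = Function.update L k l) {s₁ s₂ : State}
    (hs8 : s₁.arr 8 = Function.update (s.arr 8) u 1)
    (hs4 : s₁.arr 4 = Function.update (s.arr 4) u k)
    (hs3 : s₁.arr 3 = Function.update (s.arr 3) u k)
    (hs7 : s₁.arr 7 = s.arr 7) (hs9 : ∀ a, 9 ≤ a → s₁.arr a = s.arr a)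
    (hs : PeelScanInv n k u (off (u + 1)) off tgt s₁ L' L'' s₂) :
    PeelInv G M k off tgt s₀ L'' s₂ := by
  have hcu := h.coreness_eq (u := u) (hL ▸ List.mem_cons_self) hju hu
  have f8 : s₂.arr 8 = Function.update (s.arr 8) u 1 := (hs.frame 8 (by omega) (by omega)
    (by omega)).trans hs8
  have f4 : s₂.arr 4 = Function.update (s.arr 4) u k := (hs.frame 4 (by omega) (by omega)
    (by omega)).trans hs4
  have f3 : s₂.arr 3 = Function.update (s.arr 3) u k := (hs.frame 3 (by omega) (by omega)
    (by omega)).trans hs3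
  have fu : s₂.arr 8 u = 1 := by rw [f8, Function.update_self]
  have fne : ∀ {w : Fin n}, w ≠ u → s₂.arr 8 w = s.arr 8 w := fun hw => by
    rw [f8, Function.update_of_ne (fun e => hw (Fin.ext e))]
  have f0 : ∀ {w : ℕ}, s₂.arr 8 w = 0 → s.arr 8 w = 0 ∧ w ≠ u := fun {w} hw => by
    rw [f8] at hw
    by_cases e : w = u
    · rw [e, Function.update_self] at hw
      omega
    · rw [Function.update_of_ne e] at hw
      exact ⟨hw, e⟩
  have hdeg := hs.deg
  rw [hs7] at hdeg
  have hdle : ∀ w, s₂.arr 7 w ≤ s.arr 7 w := fun w => by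
    rw [hdeg]
    split_ifs <;> omega
  have hdge : ∀ w, k ≤ s.arr 7 w → k ≤ s₂.arr 7 w := fun w hw => by
    rw [hdeg]
    split_ifs <;> omega
  have hsub : ∀ {b i}, i ∈ L' b → i ∈ L b := fun hi => by
    rw [hL'] at hi
    exact mem_of_mem_pop hL hi
  have harc : ∀ w : Fin n, (∃ i, off u ≤ i ∧ i < off (u + 1) ∧ tgt i = w) ↔ G.Adj u w :=
    fun w => (hA.adj_iff u w).symm
  refine ⟨hs.base, hs.var_four, h.le, ?_, hs.buckets, ?_, ?_, ?_, ?_, ?_, ?_, ?_, ?_, ?_⟩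
  · intro a ha
    rw [hs.frame a (by omega) (by omega) (by omega), hs9 a ha, h.frame a ha]
  · intro v
    rw [f8]
    by_cases e : v = u
    · rw [e, Function.update_self]
      exact Or.inr rfl
    · rw [Function.update_of_ne e]
      exact h.flag v
  · intro b i hi
    rcases hs.mem b i hi with hi | ⟨h1, h2, -⟩
    · exact h.tgt_lt b i (hsub hi)
    · exact hA.tgt_lt i (hA.lt_of_arc u.2 h2)
  · intro b i hi hi0
    rcases hs.mem b i hi with hi | ⟨h1, h2, h3⟩
    · exact (hdle _).trans (h.bucket_le b i (hsub hi) (f0 hi0).1)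
    · exact h3.le
  · intro b i hi
    rcases hs.mem b i hi with hi | ⟨h1, h2, h3⟩
    · refine (h.source b i (hsub hi)).imp id ?_
      rintro ⟨w, hw, e⟩
      refine ⟨w, ?_, e⟩
      by_cases hwu : w = u
      · rw [hwu, fu]
      · rw [fne hwu, hw]
    · exact Or.inr ⟨u, fu, h1, h2⟩
  · intro v hv
    obtain ⟨hv0, hvu⟩ := f0 hv
    by_cases hc : k < s.arr 7 v ∧ ∃ i, off u ≤ i ∧ i < off (u + 1) ∧ tgt i = v
    · obtain ⟨hk, i, h1, h2, h3⟩ := hc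
      refine ⟨i, ?_, h3⟩
      rw [← h3]
      exact hs.new i h1 h2 (by rw [hs7, h3]; exact hk)
    · obtain ⟨i, hi, e⟩ := h.mem v hv0
      refine ⟨i, hs.old _ _ ?_, e⟩
      rw [hdeg, if_neg hc, hL']
      refine mem_pop hL hi ?_
      rintro rfl
      exact hvu (e.symm.trans hju)
  · intro v hv
    obtain ⟨hv0, hvu⟩ := f0 hv
    have hdv := h.deg v hv0
    have hset : {w : Fin n | s₂.arr 8 w = 0 ∧ G.Adj v w}
        = {w : Fin n | s.arr 8 w = 0 ∧ G.Adj v w} \ {u} := by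
      ext w
      constructor
      · rintro ⟨hw, ha⟩
        exact ⟨⟨(f0 hw).1, ha⟩, fun e => (f0 hw).2 (by rw [Set.mem_singleton_iff.1 e])⟩
      · rintro ⟨⟨hw, ha⟩, hwu⟩
        exact ⟨by rw [fne hwu, hw], ha⟩
    rw [hset, hdeg]
    by_cases ha : G.Adj v u
    · rw [Set.ncard_sdiff_singleton_of_mem (show u ∈ {w : Fin n | s.arr 8 w = 0 ∧ G.Adj v w} from
        ⟨hu, ha⟩)]
      have hex := (harc v).2 ha.symm
      by_cases hk : k < s.arr 7 v
      · rw [if_pos ⟨hk, hex⟩]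
        omega
      · rw [if_neg fun hh => hk hh.1]
        omega
    · rw [if_neg fun hh => ha ((harc v).1 hh.2).symm, hdv, Set.sdiff_singleton_eq_self]
      exact fun hh => ha hh.2
  · intro v hv
    refine (hdle v).trans ?_
    by_cases hvu : v = u
    · have := h.bucket_le k j (hL ▸ List.mem_cons_self) (hju ▸ hu)
      rwa [hju, ← hvu] at this
    · exact h.deg_removed v (by rw [← fne hvu, hv])
  · exact fun v hv => h.lower v (f0 hv).1
  · intro v hv
    by_cases hvu : v = u
    · rw [f3, f4, hvu, Function.update_self, Function.update_self, hcu]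
      exact ⟨le_rfl, rfl, rfl⟩
    · have hne : (v : ℕ) ≠ u := fun e => hvu (Fin.ext e)
      rw [f3, f4, Function.update_of_ne hne, Function.update_of_ne hne]
      exact h.upper v (by rw [← fne hvu, hv])

/-- Popping an arc whose target has been removed before. -/
theorem PeelInv.discard (h : PeelInv G M k off tgt s₀ L s)
    {j : ℕ} {l : List ℕ} (hL : L k = j :: l) (hu : 0 < s.arr 8 (tgt j)) {s' : State}
    (hb : Base n off tgt s') (h4 : s'.var 4 = k) (hs : ∀ a, a ≠ 5 → s'.arr a = s.arr a)
    (hB : IsBuckets (s'.arr 5) (s'.arr 6) (Function.update L k l)) :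
    PeelInv G M k off tgt s₀ (Function.update L k l) s' := by
  have hsub : ∀ {b i}, i ∈ Function.update L k l b → i ∈ L b := fun hi => mem_of_mem_pop hL hi
  have e3 := hs 3 (by omega)
  have e4 := hs 4 (by omega)
  have e7 := hs 7 (by omega)
  have e8 := hs 8 (by omega)
  refine ⟨hb, h4, h.le, fun a ha => (hs a (by omega)).trans (h.frame a ha), hB, ?_, ?_, ?_, ?_, ?_,
    ?_, ?_, ?_, ?_⟩ <;> try simp only [e3, e4, e7, e8]
  · exact h.flag
  · exact fun b i hi => h.tgt_lt b i (hsub hi)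
  · exact fun b i hi => h.bucket_le b i (hsub hi)
  · exact fun b i hi => h.source b i (hsub hi)
  · intro v hv
    obtain ⟨i, hi, e⟩ := h.mem v hv
    refine ⟨i, mem_pop hL hi ?_, e⟩
    rintro rfl
    rw [e] at hu
    omega
  · exact h.deg
  · exact h.deg_removed
  · exact h.lower
  · exact h.upper

end


/-! ### Time bound and correctness of the peeling -/

section

variable {n : ℕ} {G : SimpleGraph (Fin n)} {W M k : ℕ} {off tgt : ℕ → ℕ} {s₀ s : State}
  {L : ℕ → List ℕ}

/-- An upper bound for the time that the remaining search takes. -/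
def searchPotential (n k : ℕ) (off fl : ℕ → ℕ) (L : ℕ → List ℕ) : ℕ :=
  10 * bucketSize n L + budget n (fun v => 25 * (off (v + 1) - off v) + 20) fl + 4 * k

/-- A popped cell pays 10 and a level 4. Removing `u` releases 25 per arc and 20 more, enough for
the scan at 11 per arc and for the 10 that each pushed cell adds to the potential. The levels still
ahead are counted by `n - k`. -/
theorem PeelInv.step (h : PeelInv G M k off tgt s₀ L s) (hA : Arcs G off tgt M)
    (hW : n + M + 1 ≤ W) (hk : k < n) :
    wp W peelBody s fun t s' => ∃ k' L', PeelInv G M k' off tgt s₀ L' s' ∧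
      searchPotential n (n - k') off (s'.arr 8) L' + t + 1
        ≤ searchPotential n (n - k) off (s.arr 8) L := by
  unfold peelBody searchPotential
  simp only [wp_seq, wp_ite, wp_load, wp_add, wp_sub, wp_store, wp_skip, State.var_setVar,
    State.arr_setVar, State.var_setArr, State.arr_setArr, Nat.reduceEqDiff, reduceIte,
    h.base.var_one, h.base.var_two, h.var_four, h.base.tgt_eq, h.base.off_eq]
  constructor
  swap
  · intro h0
    refine ⟨by omega, k + 1, L, ?_, by omega⟩
    exact h.next_level (h.buckets.eq_nil (by omega)) hk
      ⟨h.base.var_zero, h.base.var_one, h.base.var_two, h.base.off_eq, h.base.tgt_eq⟩ rfl rfl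
  intro h0
  obtain ⟨l, hL, hB⟩ := h.buckets.pop h0
  have hsz := bucketSize_update hk L l
  rw [hL, List.length_cons] at hsz
  have hjL : s.arr 5 k - 1 ∈ L k := hL ▸ List.mem_cons_self
  have hjn := h.tgt_lt _ _ hjL
  constructor
  · intro hf
    refine ⟨k, Function.update L k l, h.discard hL hf ?_ ?_ ?_ ?_, by omega⟩
    · exact ⟨h.base.var_zero, h.base.var_one, h.base.var_two, h.base.off_eq, h.base.tgt_eq⟩
    · exact h.var_four
    · intro a ha
      simp [ha]
    · simpa using hB
  · intro hf
    obtain ⟨u, hu⟩ : ∃ u : Fin n, tgt (s.arr 5 k - 1) = u := ⟨⟨_, hjn⟩, rfl⟩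
    rw [hu] at hf ⊢
    have hf0 : s.arr 8 u = 0 := by omega
    have hbud := budget_update u.2 (fun v => 25 * (off (v + 1) - off v) + 20) _ hf0
    have hmono := hA.off_mono (Nat.le_add_right u 1) u.2
    have hM := hA.off_mono u.2 le_rfl
    refine ⟨by have := u.2; omega, ?_⟩
    refine wp_mono (PeelScanInv.loop (k := k) (u := u) (L₀ := Function.update L k l) hA hW ?_ ?_ ?_) ?_
    · simp only [State.arr_setVar, State.arr_setArr, Nat.reduceEqDiff, reduceIte]
      intro w hw
      rcases h.flag w with h8 | h8
      · rw [h.deg ⟨w, hw⟩ h8]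
        exact max_lt hk (ncard_adj_lt _ {w : Fin n | s.arr 8 w = 0})
      · exact (h.deg_removed ⟨w, hw⟩ h8).trans_lt hk
    -- Stored cells are vertex cells or arcs of removed vertices; `u` is only now being removed, so
    -- its arcs are fresh.
    · intro b j hj h1 h2
      rcases h.source b j (mem_of_mem_pop hL hj) with h3 | ⟨v, h3, h4, h5⟩
      · have := hA.lt_of_arc u.2 h2
        omega
      · rw [← hA.source_unique u.2 v.2 h1 h2 h4 h5] at h3
        omega
    · refine ⟨⟨?_, ?_, ?_, ?_, ?_⟩, ?_, ?_, ?_, ?_, ?_, ?_, ?_,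
        fun w => (if_neg (by rintro ⟨-, j, h1, h2, -⟩; omega)).symm, ?_, ?_, ?_, ?_⟩ <;>
        try simp only [State.var_setVar, State.arr_setVar, State.var_setArr, State.arr_setArr,
          Nat.reduceEqDiff, reduceIte]
      · exact h.base.var_zero
      · exact h.base.var_one
      · exact h.base.var_two
      · exact h.base.off_eq
      · exact h.base.tgt_eq
      · exact h.var_four
      · exact le_rfl
      · exact hmono
      · exact fun _ _ _ _ => trivial
      · exact hB
      · exact fun _ _ => id
      · exact fun _ _ => Or.inl
      · intro j h1 h2
        omega
      · omega
    · rintro t s' ⟨ht, L', hs⟩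
      refine ⟨k, L', h.remove hA hL hu hf0 rfl ?_ ?_ ?_ ?_ ?_ hs, ?_⟩
      any_goals simp only [State.arr_setVar, State.arr_setArr, Nat.reduceEqDiff, reduceIte]
      · intro a ha
        rw [if_neg (by omega), if_neg (by omega), if_neg (by omega), if_neg (by omega)]
      · rw [hs.frame 8 (by omega) (by omega) (by omega)]
        have hsz' := hs.size
        simp only [State.arr_setVar, State.arr_setArr, Nat.reduceEqDiff, reduceIte]
        omega

end

theorem Arcs.budget_search {n : ℕ} {G : SimpleGraph (Fin n)} {off tgt : ℕ → ℕ} {M : ℕ}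
    (hA : Arcs G off tgt M) :
    budget n (fun v => 25 * (off (v + 1) - off v) + 20) (fun _ => 0) = 25 * M + 20 * n := by
  rw [← hA.budget_eq]
  simp only [budget, if_true, Finset.sum_add_distrib, Finset.mul_sum, Finset.sum_const,
    Finset.card_range, smul_eq_mul]
  ring

theorem peel_spec {n : ℕ} {G : SimpleGraph (Fin n)} {W M : ℕ} {off adj : ℕ → ℕ}
    {LA LB : ℕ → List ℕ} {s : State} (hs : PrepareInv n M n off adj LA LB s)
    (hA : Arcs G off (extendedTarget n M adj) M) (hW : n + M + 1 ≤ W) :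
    wp W peel s fun t s' => t ≤ 34 * n + 25 * M + 10 ∧ Base n off (extendedTarget n M adj) s' ∧
      (∀ v : Fin n, s'.arr 3 v = coreness G v) ∧ (∀ v : Fin n, s'.arr 4 v = coreness G v) ∧
      ∀ a, 9 ≤ a → s'.arr a = s.arr a := by
  unfold peel
  simp only [wp_seq, wp_const]
  refine ⟨by omega, ?_⟩
  set tgt := extendedTarget n M adj with htgt
  have hbud := hA.budget_search
  have h8 : s.arr 8 = fun _ => 0 := funext fun i => hs.zero 8 (by omega) (by omega) (by omega)
    (by omega) (by omega) (by omega) i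
  -- The initial potential: `n` cells at 10, the full budget `25 M + 20 n`, and `n` levels at 4.
  refine wp_loop (fun τ s' => ∃ k L, PeelInv G M k off tgt s L s' ∧
    searchPotential n (n - k) off (s'.arr 8) L ≤ τ) ?_ (τ := 34 * n + 25 * M) ⟨0, LA, ?_, ?_⟩ ?_
  · rintro τ s' ⟨k, L, h, hτ⟩ hc
    rw [h.base.var_zero, h.var_four] at hc
    refine wp_mono (h.step hA hW hc) ?_
    rintro t s'' ⟨k', L', h', ht⟩
    exact ⟨searchPotential n (n - k') off (s''.arr 8) L', by omega, k', L', h', le_rfl⟩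
  · have hmemA : ∀ {b j}, j ∈ LA b → ∃ w < n, j = M + w ∧ tgt j = w ∧ b = off (w + 1) - off w := by
      intro b j hj
      obtain ⟨w, hw, rfl, e⟩ := (hs.memA b j).1 hj
      exact ⟨w, hw, rfl, hA.tgt_vertex w hw, e⟩
    refine ⟨⟨?_, ?_, ?_, ?_, ?_⟩, ?_, ?_, ?_, ?_, ?_, ?_, ?_, ?_, ?_, ?_, ?_, ?_, ?_⟩ <;>
      try simp only [State.var_setVar, State.arr_setVar, Nat.reduceEqDiff, reduceIte, h8]
    · exact hs.var_zero
    · exact hs.var_one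
    · exact hs.var_two
    · exact hs.off_eq
    · exact hs.tgt_eq
    · omega
    · exact fun _ _ => trivial
    · exact hs.bucketsA
    · exact fun _ => Or.inl trivial
    · intro b j hj
      obtain ⟨w, hw, -, e, -⟩ := hmemA hj
      rwa [e]
    · intro b j hj _
      obtain ⟨w, hw, -, e, e'⟩ := hmemA hj
      rw [e, hs.deg w hw, e']
    · intro b j hj
      obtain ⟨w, -, rfl, -, -⟩ := hmemA hj
      exact Or.inl (Nat.le_add_right _ _)
    · intro v _
      refine ⟨M + v, (hs.memA _ _).2 ⟨v, v.2, rfl, hs.deg v v.2⟩, hA.tgt_vertex v v.2⟩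
    · intro v _
      rw [hs.deg v v.2, hA.off_succ v, Nat.add_sub_cancel_left, Nat.zero_max]
      congr 1
      ext w
      exact (and_iff_right trivial).symm
    · intro v h
      simp at h
    · exact fun _ _ => Nat.zero_le _
    · intro v h
      simp at h
  · simp only [searchPotential, State.arr_setVar, h8, hbud, hs.sizeA]
    omega
  · rintro t τ s' ⟨k, L, h, -⟩ hc ht
    rw [h.base.var_zero, h.var_four] at hc
    -- A remaining vertex would have coreness at least `n`, but coreness is at most the degree,
    -- which is below `n`.
    have hall : ∀ v : Fin n, s'.arr 8 v = 1 := by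
      intro v
      refine (h.flag v).resolve_left fun h0 => ?_
      have h1 := h.lower v h0
      have h2 := coreness_le_ncard G v
      have h3 := ncard_adj_lt (G := G) v Set.univ
      simp only [Set.mem_univ, true_and] at h3
      have h4 : (G.neighborSet v).ncard < n := h3
      omega
    exact ⟨by omega, h.base, fun v => (h.upper v (hall v)).2.1, fun v => (h.upper v (hall v)).2.2,
      h.frame⟩


/-! ## Computing a core order -/

/-- Put arc `8` into the bucket of its weight; `4` is the coreness of its source. -/
def searchScanBody : Prog :=
  .load 10 1 8 ;; .load 11 4 10 ;; .ite 11 4 .skip (.copy 11 4) ;; .load 12 9 11 ;;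
  .store 10 8 12 ;; .add 12 8 2 ;; .store 9 11 12 ;; .add 8 8 2

/-- Take an arc from the bucket of the current weight `4` and visit its target, or decrease the
weight. -/
def searchBody : Prog :=
  .load 6 9 4 ;;
  .ite 1 6
    (.sub 6 6 2 ;; .load 7 10 6 ;; .store 9 4 7 ;; .load 7 1 6 ;; .load 8 11 7 ;;
      .ite 1 8 .skip
        (.store 11 7 2 ;; .store 12 5 7 ;; .store 13 5 4 ;; .add 5 5 2 ;; .load 4 4 7 ;;
          .load 8 0 7 ;; .add 9 7 2 ;; .load 9 0 9 ;; .loop 8 9 searchScanBody))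
    (.sub 4 4 2)

/-- Compute a core order by always following an arc of maximum weight. -/
def search : Prog := .const 4 0 ;; .const 5 0 ;; .loop 5 0 searchBody ;; .store 13 1 1

/-- The arcs of `u` before `i` have been scanned since the state `s₀`. -/
structure SearchScanInv (n k cnt u i : ℕ) (off tgt : ℕ → ℕ) (s₀ : State) (L₀ L : ℕ → List ℕ)
    (s : State) : Prop where
  base : Base n off tgt s
  var_four : s.var 4 = k
  var_five : s.var 5 = cnt
  var_eight : s.var 8 = i
  var_nine : s.var 9 = off (u + 1)
  le : off u ≤ i
  le' : i ≤ off (u + 1)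
  frame : ∀ a, a ≠ 9 → a ≠ 10 → s.arr a = s₀.arr a
  buckets : IsBuckets (s.arr 9) (s.arr 10) L
  mem : ∀ b j, j ∈ L b ↔ j ∈ L₀ b ∨ off u ≤ j ∧ j < i ∧ b = min k (s₀.arr 4 (tgt j))
  size : bucketSize n L = bucketSize n L₀ + (i - off u)

theorem SearchScanInv.step {n : ℕ} {G : SimpleGraph (Fin n)} {W M k cnt i : ℕ} {u : Fin n}
    {off tgt : ℕ → ℕ} {s₀ s : State} {L₀ L : ℕ → List ℕ}
    (h : SearchScanInv n k cnt u i off tgt s₀ L₀ L s) (hA : Arcs G off tgt M)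
    (hW : n + M + 1 ≤ W) (hk : k < n)
    (hfresh : ∀ b j, j ∈ L₀ b → off u ≤ j → j < off (u + 1) → False) (hi : i < off (u + 1)) :
    wp W searchScanBody s fun t s' => t ≤ 9 ∧
      ∃ L', SearchScanInv n k cnt u (i + 1) off tgt s₀ L₀ L' s' := by
  have hiM := hA.lt_of_arc u.2 hi
  have hle := h.le
  have h4 := h.frame 4 (by omega) (by omega)
  have hfr : ∀ b, i ∉ L b := fun b hb => by
    rcases (h.mem b i).1 hb with h1 | ⟨-, h1, -⟩
    · exact hfresh b i h1 h.le hi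
    · omega
  have key : ∀ b, b = min k (s₀.arr 4 (tgt i)) → ∀ s' : State, Base n off tgt s' →
      s'.var 4 = k → s'.var 5 = cnt → s'.var 8 = i + 1 → s'.var 9 = off (u + 1) →
      (∀ a, a ≠ 9 → a ≠ 10 → s'.arr a = s.arr a) →
      s'.arr 9 = Function.update (s.arr 9) b (i + 1) →
      s'.arr 10 = Function.update (s.arr 10) i (s.arr 9 b) →
      ∃ L', SearchScanInv n k cnt u (i + 1) off tgt s₀ L₀ L' s' := by
    intro b hb s' hbase h4' h5 h8 h9 hf e9 e10
    refine ⟨Function.update L b (i :: L b), hbase, h4', h5, h8, h9, by omega, hi, ?_, ?_, ?_, ?_⟩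
    · exact fun a h1 h2 => (hf a h1 h2).trans (h.frame a h1 h2)
    · rw [e9, e10]
      exact h.buckets.push _ hfr
    · intro c j
      rw [mem_update_cons, h.mem]
      constructor
      · rintro (⟨rfl, rfl⟩ | h1 | ⟨h1, h2, h3⟩)
        · exact Or.inr ⟨h.le, by omega, hb⟩
        · exact Or.inl h1
        · exact Or.inr ⟨h1, by omega, h3⟩
      · rintro (h1 | ⟨h1, h2, h3⟩)
        · exact Or.inr (Or.inl h1)
        · by_cases e : j = i
          · exact Or.inl ⟨by rw [h3, hb, e], e⟩
          · exact Or.inr (Or.inr ⟨h1, by omega, h3⟩)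
    · have h1 := bucketSize_update (n := n) (b := b) (by omega) L (i :: L b)
      have := h.size
      rw [List.length_cons] at h1
      omega
  unfold searchScanBody
  simp only [wp, State.var_setVar, State.arr_setVar, State.var_setArr,
    Nat.reduceEqDiff, reduceIte, h.base.var_two, h.var_four, h.var_eight, h.base.tgt_eq, h4]
  constructor <;> intro hc
  on_goal 1 => refine ⟨by omega, by omega, by omega, key (s₀.arr 4 (tgt i)) (by omega) _
    ⟨?_, ?_, ?_, ?_, ?_⟩ ?_ ?_ ?_ ?_ ?_ ?_ ?_⟩
  rotate_left 12
  on_goal 1 => refine ⟨by omega, by omega, by omega, key k (by omega) _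
    ⟨?_, ?_, ?_, ?_, ?_⟩ ?_ ?_ ?_ ?_ ?_ ?_ ?_⟩
  any_goals
    try simp only [State.var_setVar, State.arr_setVar, State.var_setArr, State.arr_setArr,
      Nat.reduceEqDiff, reduceIte]
  any_goals first | exact h.base.var_zero | exact h.base.var_one | exact h.base.var_two |
    exact h.base.off_eq | exact h.base.tgt_eq | exact h.var_four | exact h.var_five |
    exact h.var_nine
  all_goals
    intro a h1 h2
    rw [if_neg h1, if_neg h2]

theorem SearchScanInv.loop {n : ℕ} {G : SimpleGraph (Fin n)} {W M k cnt : ℕ} {u : Fin n}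
    {off tgt : ℕ → ℕ} {s₀ : State} {L₀ : ℕ → List ℕ} (hA : Arcs G off tgt M)
    (hW : n + M + 1 ≤ W) (hk : k < n)
    (hfresh : ∀ b j, j ∈ L₀ b → off u ≤ j → j < off (u + 1) → False)
    (h : SearchScanInv n k cnt u (off u) off tgt s₀ L₀ L₀ s₀) :
    wp W (.loop 8 9 searchScanBody) s₀ fun t s => t ≤ 10 * (off (u + 1) - off u) + 1 ∧
      ∃ L, SearchScanInv n k cnt u (off (u + 1)) off tgt s₀ L₀ L s := by
  refine wp_loop (fun τ s => ∃ i L, 10 * (off (u + 1) - i) ≤ τ ∧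
    SearchScanInv n k cnt u i off tgt s₀ L₀ L s) ?_ (τ := 10 * (off (u + 1) - off u))
    ⟨_, L₀, le_rfl, h⟩ ?_
  · rintro τ s ⟨i, L, hτ, hs⟩ hc
    rw [hs.var_eight, hs.var_nine] at hc
    refine wp_mono (hs.step hA hW hk hfresh hc) ?_
    rintro t s' ⟨ht, L', hs'⟩
    exact ⟨τ - 10, by omega, i + 1, L', by omega, hs'⟩
  · rintro t τ s ⟨i, L, hτ, hs⟩ hc ht
    rw [hs.var_eight, hs.var_nine] at hc
    obtain rfl : i = off (u + 1) := le_antisymm hs.le' (by omega)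
    exact ⟨by omega, L, hs⟩

/-- The invariant of the search: `cnt` vertices, flagged in array `11`, have been visited in a core
order, and `k` bounds the weights of the cells in the buckets. -/
structure SearchInv {n : ℕ} (G : SimpleGraph (Fin n)) (M k cnt : ℕ) (off tgt : ℕ → ℕ) (s₀ : State)
    (o : ℕ → Fin n) (L : ℕ → List ℕ) (s : State) : Prop where
  base : Base n off tgt s
  var_four : s.var 4 = k
  var_five : s.var 5 = cnt
  le : cnt ≤ n
  frame : ∀ a, 2 ≤ a → a < 9 ∨ 14 ≤ a → s.arr a = s₀.arr a
  buckets : IsBuckets (s.arr 9) (s.arr 10) L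
  flag : ∀ v, s.arr 11 v = 0 ∨ s.arr 11 v = 1
  ord : ∀ i < cnt, s.arr 12 i = o i
  visited : ∀ v : Fin n, s.arr 11 v = 1 ↔ ∃ i < cnt, o i = v
  order : CoreOrder G o (s.arr 13) cnt
  -- Together with `arc` this makes a cell popped from bucket `k` a crossing arc of maximum weight
  -- whenever its target is unvisited and it is not a vertex cell.
  empty : ∀ b, k < b → L b = []
  tgt_lt : ∀ b j, j ∈ L b → tgt j < n
  source : ∀ b j, j ∈ L b → M ≤ j ∧ b = 0 ∨ ∃ u : Fin n, s.arr 11 u = 1 ∧ off u ≤ j ∧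
    j < off (u + 1) ∧ ∀ w : Fin n, tgt j = w → b = min (coreness G u) (coreness G w)
  arc : ∀ u : Fin n, s.arr 11 u = 1 → ∀ j, off u ≤ j → j < off (u + 1) →
    ∀ w : Fin n, tgt j = w → s.arr 11 w = 0 → j ∈ L (min (coreness G u) (coreness G w))
  vertex : ∀ v : Fin n, s.arr 11 v = 0 → M + v ∈ L 0

section

variable {n : ℕ} {G : SimpleGraph (Fin n)} {W M k cnt : ℕ} {off tgt : ℕ → ℕ} {s₀ s : State}
  {o : ℕ → Fin n} {L : ℕ → List ℕ}

theorem SearchInv.exists_unvisited (h : SearchInv G M k cnt off tgt s₀ o L s) (hc : cnt < n) :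
    ∃ v : Fin n, s.arr 11 v = 0 := by
  by_contra! hcon
  have hs : Function.Surjective (fun i : Fin cnt => o i) := fun v => by
    obtain ⟨i, hi, e⟩ := (h.visited v).1 ((h.flag v).resolve_left (hcon v))
    exact ⟨⟨i, hi⟩, e⟩
  have := Nat.card_le_card_of_surjective _ hs
  simp only [Nat.card_fin] at this
  omega

theorem SearchInv.next_level (h : SearchInv G M k cnt off tgt s₀ o L s) (hL : L k = [])
    (hc : cnt < n) {s' : State} (hb : Base n off tgt s') (h4 : s'.var 4 = k - 1)
    (h5 : s'.var 5 = cnt) (hs : s'.arr = s.arr) :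
    1 ≤ k ∧ SearchInv G M (k - 1) cnt off tgt s₀ o L s' := by
  -- The vertex cells in bucket `0` keep it nonempty while a vertex is unvisited, so the level never
  -- drops below `0`.
  have hk : 1 ≤ k := by
    obtain ⟨v, hv⟩ := h.exists_unvisited hc
    by_contra! hcon
    obtain rfl : k = 0 := by omega
    have := h.vertex v hv
    rw [hL] at this
    exact List.not_mem_nil this
  refine ⟨hk, hb, h4, h5, h.le, ?_, ?_, ?_, ?_, ?_, ?_, ?_, h.tgt_lt, ?_, ?_, ?_⟩ <;>
    try rw [hs]
  · exact h.frame
  · exact h.buckets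
  · exact h.flag
  · exact h.ord
  · exact h.visited
  · exact h.order
  · intro b hb
    by_cases e : b = k
    · exact e ▸ hL
    · exact h.empty b (by omega)
  · exact h.source
  · exact h.arc
  · exact h.vertex

theorem SearchInv.discard (h : SearchInv G M k cnt off tgt s₀ o L s)
    {j : ℕ} {l : List ℕ} (hL : L k = j :: l) (hu : 0 < s.arr 11 (tgt j)) {s' : State}
    (hA : Arcs G off tgt M)
    (hb : Base n off tgt s') (h4 : s'.var 4 = k) (h5 : s'.var 5 = cnt)
    (hs : ∀ a, a ≠ 9 → s'.arr a = s.arr a)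
    (hB : IsBuckets (s'.arr 9) (s'.arr 10) (Function.update L k l)) :
    SearchInv G M k cnt off tgt s₀ o (Function.update L k l) s' := by
  have hsub : ∀ {b i}, i ∈ Function.update L k l b → i ∈ L b := fun hi => mem_of_mem_pop hL hi
  have e11 := hs 11 (by omega)
  have e12 := hs 12 (by omega)
  have e13 := hs 13 (by omega)
  refine ⟨hb, h4, h5, h.le, fun a h2 ha => (hs a (by omega)).trans (h.frame a h2 ha), hB, ?_, ?_,
    ?_, ?_, ?_, ?_, ?_, ?_, ?_⟩ <;> try simp only [e11, e12, e13]
  · exact h.flag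
  · exact h.ord
  · exact h.visited
  · exact h.order
  · intro b hb
    rw [Function.update_of_ne (by omega)]
    exact h.empty b hb
  · exact fun b i hi => h.tgt_lt b i (hsub hi)
  · exact fun b i hi => h.source b i (hsub hi)
  · intro u hu' i h1 h2 w hw h0
    refine mem_pop hL (h.arc u hu' i h1 h2 w hw h0) ?_
    rintro rfl
    rw [hw] at hu
    omega
  · intro v hv
    refine mem_pop hL (h.vertex v hv) ?_
    rintro rfl
    rw [hA.tgt_vertex v v.2] at hu
    omega

/-- The coreness of a newly visited vertex is at least the current weight. -/
theorem SearchInv.le_coreness (h : SearchInv G M k cnt off tgt s₀ o L s) {j : ℕ} {u : Fin n}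
    (hj : j ∈ L k) (hju : tgt j = u) : k ≤ coreness G u := by
  rcases h.source k j hj with ⟨-, rfl⟩ | ⟨v, -, -, -, h1⟩
  · exact Nat.zero_le _
  · exact (h1 u hju).trans_le (min_le_right _ _)

/-- A crossing edge heavier than `k` would have its arc in a bucket above `k`, and these are empty.
The popped cell is a vertex cell of weight `0`, which starts afresh, or an arc of weight `k` from a
visited vertex. -/
theorem SearchInv.order_extend (h : SearchInv G M k cnt off tgt s₀ o L s) (hA : Arcs G off tgt M)
    {j : ℕ} {u : Fin n} (hj : j ∈ L k) (hju : tgt j = u) (hu : s.arr 11 u = 0) :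
    CoreOrder G (Function.update o cnt u) (Function.update (s.arr 13) cnt k) (cnt + 1) := by
  have ho : ∀ i < cnt, Function.update o cnt u i = o i :=
    fun i hi => Function.update_of_ne (by omega) _ _
  have hunv : ∀ i < cnt, o i ≠ u := fun i hi e => by
    have := (h.visited u).2 ⟨i, hi, e⟩
    omega
  refine (h.order.congr ho fun i hi => Function.update_of_ne (by omega) _ _).extend ?_ ?_ ?_
  · intro i hi
    rw [ho i hi, Function.update_self]
    exact hunv i hi
  · intro i hi y hy ha
    rw [ho i hi] at ha ⊢
    rw [Function.update_self]
    by_contra! hcon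
    obtain ⟨p, h1, h2, h3⟩ := (hA.adj_iff (o i) y).1 ha
    have hy0 : s.arr 11 y = 0 := by
      refine (h.flag y).resolve_right fun h1 => ?_
      obtain ⟨i', hi', e⟩ := (h.visited y).1 h1
      exact hy i' hi' ((ho i' hi').trans e)
    have := h.arc (o i) ((h.visited _).2 ⟨i, hi, rfl⟩) p h1 h2 y h3 hy0
    rw [h.empty _ hcon] at this
    exact List.not_mem_nil this
  · simp only [Function.update_self]
    rcases h.source k j hj with ⟨-, rfl⟩ | ⟨v, hv, h1, h2, h3⟩
    · exact Or.inl rfl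
    · right
      obtain ⟨i, hi, e⟩ := (h.visited v).1 hv
      refine ⟨i, hi, ?_⟩
      rw [ho i hi, e]
      obtain ⟨w, hw, ha⟩ := hA.tgt_adj v h1 h2
      obtain rfl : w = u := Fin.ext (hw.symm.trans hju)
      have := h3 w hw
      exact SameCore.of_adj ha (this.trans_le (min_le_left _ _)) (this.trans_le (min_le_right _ _))

/-- Popping an arc and visiting its target `u`. -/
theorem SearchInv.visit (h : SearchInv G M k cnt off tgt s₀ o L s) (hA : Arcs G off tgt M)
    (hcore : ∀ v : Fin n, s.arr 4 v = coreness G v) (hcnt : cnt < n)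
    {u : Fin n} {j : ℕ} {l : List ℕ} (hL : L k = j :: l) (hju : tgt j = u) (hu : s.arr 11 u = 0)
    {L' L'' : ℕ → List ℕ} (hL' : L' = Function.update L k l) {s₁ s₂ : State}
    (hs11 : s₁.arr 11 = Function.update (s.arr 11) u 1)
    (hs12 : s₁.arr 12 = Function.update (s.arr 12) cnt u)
    (hs13 : s₁.arr 13 = Function.update (s.arr 13) cnt k)
    (hs9 : ∀ a, a < 9 ∨ 14 ≤ a → s₁.arr a = s.arr a)
    (hs : SearchScanInv n (coreness G u) (cnt + 1) u (off (u + 1)) off tgt s₁ L' L'' s₂) :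
    SearchInv G M (coreness G u) (cnt + 1) off tgt s₀ (Function.update o cnt u) L'' s₂ := by
  have hjL : j ∈ L k := hL ▸ List.mem_cons_self
  -- Resetting the level to the coreness of `u` never lowers it and dominates the weights of all
  -- arcs of `u`, so the buckets above it stay empty.
  have hku := h.le_coreness hjL hju
  have f11 : s₂.arr 11 = Function.update (s.arr 11) u 1 :=
    (hs.frame 11 (by omega) (by omega)).trans hs11
  have f12 : s₂.arr 12 = Function.update (s.arr 12) cnt u :=
    (hs.frame 12 (by omega) (by omega)).trans hs12
  have f13 : s₂.arr 13 = Function.update (s.arr 13) cnt k :=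
    (hs.frame 13 (by omega) (by omega)).trans hs13
  have fu : s₂.arr 11 u = 1 := by rw [f11, Function.update_self]
  have fne : ∀ {w : Fin n}, w ≠ u → s₂.arr 11 w = s.arr 11 w := fun hw => by
    rw [f11, Function.update_of_ne (fun e => hw (Fin.ext e))]
  have f0 : ∀ {w : Fin n}, s₂.arr 11 w = 0 → s.arr 11 w = 0 ∧ w ≠ u := fun {w} hw => by
    by_cases e : w = u
    · rw [e, fu] at hw
      omega
    · exact ⟨by rw [← fne e, hw], e⟩
  have hsub : ∀ {b i}, i ∈ L' b → i ∈ L b := fun hi => by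
    rw [hL'] at hi
    exact mem_of_mem_pop hL hi
  have hmem := hs.mem
  rw [hs9 4 (by omega)] at hmem
  have ho : ∀ i < cnt, Function.update o cnt u i = o i :=
    fun i hi => Function.update_of_ne (by omega) _ _
  have hou : Function.update o cnt u cnt = u := Function.update_self _ _ _
  refine ⟨hs.base, hs.var_four, hs.var_five, hcnt, ?_, hs.buckets, ?_, ?_, ?_, ?_, ?_, ?_, ?_, ?_,
    ?_⟩
  · intro a h2 ha
    rw [hs.frame a (by omega) (by omega), hs9 a ha, h.frame a h2 ha]
  · intro v
    rw [f11]
    by_cases e : v = u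
    · rw [e, Function.update_self]
      exact Or.inr rfl
    · rw [Function.update_of_ne e]
      exact h.flag v
  · intro i hi
    rw [f12]
    rcases Nat.lt_succ_iff_lt_or_eq.1 hi with hi | rfl
    · rw [Function.update_of_ne (by omega), ho i hi, h.ord i hi]
    · rw [Function.update_self, hou]
  · intro v
    by_cases e : v = u
    · rw [e]
      exact iff_of_true fu ⟨cnt, by omega, hou⟩
    · rw [fne e, h.visited]
      constructor
      · rintro ⟨i, hi, e'⟩
        exact ⟨i, by omega, (ho i hi).trans e'⟩
      · rintro ⟨i, hi, e'⟩
        rcases Nat.lt_succ_iff_lt_or_eq.1 hi with hi | rfl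
        · exact ⟨i, hi, (ho i hi).symm.trans e'⟩
        · exact absurd (e'.symm.trans hou) e
  · rw [f13]
    exact h.order_extend hA hjL hju hu
  · intro b hb
    refine List.eq_nil_iff_forall_not_mem.2 fun i hi => ?_
    rcases (hmem b i).1 hi with hi | ⟨-, -, e⟩
    · have := hsub hi
      rw [h.empty b (by omega)] at this
      exact List.not_mem_nil this
    · omega
  · intro b i hi
    rcases (hmem b i).1 hi with hi | ⟨-, h2, -⟩
    · exact h.tgt_lt b i (hsub hi)
    · exact hA.tgt_lt i (hA.lt_of_arc u.2 h2)
  · intro b i hi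
    rcases (hmem b i).1 hi with hi | ⟨h1, h2, e⟩
    · refine (h.source b i (hsub hi)).imp id ?_
      rintro ⟨v, hv, e⟩
      refine ⟨v, ?_, e⟩
      by_cases hvu : v = u
      · rw [hvu, fu]
      · rw [fne hvu, hv]
    · refine Or.inr ⟨u, fu, h1, h2, fun w hw => ?_⟩
      rw [e, hw, hcore]
  · intro v hv i h1 h2 w hw hw0
    rw [hmem]
    by_cases hvu : v = u
    · subst hvu
      exact Or.inr ⟨h1, h2, by rw [hw, hcore]⟩
    · left
      rw [hL']
      refine mem_pop hL (h.arc v (by rw [← fne hvu, hv]) i h1 h2 w hw (f0 hw0).1) ?_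
      rintro rfl
      exact (f0 hw0).2 (Fin.ext (hw.symm.trans hju))
  · intro v hv
    rw [hmem]
    left
    rw [hL']
    refine mem_pop hL (h.vertex v (f0 hv).1) ?_
    rintro rfl
    rw [hA.tgt_vertex v v.2] at hju
    exact (f0 hv).2 (Fin.ext hju)

end


/-! ### Time bound and correctness of the search -/

section

variable {n : ℕ} {G : SimpleGraph (Fin n)} {W M k cnt : ℕ} {off tgt : ℕ → ℕ} {s₀ s : State}
  {o : ℕ → Fin n} {L : ℕ → List ℕ}

theorem coreness_lt (G : SimpleGraph (Fin n)) (v : Fin n) : coreness G v < n := by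
  have h2 := coreness_le_ncard G v
  have h3 := ncard_adj_lt (G := G) v Set.univ
  simp only [Set.mem_univ, true_and] at h3
  exact h2.trans_lt h3

/-- Unlike in the peeling, the level may rise: visiting `u` lifts it by at most the coreness of `u`,
hence by at most its degree. The 25 released per arc cover the scan (10), the new cell (10) and this
rise (4). -/
theorem SearchInv.step (h : SearchInv G M k cnt off tgt s₀ o L s) (hA : Arcs G off tgt M)
    (hW : n + M + 1 ≤ W) (hcore : ∀ v : Fin n, s₀.arr 4 v = coreness G v) (hc : cnt < n)
    (hk : k < n) :
    wp W searchBody s fun t s' => ∃ k' cnt' o' L', k' < n ∧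
      SearchInv G M k' cnt' off tgt s₀ o' L' s' ∧
      searchPotential n k' off (s'.arr 11) L' + t + 1 ≤ searchPotential n k off (s.arr 11) L := by
  unfold searchBody searchPotential
  have h4 := h.frame 4 (by omega) (by omega)
  simp only [wp_seq, wp_ite, wp_load, wp_add, wp_sub, wp_store, wp_skip, State.var_setVar,
    State.arr_setVar, State.var_setArr, State.arr_setArr, Nat.reduceEqDiff, reduceIte,
    h.base.var_one, h.base.var_two, h.var_four, h.var_five, h.base.tgt_eq, h.base.off_eq]
  constructor
  swap
  · intro h0
    obtain ⟨h1, h2⟩ := h.next_level (h.buckets.eq_nil (by omega)) hc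
      (s' := (s.setVar 6 (s.arr 9 k)).setVar 4 (k - 1))
      ⟨h.base.var_zero, h.base.var_one, h.base.var_two, h.base.off_eq, h.base.tgt_eq⟩
      rfl h.var_five rfl
    exact ⟨k - 1, cnt, o, L, by omega, h2, by omega⟩
  intro h0
  obtain ⟨l, hL, hB⟩ := h.buckets.pop h0
  have hsz := bucketSize_update hk L l
  rw [hL, List.length_cons] at hsz
  have hjL : s.arr 9 k - 1 ∈ L k := hL ▸ List.mem_cons_self
  have hjn := h.tgt_lt _ _ hjL
  constructor
  · intro hf
    refine ⟨k, cnt, o, Function.update L k l, hk, h.discard hL hf hA ?_ ?_ ?_ ?_ ?_, by omega⟩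
    · exact ⟨h.base.var_zero, h.base.var_one, h.base.var_two, h.base.off_eq, h.base.tgt_eq⟩
    · exact h.var_four
    · exact h.var_five
    · intro a ha
      simp [ha]
    · simpa using hB
  · intro hf
    obtain ⟨u, hu⟩ : ∃ u : Fin n, tgt (s.arr 9 k - 1) = u := ⟨⟨_, hjn⟩, rfl⟩
    rw [hu] at hf ⊢
    have hf0 : s.arr 11 u = 0 := by omega
    have hbud := budget_update u.2 (fun v => 25 * (off (v + 1) - off v) + 20) _ hf0
    have hmono := hA.off_mono (Nat.le_add_right u 1) u.2
    have hM := hA.off_mono u.2 le_rfl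
    have hcu : s.arr 4 u = coreness G u := by rw [h4, hcore]
    have hclt := coreness_lt G u
    have hcle := coreness_le_ncard G u
    have hoff := hA.off_succ u
    have hun := u.2
    refine ⟨by omega, by omega, ?_⟩
    rw [hcu]
    refine wp_mono (SearchScanInv.loop (k := coreness G u) (cnt := cnt + 1) (u := u)
      (L₀ := Function.update L k l) hA hW hclt ?_ ?_) ?_
    · intro b j hj h1 h2
      rcases h.source b j (mem_of_mem_pop hL hj) with ⟨h3, -⟩ | ⟨v, h3, h4, h5, -⟩
      · have := hA.lt_of_arc u.2 h2
        omega
      · rw [← hA.source_unique u.2 v.2 h1 h2 h4 h5] at h3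
        omega
    · refine ⟨⟨?_, ?_, ?_, ?_, ?_⟩, ?_, ?_, ?_, ?_, ?_, ?_, ?_, ?_, ?_, ?_⟩ <;>
        try simp only [State.var_setVar, State.arr_setVar, State.var_setArr, State.arr_setArr,
          Nat.reduceEqDiff, reduceIte]
      · exact h.base.var_zero
      · exact h.base.var_one
      · exact h.base.var_two
      · exact h.base.off_eq
      · exact h.base.tgt_eq
      · exact le_rfl
      · exact hmono
      · exact fun _ _ _ => trivial
      · exact hB
      · intro b j
        refine ⟨Or.inl, ?_⟩
        rintro (h1 | ⟨h1, h2, -⟩)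
        · exact h1
        · omega
      · omega
    · rintro t s' ⟨ht, L', hs⟩
      refine ⟨coreness G u, cnt + 1, Function.update o cnt u, L', hclt,
        h.visit hA (fun v => by rw [h4, hcore]) hc hL hu hf0 rfl ?_ ?_ ?_ ?_ hs, ?_⟩
      any_goals simp only [State.arr_setVar, State.arr_setArr, Nat.reduceEqDiff, reduceIte]
      · intro a ha
        rw [if_neg (by omega), if_neg (by omega), if_neg (by omega), if_neg (by omega)]
      · rw [hs.frame 11 (by omega) (by omega)]
        have hsz' := hs.size
        simp only [State.arr_setVar, State.arr_setArr, Nat.reduceEqDiff, reduceIte]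
        omega

end

/-- The machine state after the search: the coreness values and a core order are known. -/
structure Searched {n : ℕ} (G : SimpleGraph (Fin n)) (o : ℕ → Fin n) (s : State) : Prop where
  var_zero : s.var 0 = n
  var_one : s.var 1 = 0
  var_two : s.var 2 = 1
  core_min : ∀ v : Fin n, s.arr 3 v = coreness G v
  core_max : ∀ v : Fin n, s.arr 4 v = coreness G v
  ord : ∀ i < n, s.arr 12 i = o i
  order : CoreOrder G o (s.arr 13) n
  gap_zero : s.arr 13 0 = 0
  zero : ∀ a, 14 ≤ a → ∀ i, s.arr a i = 0

theorem search_spec {n : ℕ} {G : SimpleGraph (Fin n)} {W M : ℕ} {off adj : ℕ → ℕ}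
    {LA LB : ℕ → List ℕ} {s₀ s : State} (hs₀ : PrepareInv n M n off adj LA LB s₀)
    (hA : Arcs G off (extendedTarget n M adj) M) (hW : n + M + 1 ≤ W) (hn : 0 < n)
    (hb : Base n off (extendedTarget n M adj) s) (h3 : ∀ v : Fin n, s.arr 3 v = coreness G v)
    (h4 : ∀ v : Fin n, s.arr 4 v = coreness G v) (h9 : ∀ a, 9 ≤ a → s.arr a = s₀.arr a) :
    wp W search s fun t s' => t ≤ 34 * n + 25 * M + 10 ∧ ∃ o, Searched G o s' := by
  unfold search
  simp only [wp_seq, wp_const]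
  refine ⟨by omega, by omega, ?_⟩
  set tgt := extendedTarget n M adj with htgt
  have hbud := hA.budget_search
  have h11 : s.arr 11 = fun _ => 0 := funext fun i => by
    rw [h9 11 (by omega)]
    exact hs₀.zero 11 (by omega) (by omega) (by omega) (by omega) (by omega) (by omega) i
  refine wp_loop (fun τ s' => ∃ k cnt o L, k < n ∧ SearchInv G M k cnt off tgt s o L s' ∧
    searchPotential n k off (s'.arr 11) L ≤ τ) ?_ (τ := 34 * n + 25 * M)
    ⟨0, 0, fun _ => ⟨0, hn⟩, LB, hn, ?_, ?_⟩ ?_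
  · rintro τ s' ⟨k, cnt, o, L, hk, h, hτ⟩ hc
    rw [h.base.var_zero, h.var_five] at hc
    refine wp_mono (h.step hA hW h4 hc hk) ?_
    rintro t s'' ⟨k', cnt', o', L', hk', h', ht⟩
    exact ⟨searchPotential n k' off (s''.arr 11) L', by omega, k', cnt', o', L', hk', h', le_rfl⟩
  · refine ⟨⟨?_, ?_, ?_, ?_, ?_⟩, ?_, ?_, ?_, ?_, ?_, ?_, ?_, ?_, ?_, ?_, ?_, ?_, ?_, ?_⟩ <;>
      try simp only [State.var_setVar, State.arr_setVar, Nat.reduceEqDiff, reduceIte, h11]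
    · exact hb.var_zero
    · exact hb.var_one
    · exact hb.var_two
    · exact hb.off_eq
    · exact hb.tgt_eq
    · omega
    · exact fun _ _ _ => trivial
    · rw [h9 9 le_rfl, h9 10 (by omega)]
      exact hs₀.bucketsB
    · exact fun _ => Or.inl trivial
    · intro i hi
      omega
    · simp
    · exact CoreOrder.nil _ _
    · intro b hb
      refine List.eq_nil_iff_forall_not_mem.2 fun j hj => ?_
      have := ((hs₀.memB b j).1 hj).1
      omega
    · intro b j hj
      obtain ⟨-, w, hw, rfl⟩ := (hs₀.memB b j).1 hj
      rwa [hA.tgt_vertex w hw]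
    · intro b j hj
      obtain ⟨hb, w, hw, rfl⟩ := (hs₀.memB b j).1 hj
      exact Or.inl ⟨by omega, hb⟩
    · intro u h
      simp at h
    · exact fun v _ => (hs₀.memB _ _).2 ⟨rfl, v, v.2, rfl⟩
  · simp only [searchPotential, State.arr_setVar, h11, hbud, hs₀.sizeB]
    omega
  · rintro t τ s' ⟨k, cnt, o, L, hk, h, -⟩ hc ht
    rw [h.base.var_zero, h.var_five] at hc
    obtain rfl : cnt = n := le_antisymm h.le (by omega)
    simp only [wp_store]
    refine ⟨by omega, o, ?_⟩
    constructor <;> simp only [State.var_setArr, State.arr_setArr, Nat.reduceEqDiff, reduceIte,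
      h.base.var_one]
    · exact h.base.var_zero
    · exact h.base.var_two
    · intro v
      rw [h.frame 3 (by omega) (by omega)]
      exact h3 v
    · intro v
      rw [h.frame 4 (by omega) (by omega)]
      exact h4 v
    · exact h.ord
    -- The final store fixes the weight at position `0`, which a core order ignores but
    -- `CoreOrder.leaf_gap` needs to be `0`.
    · exact h.order.congr_weight fun l hl => Function.update_of_ne (by omega) _ _
    · exact Function.update_self _ _ _
    · intro a ha i
      rw [if_neg (by omega), h.frame a (by omega) (by omega)]
      rw [h9 a (by omega)]
      exact hs₀.zero a (by omega) (by omega) (by omega) (by omega) (by omega) (by omega) i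


/-! ## Building the tree -/

/-- One step of the walk from the node `8` towards the root; `10` is its level. -/
def walkBody : Prog := .copy 9 8 ;; .load 8 15 8 ;; .load 10 14 8

/-- Insert the gap at position `4`; `5` is the node of the previous gap and `6` the number of
nodes. -/
def buildBody : Prog :=
  .load 7 13 4 ;; .add 7 7 2 ;; .copy 8 5 ;; .copy 9 1 ;; .load 10 14 8 ;; .loop 7 10 walkBody ;;
  .ite 10 7
    (.store 14 6 7 ;; .store 15 6 8 ;; .store 15 9 6 ;; .copy 5 6 ;; .add 6 6 2)
    (.copy 5 8) ;;
  .store 16 4 5 ;; .add 4 4 2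

/-- Compute the tree of the gaps of the core order. -/
def build : Prog := .copy 6 0 ;; .copy 4 2 ;; .copy 5 1 ;; .loop 4 0 buildBody

section Build

variable {n : ℕ} {G : SimpleGraph (Fin n)} {W M : ℕ} {off tgt : ℕ → ℕ} {o : ℕ → Fin n}
  {g : ℕ → ℕ} {N i k : ℕ} {s₀ s : State}

/-- Levels are integers that strictly drop towards the root, so a walk from the node of position `i`
makes at most `g i` rounds, of four steps each. -/
theorem walk_spec (hT : GapTree g n N i (s.arr 14) (s.arr 15) (s.arr 16)) (hg : g 0 = 0)
    (h7 : s.var 7 = k) (h8 : s.var 8 = s.arr 16 i) (h9 : s.var 9 = 0)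
    (h10 : s.var 10 = s.arr 14 (s.arr 16 i)) :
    wp W (.loop 7 10 walkBody) s fun t s' => t ≤ 4 * g i + 1 ∧ s'.arr = s.arr ∧
      (∀ y, y < 8 → s'.var y = s.var y) ∧ s'.var 10 = s.arr 14 (s'.var 8) ∧ s'.var 10 ≤ k ∧
      GapTree.Walk g (s.arr 15) (s.arr 16) i k (s'.var 9) (s'.var 8) := by
  refine wp_loop (fun τ s' => 4 * s'.var 10 ≤ τ ∧ s'.arr = s.arr ∧
    (∀ y, y < 8 → s'.var y = s.var y) ∧ s'.var 10 = s.arr 14 (s'.var 8) ∧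
    GapTree.Walk g (s.arr 15) (s.arr 16) i k (s'.var 9) (s'.var 8)) ?_ (τ := 4 * g i)
    ⟨?_, rfl, fun _ _ => rfl, ?_, ?_⟩ ?_
  · rintro τ s' ⟨hτ, ha, hv, hl, hw⟩ hc
    rw [hv 7 (by omega), h7, hl] at hc
    obtain ⟨hw', hlt⟩ := GapTree.walk_step hT hw hg hc
    unfold walkBody
    simp only [wp, State.var_setVar, State.arr_setVar, Nat.reduceEqDiff, reduceIte, ha]
    refine ⟨τ - 4, by omega, by omega, trivial, ?_, trivial, hw'⟩
    intro y hy
    rw [if_neg (by omega), if_neg (by omega), if_neg (by omega)]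
    exact hv y hy
  · rw [h10, hT.lvl_nd i le_rfl]
  · rw [h10, h8]
  · rw [h8, h9]
    exact GapTree.walk_start _ _
  · rintro t τ s' ⟨hτ, ha, hv, hl, hw⟩ hc ht
    rw [hv 7 (by omega), h7] at hc
    exact ⟨by omega, ha, hv, hl, by omega, hw⟩

/-- The gaps up to position `i` have been inserted into the tree, with the nodes below `N`. -/
structure BuildInv (n i N : ℕ) (q : ℕ → ℕ) (s₀ s : State) : Prop where
  var_zero : s.var 0 = n
  var_one : s.var 1 = 0
  var_two : s.var 2 = 1
  var_four : s.var 4 = i + 1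
  var_five : s.var 5 = s.arr 16 i
  var_six : s.var 6 = N
  lt : i < n
  le : n ≤ N
  le' : N ≤ n + i
  frame : ∀ a, a < 14 → s.arr a = s₀.arr a
  tree : GapTree (gapLevel q) n N i (s.arr 14) (s.arr 15) (s.arr 16)

theorem BuildInv.step {q : ℕ → ℕ} (h : BuildInv n i N q s₀ s) (hq : s₀.arr 13 = q)
    (hqn : q (i + 1) < n) (hW : 2 * n + 1 ≤ W) (hi : i + 1 < n) :
    wp W buildBody s fun t s' => t ≤ 4 * gapLevel q i + 15 ∧
      ∃ N', BuildInv n (i + 1) N' q s₀ s' := by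
  have hg0 : gapLevel q 0 = 0 := rfl
  have hg1 : ∀ l, 1 ≤ l → 1 ≤ gapLevel q l := fun l hl => by
    rw [gapLevel_pos hl]
    omega
  have hgi : gapLevel q (i + 1) = q (i + 1) + 1 := gapLevel_pos (by omega)
  have hle' := h.le'
  unfold buildBody
  simp only [wp_seq, wp_load, wp_add, wp_copy, State.var_setVar, State.arr_setVar,
    Nat.reduceEqDiff, reduceIte, h.var_four, h.var_five, h.var_two, h.var_one,
    h.frame 13 (by omega), hq]
  refine ⟨by omega, ?_⟩
  refine wp_mono (walk_spec (k := gapLevel q (i + 1)) h.tree hg0 ?_ ?_ ?_ ?_) ?_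
  · simp only [State.var_setVar, Nat.reduceEqDiff, reduceIte, hgi]
  · simp only [State.var_setVar, State.arr_setVar, Nat.reduceEqDiff, reduceIte]
  · simp only [State.var_setVar, Nat.reduceEqDiff, reduceIte]
  · simp only [State.var_setVar, State.arr_setVar, Nat.reduceEqDiff, reduceIte]
  rintro t s' ⟨ht, ha, hv, hl, hle, hw⟩
  simp only [State.arr_setVar] at ha hl hw
  have v0 : s'.var 0 = n := (hv 0 (by omega)).trans h.var_zero
  have v1 : s'.var 1 = 0 := (hv 1 (by omega)).trans h.var_one
  have v2 : s'.var 2 = 1 := (hv 2 (by omega)).trans h.var_two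
  have v4 : s'.var 4 = i + 1 := (hv 4 (by omega)).trans h.var_four
  have v6 : s'.var 6 = N := (hv 6 (by omega)).trans h.var_six
  have v7 : s'.var 7 = gapLevel q (i + 1) := by
    rw [hv 7 (by omega), hgi]
    rfl
  simp only [wp_ite, wp_seq, wp_store, wp_copy, wp_add, State.var_setVar, State.var_setArr,
    Nat.reduceEqDiff, reduceIte, v2, v4, v6, v7]
  constructor
  · intro hc
    refine ⟨by omega, by omega, by omega, N + 1, ?_⟩
    constructor <;> try simp only [State.var_setVar, State.arr_setVar, State.var_setArr,
      State.arr_setArr, Nat.reduceEqDiff, reduceIte, ha]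
    · exact v0
    · exact v1
    · exact v2
    · rw [Function.update_self]
    · omega
    · have := h.le
      omega
    · omega
    · intro a ha'
      rw [if_neg (by omega), if_neg (by omega), if_neg (by omega), if_neg (by omega)]
      exact h.frame a ha'
    · exact h.tree.extend_new (by omega) h.le hw (by omega)
  · intro hc
    refine ⟨by omega, by omega, N, ?_⟩
    constructor <;> try simp only [State.var_setVar, State.arr_setVar, State.var_setArr,
      State.arr_setArr, Nat.reduceEqDiff, reduceIte, ha]
    · exact v0
    · exact v1
    · exact v2
    · rw [Function.update_self]
    · exact v6
    · omega
    · exact h.le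
    · omega
    · intro a ha'
      rw [if_neg (by omega)]
      exact h.frame a ha'
    · exact h.tree.extend_old hg1 hg0 hw (by omega)

/-- Coreness is at most the degree, and the degrees sum to the number of arcs. This bounds the total
length of the walks. -/
theorem sum_coreness_le (hA : Arcs G off tgt M) (h : CoreOrder G o (s.arr 13) n) :
    ∑ j ∈ Finset.range n, coreness G (o j) ≤ M := by
  have hb : Function.Bijective (fun i : Fin n => o i) := by
    have hi : Function.Injective (fun i : Fin n => o i) :=
      fun i j e => Fin.ext (h.inj i j i.2 j.2 e)
    exact ⟨hi, Finite.injective_iff_surjective.1 hi⟩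
  rw [← Fin.sum_univ_eq_sum_range (fun j => coreness G (o j)),
    hb.sum_comp (fun v => coreness G v), ← hA.budget_eq]
  unfold budget
  simp only [if_true]
  rw [← Fin.sum_univ_eq_sum_range (fun v => off (v + 1) - off v)]
  refine Finset.sum_le_sum fun v _ => ?_
  rw [hA.off_succ v, Nat.add_sub_cancel_left]
  exact coreness_le_ncard G v

theorem build_spec (hs : Searched G o s) (hA : Arcs G off tgt M) (hn : 0 < n)
    (hW : 2 * n + 1 ≤ W) :
    wp W build s fun t s' => t ≤ 20 * n + 4 * M + 10 ∧
      ∃ N, BuildInv n (n - 1) N (s.arr 13) s s' := by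
  set q := s.arr 13 with hq
  have hqn : ∀ l, 1 ≤ l → l < n → q l < n := fun l h1 hl =>
    (hs.order.le_coreness h1 hl).trans_lt (coreness_lt G _)
  have htot : ∑ j ∈ Finset.Ico 1 n, (4 * q j + 20) ≤ 4 * M + 20 * n := by
    have h1 : ∑ j ∈ Finset.Ico 1 n, (4 * q j + 20)
        ≤ ∑ j ∈ Finset.Ico 1 n, (4 * coreness G (o j) + 20) := by
      refine Finset.sum_le_sum fun j hj => ?_
      rw [Finset.mem_Ico] at hj
      have := hs.order.le_coreness hj.1 hj.2
      change 4 * s.arr 13 j + 20 ≤ _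
      omega
    have h2 : ∑ j ∈ Finset.Ico 1 n, (4 * coreness G (o j) + 20)
        ≤ ∑ j ∈ Finset.range n, (4 * coreness G (o j) + 20) :=
      Finset.sum_le_sum_of_subset fun j hj => by
        rw [Finset.mem_Ico] at hj
        exact Finset.mem_range.2 hj.2
    have h3 := sum_coreness_le hA hs.order
    have h4 : ∑ j ∈ Finset.range n, (4 * coreness G (o j) + 20)
        = 4 * ∑ j ∈ Finset.range n, coreness G (o j) + n * 20 := by
      rw [Finset.sum_add_distrib, ← Finset.mul_sum, Finset.sum_const, Finset.card_range,
        smul_eq_mul]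
    omega
  unfold build
  simp only [wp_seq, wp_copy]
  -- Position `j` is charged `4 (q j + 1)` for the walk that later starts at its node, and 16 for
  -- the rest of its own round.
  refine wp_loop (fun τ s' => ∃ i N, BuildInv n i N q s s' ∧
    4 * gapLevel q i + ∑ j ∈ Finset.Ico (i + 1) n, (4 * q j + 20) ≤ τ) ?_
    (τ := 4 * M + 20 * n) ⟨0, n, ?_, ?_⟩ ?_
  · rintro τ s' ⟨i, N, h, hτ⟩ hc
    rw [h.var_four, h.var_zero] at hc
    refine wp_mono (h.step hq.symm (hqn _ (by omega) hc) hW hc) ?_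
    rintro t s'' ⟨ht, N', h'⟩
    rw [Finset.sum_eq_sum_Ico_succ_bot hc] at hτ
    refine ⟨4 * gapLevel q (i + 1) + ∑ j ∈ Finset.Ico (i + 1 + 1) n, (4 * q j + 20), ?_, i + 1,
      N', h', le_rfl⟩
    rw [gapLevel_pos (show 1 ≤ i + 1 by omega)]
    omega
  · have hz := hs.zero
    constructor <;> try simp only [State.var_setVar, State.arr_setVar, Nat.reduceEqDiff, reduceIte,
      hs.var_zero, hs.var_one, hs.var_two, hz 16 (by omega)]
    · omega
    · omega
    · exact le_rfl
    · exact fun _ _ => trivial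
    · exact GapTree.nil (hz 16 (by omega) 0) (hz 14 (by omega) 0) rfl
  · change 4 * 0 + _ ≤ _
    rw [Nat.zero_add]
    exact htot
  · rintro t τ s' ⟨i, N, h, -⟩ hc ht
    rw [h.var_four, h.var_zero] at hc
    have := h.lt
    obtain rfl : i = n - 1 := by omega
    exact ⟨by omega, N, h⟩

end Build


/-! ## Writing the output -/

/-- Set the parent of the vertex at position `4`. -/
def leafBody : Prog :=
  .load 5 12 4 ;; .load 7 13 4 ;; .load 9 4 5 ;; .add 8 4 2 ;;
  .ite 7 9 (.load 8 16 8) (.load 8 16 4) ;; .store 2 5 8 ;; .add 4 4 2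

/-- Set the parents of all vertices. -/
def linkLeaves : Prog := .copy 4 1 ;; .loop 4 0 leafBody

/-- Set the parent and the labels of the inner node `4`. -/
def nodeBody : Prog :=
  .load 5 15 4 ;; .load 7 14 4 ;; .sub 7 7 2 ;; .store 4 4 7 ;; .load 7 14 5 ;; .store 3 4 7 ;;
  .ite 1 5 (.store 2 4 5) (.store 2 4 4) ;; .add 4 4 2

/-- Set the parents and the labels of the inner nodes. -/
def labelNodes : Prog := .copy 4 0 ;; .loop 4 6 nodeBody ;; .copy 0 6

section Output

variable {n : ℕ} {G : SimpleGraph (Fin n)} {W : ℕ} {o : ℕ → Fin n} {N : ℕ} {s : State}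

/-- The gap next to position `j` whose range is the smallest core of the vertex there. -/
theorem CoreOrder.leaf_gap {q : ℕ → ℕ} (h : CoreOrder G o q n) (hG : ∀ v, ∃ w, G.Adj v w)
    (h0 : q 0 = 0) {j l : ℕ} (hj : j < n)
    (hl : l = if q j < coreness G (o j) then j + 1 else j) :
    1 ≤ l ∧ l < n ∧ q l = coreness G (o j) ∧ SameCore G (q l) (o l) (o j) := by
  split_ifs at hl with hc
  · subst hl
    obtain ⟨v, hv, hs⟩ := exists_sameCore_ne hG (le_refl (coreness G (o j)))
    obtain ⟨p, hp, rfl⟩ := h.exists_eq v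
    -- A companion of the vertex in its smallest core at an earlier position would force `coreness G
    -- (o j) ≤ q j`. So it comes later, and the gap `j + 1` lies between.
    have hpj : j < p := by
      by_contra! hcon
      rcases hcon.eq_or_lt with rfl | hlt
      · exact hv rfl
      · have := h.le_of_sameCore hj hp hs (l := j) (by omega) (by omega)
        omega
    have h1 := h.le_of_sameCore hj hp hs (l := j + 1) (by omega) (by omega)
    have h2 : SameCore G (q (j + 1)) (o j) (o (j + 1)) := h.link j (by omega)
    have h3 := h2.le_coreness_left fun e => by
      have := h.inj _ _ hj (by omega) e
      omega
    exact ⟨by omega, by omega, le_antisymm h3 h1, h2.symm⟩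
  · subst hl
    -- Position `0` has weight `0`, below any coreness, so it falls under the other case.
    have h1 : 1 ≤ l := by
      rcases Nat.eq_zero_or_pos l with rfl | h1
      · have := one_le_coreness G hG (o 0)
        omega
      · exact h1
    exact ⟨h1, hj, le_antisymm (h.le_coreness h1 hj) (by omega), SameCore.refl _ _⟩

/-- The parents of the vertices at the positions before `i` have been set since the state `s₀`. -/
structure LeafInv {n : ℕ} (G : SimpleGraph (Fin n)) (o : ℕ → Fin n) (q : ℕ → ℕ) (N i : ℕ)
    (s₀ s : State) : Prop where
  var_zero : s.var 0 = n
  var_one : s.var 1 = 0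
  var_two : s.var 2 = 1
  var_four : s.var 4 = i
  var_six : s.var 6 = N
  le : i ≤ n
  frame : ∀ a, a ≠ 2 → s.arr a = s₀.arr a
  par : ∀ j < i, s.arr 2 (o j) = s₀.arr 16 (if q j < coreness G (o j) then j + 1 else j)

theorem linkLeaves_spec {q : ℕ → ℕ} (hv0 : s.var 0 = n) (hv1 : s.var 1 = 0) (hv2 : s.var 2 = 1)
    (hv6 : s.var 6 = N) (hord : ∀ i < n, s.arr 12 i = o i) (h : CoreOrder G o q n)
    (h13 : s.arr 13 = q) (hcore : ∀ v : Fin n, s.arr 4 v = coreness G v) (hW : n ≤ W) :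
    wp W linkLeaves s fun t s' => t ≤ 9 * n + 2 ∧ LeafInv G o q N n s s' := by
  unfold linkLeaves
  simp only [wp_seq, wp_copy]
  refine wp_loop (fun τ s' => ∃ i, 9 * (n - i) ≤ τ ∧ LeafInv G o q N i s s') ?_
    (τ := 9 * n) (s := s.setVar 4 (s.var 1)) ⟨0, by omega, hv0, hv1, hv2, hv1, hv6,
      Nat.zero_le _, fun _ _ => rfl, by omega⟩ ?_
  · rintro τ s' ⟨i, hτ, hi⟩ hc
    rw [hi.var_four, hi.var_zero] at hc
    have key : ∀ s'' : State, s''.var 4 = i + 1 → (∀ y, y < 4 ∨ y = 6 → s''.var y = s'.var y) →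
        s''.arr 2 = Function.update (s'.arr 2) (o i)
          (s.arr 16 (if q i < coreness G (o i) then i + 1 else i)) →
        (∀ a, a ≠ 2 → s''.arr a = s'.arr a) →
        ∃ i, 9 * (n - i) ≤ τ - 9 ∧ LeafInv G o q N i s s'' := by
      intro s'' h4' hv e2 ha'
      refine ⟨i + 1, by omega, (hv 0 (by omega)).trans hi.var_zero,
        (hv 1 (by omega)).trans hi.var_one, (hv 2 (by omega)).trans hi.var_two, h4',
        (hv 6 (by omega)).trans hi.var_six, hc,
        fun a h => (ha' a h).trans (hi.frame a h), fun j hj => ?_⟩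
      rw [e2]
      rcases Nat.lt_succ_iff_lt_or_eq.1 hj with hj | rfl
      · rw [Function.update_of_ne fun e => by
          have := h.inj j i (by omega) hc (Fin.ext e)
          omega]
        exact hi.par j hj
      · rw [Function.update_self]
    unfold leafBody
    simp only [wp, State.var_setVar, State.arr_setVar, State.var_setArr,
      Nat.reduceEqDiff, reduceIte, hi.var_four, hi.var_two, hi.frame 12 (by omega),
      hi.frame 13 (by omega), hi.frame 4 (by omega), hi.frame 16 (by omega), hord i hc, h13, hcore]
    refine ⟨by omega, ?_, ?_⟩ <;> intro hq <;>
      refine ⟨by omega, τ - 9, by omega, key _ ?_ ?_ ?_ ?_⟩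
    any_goals try simp only [State.var_setVar, State.arr_setVar, State.var_setArr,
      State.arr_setArr, Nat.reduceEqDiff, reduceIte]
    any_goals
      intro y hy
      simp only [if_neg (show y ≠ 4 by omega), if_neg (show y ≠ 5 by omega),
        if_neg (show y ≠ 7 by omega), if_neg (show y ≠ 8 by omega), if_neg (show y ≠ 9 by omega)]
    any_goals
      intro a ha'
      rw [if_neg ha']
    · rw [if_pos hq]
    · rw [if_neg hq]
  · rintro t τ s' ⟨i, hτ, hi⟩ hc ht
    rw [hi.var_four, hi.var_zero] at hc
    obtain rfl : i = n := le_antisymm hi.le (by omega)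
    exact ⟨by omega, hi⟩

/-- The inner nodes before `i` have been labelled since the state `s₀`. -/
structure NodeInv (n N i : ℕ) (s₀ s : State) : Prop where
  var_one : s.var 1 = 0
  var_two : s.var 2 = 1
  var_four : s.var 4 = i
  var_six : s.var 6 = N
  ge : n ≤ i
  le : i ≤ N
  lvl : s.arr 14 = s₀.arr 14
  par : s.arr 15 = s₀.arr 15
  old : ∀ v < n, s.arr 2 v = s₀.arr 2 v ∧ s.arr 3 v = s₀.arr 3 v ∧ s.arr 4 v = s₀.arr 4 v
  new : ∀ x, n ≤ x → x < i →
    s.arr 2 x = (if s₀.arr 15 x = 0 then x else s₀.arr 15 x) ∧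
    s.arr 3 x = s₀.arr 14 (s₀.arr 15 x) ∧ s.arr 4 x = s₀.arr 14 x - 1

theorem labelNodes_spec (hv0 : s.var 0 = n) (hv1 : s.var 1 = 0) (hv2 : s.var 2 = 1)
    (hv6 : s.var 6 = N) (hN : n ≤ N) (hN' : N ≤ 2 * n) (hW : 2 * n ≤ W) :
    wp W labelNodes s fun t s' => t ≤ 10 * n + 3 ∧ s'.var 0 = N ∧
      (∀ v < n, s'.arr 2 v = s.arr 2 v ∧ s'.arr 3 v = s.arr 3 v ∧ s'.arr 4 v = s.arr 4 v) ∧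
      ∀ x, n ≤ x → x < N →
        s'.arr 2 x = (if s.arr 15 x = 0 then x else s.arr 15 x) ∧
        s'.arr 3 x = s.arr 14 (s.arr 15 x) ∧ s'.arr 4 x = s.arr 14 x - 1 := by
  unfold labelNodes
  simp only [wp_seq, wp_copy]
  refine wp_loop (fun τ s' => ∃ i, 10 * (N - i) ≤ τ ∧ NodeInv n N i s s') ?_
    (τ := 10 * n) (s := s.setVar 4 (s.var 0)) ⟨n, by omega, hv1, hv2, hv0, hv6, le_rfl, hN, rfl,
      rfl, fun _ _ => ⟨rfl, rfl, rfl⟩, by omega⟩ ?_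
  · rintro τ s' ⟨i, hτ, hi⟩ hc
    rw [hi.var_four, hi.var_six] at hc
    have hge := hi.ge
    have key : ∀ s'' : State, s''.var 4 = i + 1 →
        (∀ y, y = 1 ∨ y = 2 ∨ y = 6 → s''.var y = s'.var y) →
        s''.arr 2 = Function.update (s'.arr 2) i (if s.arr 15 i = 0 then i else s.arr 15 i) →
        s''.arr 3 = Function.update (s'.arr 3) i (s.arr 14 (s.arr 15 i)) →
        s''.arr 4 = Function.update (s'.arr 4) i (s.arr 14 i - 1) →
        s''.arr 14 = s'.arr 14 → s''.arr 15 = s'.arr 15 →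
        ∃ i, 10 * (N - i) ≤ τ - 10 ∧ NodeInv n N i s s'' := by
      intro s'' h4' hv e2 e3 e4 e14 e15
      refine ⟨i + 1, by omega, (hv 1 (by omega)).trans hi.var_one,
        (hv 2 (by omega)).trans hi.var_two, h4', (hv 6 (by omega)).trans hi.var_six, by omega, hc,
        e14.trans hi.lvl, e15.trans hi.par, fun v hvn => ?_, fun x hx hxi => ?_⟩
      · rw [e2, e3, e4, Function.update_of_ne (by omega), Function.update_of_ne (by omega),
          Function.update_of_ne (by omega)]
        exact hi.old v hvn
      · rw [e2, e3, e4]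
        rcases Nat.lt_succ_iff_lt_or_eq.1 hxi with hxi | rfl
        · rw [Function.update_of_ne (by omega), Function.update_of_ne (by omega),
            Function.update_of_ne (by omega)]
          exact hi.new x hx hxi
        · simp only [Function.update_self, and_self]
    unfold nodeBody
    simp only [wp, State.var_setVar, State.arr_setVar, State.var_setArr, State.arr_setArr,
      Nat.reduceEqDiff, reduceIte, hi.var_four, hi.var_two, hi.var_one, hi.lvl, hi.par]
    constructor <;> intro hq <;>
      refine ⟨by omega, τ - 10, by omega, key _ ?_ ?_ ?_ ?_ ?_ ?_ ?_⟩
    any_goals try simp only [State.var_setVar, State.arr_setVar, State.var_setArr,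
      State.arr_setArr, Nat.reduceEqDiff, reduceIte]
    any_goals
      intro y hy
      simp only [if_neg (show y ≠ 4 by omega), if_neg (show y ≠ 5 by omega),
        if_neg (show y ≠ 7 by omega)]
    · rw [if_neg (by omega)]
    · rw [if_pos (by omega)]
  · rintro t τ s' ⟨i, hτ, hi⟩ hc ht
    rw [hi.var_four, hi.var_six] at hc
    obtain rfl : i = N := le_antisymm hi.le (by omega)
    exact ⟨by omega, hi.var_six, hi.old, hi.new⟩

end Output

/-! ## The whole program -/

/-- The program that computes the core-connectivity tree. -/
def coreTreeProgram : Prog := prepare ;; peel ;; search ;; build ;; linkLeaves ;; labelNodes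

theorem coreTreeProgram_spec {n : ℕ} {G : SimpleGraph (Fin n)} {W : ℕ} {s : State}
    (hs : IsInput G s) (hn : 0 < n) (hG : ∀ v, ∃ w, G.Adj v w)
    (hW : 2 * n + s.arr 0 n + 1 ≤ W) :
    wp W coreTreeProgram s fun t s' => t ≤ 123 * n + 54 * s.arr 0 n + 50 ∧ IsOutput G s' := by
  have hA := hs.arcs
  unfold coreTreeProgram
  simp only [wp_seq]
  refine wp_mono (prepare_spec hs (by omega)) ?_
  rintro t₁ s₁ ⟨ht₁, LA, LB, h₁⟩
  refine wp_mono (peel_spec h₁ hA (by omega)) ?_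
  rintro t₂ s₂ ⟨ht₂, hb₂, hmin₂, hmax₂, hf₂⟩
  refine wp_mono (search_spec h₁ hA (by omega) hn hb₂ hmin₂ hmax₂ hf₂) ?_
  rintro t₃ s₃ ⟨ht₃, o, h₃⟩
  refine wp_mono (build_spec h₃ hA hn (by omega)) ?_
  rintro t₄ s₄ ⟨ht₄, N, h₄⟩
  have hmax₄ : ∀ v : Fin n, s₄.arr 4 v = coreness G v := fun v => by
    rw [h₄.frame 4 (by omega), h₃.core_max]
  have hmin₄ : ∀ v : Fin n, s₄.arr 3 v = coreness G v := fun v => by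
    rw [h₄.frame 3 (by omega), h₃.core_min]
  refine wp_mono (linkLeaves_spec h₄.var_zero h₄.var_one h₄.var_two h₄.var_six
    (fun i hi => by rw [h₄.frame 12 (by omega), h₃.ord i hi]) h₃.order (h₄.frame 13 (by omega))
    hmax₄ (by omega)) ?_
  rintro t₅ s₅ ⟨ht₅, h₅⟩
  have hf₅ := h₅.frame
  have hNn := h₄.le'
  refine wp_mono (labelNodes_spec h₅.var_zero h₅.var_one h₅.var_two h₅.var_six h₄.le
    (by omega) (by omega)) ?_
  rintro t₆ s₆ ⟨ht₆, v0', hold₆, hnew₆⟩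
  have hT := h₄.tree
  refine ⟨by omega, OutputSpec.isOutput (nd := s₄.arr 16) (lvl := s₄.arr 14) (par := s₄.arr 15)
    ?_ hT h₃.order hG⟩
  rw [← hf₅ 14 (by omega), ← hf₅ 15 (by omega)]
  refine ⟨v0', h₄.le, fun v => ?_, fun v => ?_, fun v => ?_, fun x h1 h2 => (hnew₆ x h1 h2).1,
    fun x h1 h2 => (hnew₆ x h1 h2).2.2, fun x h1 h2 => (hnew₆ x h1 h2).2.1⟩
  · rw [(hold₆ v v.2).2.1, hf₅ 3 (by omega), hmin₄]
  · rw [(hold₆ v v.2).2.2, hf₅ 4 (by omega), hmax₄]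
  · obtain ⟨j, hj, rfl⟩ := h₃.order.exists_eq v
    obtain ⟨h1, h2, h3, h4⟩ := h₃.order.leaf_gap hG h₃.gap_zero hj rfl
    exact ⟨_, h1, h2, (hold₆ _ (o j).2).1.trans (h₅.par j hj), h3, h4⟩

/-! ### The factor `α(n)` and the word size -/

/-- Since `A(0, 0) = 1 < n`. No other property of `α` is used: the program is linear. -/
theorem one_le_invAck {n : ℕ} (hn : 2 ≤ n) : 1 ≤ invAck n := by
  have hne : {k | n ≤ ack k k}.Nonempty := ⟨n, (lt_ack_left n n).le⟩
  by_contra! hcon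
  have h := Nat.sInf_mem hne
  have h0 : sInf {k | n ≤ ack k k} = 0 := by
    change invAck n = 0
    omega
  rw [h0] at h
  have h' : n ≤ ack 0 0 := h
  rw [ack_zero] at h'
  omega

theorem IsInput.boundedBy {n : ℕ} {G : SimpleGraph (Fin n)} {s : State} (hs : IsInput G s)
    {W : ℕ} (hW : n + s.arr 0 n ≤ W) : s.BoundedBy W := by
  have hA := hs.arcs
  constructor
  · intro x
    by_cases hx : x = 0
    · rw [hx, hs.var_zero]
      omega
    · rw [hs.var_other x hx]
      omega
  · intro a i
    rcases (show a = 0 ∨ a = 1 ∨ 2 ≤ a by omega) with rfl | rfl | ha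
    · by_cases hi : i ≤ n
      · have := hA.off_mono hi le_rfl
        omega
      · rw [hs.off_other i (by omega)]
        omega
    · by_cases hi : i < s.arr 0 n
      · have := hs.adj_lt i hi
        omega
      · rw [hs.adj_other i (by omega)]
        omega
    · rw [hs.arr_other a ha i]
      omega

end CoreTree

/-- For graphs without isolated vertices, with `n ≥ 1` vertices and `m` edges: the core-connectivity
tree has `O(n)` nodes, and one program for a random access machine computes it in time
`O(n + m α(n))`, using only numbers of size `O(n + m)`. -/
theorem theorem1 :
    (∃ C : ℕ, ∀ (n : ℕ) (G : SimpleGraph (Fin n)), 0 < n → (∀ v, ∃ w, G.Adj v w) →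
      Finite (CoreTree.Node G) ∧ Nat.card (CoreTree.Node G) ≤ C * n) ∧
    (∃ (P : CoreTree.Prog) (C K : ℕ), ∀ (n : ℕ) (G : SimpleGraph (Fin n)),
      0 < n → (∀ v, ∃ w, G.Adj v w) →
      ∀ s : CoreTree.State, CoreTree.IsInput G s →
        s.BoundedBy (K * (n + G.edgeSet.ncard)) ∧
        ∃ (t : ℕ) (s' : CoreTree.State),
          CoreTree.Exec (K * (n + G.edgeSet.ncard)) P s t s' ∧
          t ≤ C * (n + G.edgeSet.ncard * CoreTree.invAck n) ∧
          CoreTree.IsOutput G s') := by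
  open CoreTree in
  -- With `2m` arcs the program needs words up to `2n + 2m + 1 ≤ 3 (n + m)` and at most `123 n + 108
  -- m + 50 ≤ 200 (n + m)` steps.
  refine ⟨⟨2, fun n G hn hG => ?_⟩, coreTreeProgram, 200, 3, fun n G hn hG s hs => ?_⟩
  · have : Nonempty (Fin n) := ⟨⟨0, hn⟩⟩
    obtain ⟨o, q, h⟩ := CoreOrder.exists_full G
    rw [Nat.card_fin] at h
    exact h.finite_node_and_card_le hG
  · have hA := hs.arcs
    have hM := hA.arcs_eq
    -- A vertex has a neighbour other than itself.
    have hn2 : 2 ≤ n := by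
      obtain ⟨w, hw⟩ := hG ⟨0, hn⟩
      by_contra! hcon
      have hw0 : w = ⟨0, hn⟩ := Fin.ext (by have := w.2; change (w : ℕ) = 0; omega)
      exact hw.ne hw0.symm
    have hα : G.edgeSet.ncard ≤ G.edgeSet.ncard * invAck n :=
      Nat.le_mul_of_pos_right _ (one_le_invAck hn2)
    refine ⟨hs.boundedBy (by omega), ?_⟩
    obtain ⟨t, s', he, ht, ho⟩ := wp_sound (coreTreeProgram_spec hs hn hG
      (W := 3 * (n + G.edgeSet.ncard)) (by omega))
    exact ⟨t, s', he, by omega, ho⟩
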